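/- Let $M$ be an oriented smooth $3$-manifold. For $w\in\mathbb{R}$ let $\Lambda^0(w)$ be the line bundle of densities of projective weight $w$ on $M$: an element $f$ of its fibre at $x$ has a value $f(\varepsilon)\in\mathbb{R}$ for every non-zero volume form $\varepsilon$ on $T_xM$ and $f(t\varepsilon)=|t|^{w/4}f(\varepsilon)$ (thus $\Lambda^3\cong\Lambda^0(-4)$); put $\Lambda^1(w)=\Lambda^1\otimes\Lambda^0(w)$. Suppose given on $M$ * a projective structure, i.e. a class of smooth torsion-free connections on $TM$ modulo $\nabla_XY\mapsto\nabla_XY+\Upsilon(X)Y+\Upsilon(Y)X$ for smooth $1$-forms $\Upsilon$; * a smooth section $\phi$ of $\Lambda^1(2)$ with $\nabla_{(a}\phi_{b)}=0$ (a projectively invariant equation); * a smooth section $\psi$ of $\Lambda^1(1)$. Let $\pi:C\to M$ be the configuration space of flying saucers, i.e. the five-dimensional manifold of pairs $c=(x,[p])$ with $x\in M$, $0\neq p\in T_x^*M$ and $[p]$ the class of $p$ modulo positive rescaling. Let $P\subset\pi^*TM$ be the tautological bundle of planes $P_c=\ker p$, let $H\subset TC$ be the contact distribution $H=(d\pi)^{-1}(P)$,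 and let $S=\pi^*\Lambda^0(2/3)\oplus\pi^*\Lambda^0(-1/3)$, a bundle of rank two on $C$. Let $U\subset C$ be the set of all $c$ at which the restrictions of $\phi$ and $\psi$ to $P_c$ are linearly independent. Then: 1. $U$ is open, and $\pi(U)$ is the set of all points of $M$ at which $\phi$ and $\psi$ are linearly independent. 2. There is a unique $G_2$ contact structure $\Phi:\bigodot^3S\to H$ on $U$ that is given by the following formula. For $c=(x,[p])\in U$, for any representative $p$ of $c$, any positive volume form $\varepsilon$ on $T_xM$ and any connection $\nabla$ in the projective class, write $\phi,\psi,\sigma,\tau$ for the values of these weighted quantities in the scale $\varepsilon$, define $\Theta\in\mathbb{R}$ by $p\wedge\phi\wedge\psi=\Theta\,\varepsilon$, let $E^1,E^2\in T_cC$ be the $\nabla$-horizontal lifts of the basis of $P_c$ dual to $(\phi|_{P_c},\psi|_{P_c})$, and let $E_1,E_2\in\ker d\pi$ be $\Theta$ times the velocities at $t=0$ of the curves $(x,[p+t\phi])$ and $(x,[p+t\psi])$. Then $$\Phi(s\odot s\odot s)=\sigma^3E^1+\sigma^2\tau\,E^2+\tau^3E_1-3\sigma\tau^2E_2\qquad\text{for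 all }s=(\sigma,\tau)\in S_c .$$ In particular this vector does not depend on the choice of $p$, $\varepsilon$ and $\nabla$, so that the construction is canonical. Here the horizontal lift to $c$ of $X\in T_xM$ is $ds(X)$, where $s(y)=(y,[\eta_y])$ for a local nowhere vanishing $1$-form $\eta$ with $s(x)=c$ and $(\nabla_X\eta)_x=0$. That $\Phi$ is a $G_2$ contact structure on $U$ means that $\Phi:\bigodot^3S|_U\to H|_U$ is a smooth isomorphism of vector bundles that is compatible with the Levi form $H\times H\to TC/H$, $(X,Y)\mapsto[X,Y]\bmod H$: at each $c\in U$ there are a non-zero alternating bilinear form $\nu$ on $S_c$ and a non-zero $\ell\in T_cC/H_c$ such that the Levi form takes the pair $(\Phi(s\odot s\odot s),\Phi(t\odot t\odot t))$ to $\nu(s,t)^3\,\ell$ for all $s,t\in S_c$. The vectors $\Phi(s\odot s\odot s)$, $s\in S_c$, form the twisted cubic cone in $H_c$. -/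

import Mathlib

open scoped Manifold ContDiff Topology TensorProduct

noncomputable section

namespace FlyingSaucer

open Set Bundle

/-- The model space of the three-manifold `M`. -/
abbrev E3 : Type := EuclideanSpace ℝ (Fin 3)

/-- The (five-dimensional) model space of the configuration space. -/
abbrev E5 : Type := E3 × ℝ × ℝ

section Configuration

variable {M : Type*} [TopologicalSpace M] [ChartedSpace E3 M]

/-- The cotangent space `T_x^*M`. -/
abbrev Cotangent (x : M) : Type := TangentSpace (𝓡 3) x →L[ℝ] ℝ

variable (M) in
/-- The configuration space `C` of oriented saucers in `M`: a point `x ∈ M` together with a class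
of non-zero covectors `p ∈ T_x^*M` modulo positive rescaling (an oriented two-plane in `T_xM`).
The projection `π : C → M` is `ConfigSpace.pt`. -/
structure ConfigSpace where
  /-- the position of the saucer -/
  pt : M
  /-- the oriented plane of the saucer, as a ray of covectors annihilating it -/
  ray : Module.Ray ℝ (Cotangent pt)

/-- The covector `dx⁰ + a dx¹ + b dx²` on the model space. -/
def affineCovector (a b : ℝ) : E3 →L[ℝ] ℝ :=
  EuclideanSpace.proj (𝕜 := ℝ) (0 : Fin 3) + a • EuclideanSpace.proj (𝕜 := ℝ) (1 : Fin 3)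
    + b • EuclideanSpace.proj (𝕜 := ℝ) (2 : Fin 3)

theorem affineCovector_apply (a b : ℝ) (v : E3) :
    affineCovector a b v = v 0 + a * v 1 + b * v 2 := rfl

instance (x : M) : Nonempty (Module.Ray ℝ (Cotangent x)) :=
  ⟨rayOfNeZero ℝ (affineCovector 0 0) (fun h => by
    have := DFunLike.congr_fun h (EuclideanSpace.single (0 : Fin 3) (1 : ℝ))
    change affineCovector 0 0 (EuclideanSpace.single (0 : Fin 3) (1 : ℝ)) = 0 at this
    rw [affineCovector_apply] at this
    simp at this)⟩

open Classical in
/-- The saucer `(x, [p])` for `p ≠ 0` (and an arbitrary saucer at `x` for `p = 0`). -/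
def saucer (x : M) (p : Cotangent x) : ConfigSpace M :=
  ⟨x, if hp : p ≠ 0 then rayOfNeZero ℝ p hp else Classical.arbitrary _⟩

namespace ConfigSpace

/-- Some non-zero covector `p` in the class of the saucer. -/
def covector (c : ConfigSpace M) : Cotangent c.pt := c.ray.someVector

theorem covector_ne_zero (c : ConfigSpace M) : c.covector ≠ 0 := c.ray.someVector_ne_zero

theorem saucer_eq {c : ConfigSpace M} {p : Cotangent c.pt} {r : ℝ} (hr : 0 < r)
    (h : c.covector = r • p) : saucer c.pt p = c := by
  have hp : p ≠ 0 := by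
    rintro rfl
    exact c.covector_ne_zero (by simpa using h)
  have key : rayOfNeZero ℝ p hp = c.ray := by
    rw [← c.ray.someVector_ray, ray_eq_iff]
    have h' : c.ray.someVector = r • p := h
    rw [h']
    exact SameRay.sameRay_pos_smul_right p hr
  simp only [saucer, dif_pos hp, key]

theorem saucer_of_ne_zero {x : M} {p : Cotangent x} (hp : p ≠ 0) :
    saucer x p = ⟨x, rayOfNeZero ℝ p hp⟩ := by
  simp only [saucer, dif_pos hp]

theorem exists_covector_mk {x : M} {p : Cotangent x} (hp : p ≠ 0) :
    ∃ r : ℝ, 0 < r ∧ (⟨x, rayOfNeZero ℝ p hp⟩ : ConfigSpace M).covector = r • p := by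
  have h2 : SameRay ℝ (rayOfNeZero ℝ p hp).someVector p :=
    (ray_eq_iff (Module.Ray.someVector_ne_zero _) hp).1 (Module.Ray.someVector_ray _)
  obtain ⟨r, hr, h⟩ := h2.symm.exists_pos_left hp (Module.Ray.someVector_ne_zero _)
  exact ⟨r, hr, h.symm⟩

variable [IsManifold (𝓡 3) ∞ M]

/-- The `i`-th vector at `x` of the coordinate frame given by the chart of `M` around `x₀` followed
by the linear change of coordinates `A`. -/
def frameVec (x₀ : M) (A : E3 ≃L[ℝ] E3) (x : M) (i : Fin 3) : TangentSpace (𝓡 3) x :=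
  tangentCoordChange (𝓡 3) x₀ x x (A (EuclideanSpace.single i 1))

/-- The covector `dx⁰ + a dx¹ + b dx²` at `x`, in the coordinates given by the chart of `M` around
`x₀` followed by the linear change of coordinates `A`. -/
def chartCovector (x₀ : M) (A : E3 ≃L[ℝ] E3) (a b : ℝ) (x : M) : Cotangent x :=
  ((affineCovector a b).comp (A.symm : E3 →L[ℝ] E3)).comp (tangentCoordChange (𝓡 3) x x₀ x)

theorem chartCovector_frameVec (x₀ : M) (A : E3 ≃L[ℝ] E3) (a b : ℝ) {x : M}
    (hx : x ∈ (chartAt E3 x₀).source) : chartCovector x₀ A a b x (frameVec x₀ A x 0) = 1 ∧ 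
     chartCovector x₀ A a b x (frameVec x₀ A x 1) = a ∧
     chartCovector x₀ A a b x (frameVec x₀ A x 2) = b := by
  have key : ∀ i, chartCovector x₀ A a b x (frameVec x₀ A x i) =
      affineCovector a b (EuclideanSpace.single i 1) := by
    intro i
    change affineCovector a b (A.symm (tangentCoordChange (𝓡 3) x x₀ x
      (tangentCoordChange (𝓡 3) x₀ x x (A (EuclideanSpace.single i 1))))) = _
    rw [tangentCoordChange_comp (by simp [hx]), tangentCoordChange_self (by simp [hx]),
      ContinuousLinearEquiv.symm_apply_apply]
  refine ⟨?_, ?_, ?_⟩ <;> rw [key, affineCovector_apply] <;> simp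


/-- The components of a covector representing the saucer in such a coordinate frame. -/
def pairing (x₀ : M) (A : E3 ≃L[ℝ] E3) (c : ConfigSpace M) (i : Fin 3) : ℝ :=
  c.covector (frameVec x₀ A c.pt i)

theorem pairing_mk (x₀ x : M) (A A' : E3 ≃L[ℝ] E3) (a b : ℝ)
    (hx : x ∈ (chartAt E3 x₀).source) :
    ∃ r : ℝ, 0 < r ∧ ∀ (x₁ : M) (i : Fin 3),
      pairing x₁ A' (saucer x (chartCovector x₀ A a b x)) i =
        r * chartCovector x₀ A a b x (frameVec x₁ A' x i) := by
  have hp : chartCovector x₀ A a b x ≠ 0 := by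
    intro h
    have := (chartCovector_frameVec x₀ A a b hx).1
    rw [h] at this
    exact zero_ne_one this
  rw [saucer_of_ne_zero hp]
  obtain ⟨r, hr, h⟩ := exists_covector_mk hp
  refine ⟨r, hr, fun x₁ i => ?_⟩
  rw [pairing, h]
  rfl

/-- The affine coordinates `(x, [p]) ↦ (x, p₁ / p₀, p₂ / p₀)`. -/
def chartFun (x₀ : M) (A : E3 ≃L[ℝ] E3) (c : ConfigSpace M) : E5 :=
  (chartAt E3 x₀ c.pt, pairing x₀ A c 1 / pairing x₀ A c 0, pairing x₀ A c 2 / pairing x₀ A c 0)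

/-- The inverse of the affine coordinates, `(x, a, b) ↦ (x, [dx⁰ + a dx¹ + b dx²])`. -/
def chartInv (x₀ : M) (A : E3 ≃L[ℝ] E3) (y : E5) : ConfigSpace M :=
  saucer ((chartAt E3 x₀).symm y.1) (chartCovector x₀ A y.2.1 y.2.2 ((chartAt E3 x₀).symm y.1))

theorem covector_eq (x₀ : M) (A : E3 ≃L[ℝ] E3) (c : ConfigSpace M)
    (hx : c.pt ∈ (chartAt E3 x₀).source) (h0 : pairing x₀ A c 0 ≠ 0) :
    c.covector = pairing x₀ A c 0 • chartCovector x₀ A (pairing x₀ A c 1 / pairing x₀ A c 0)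
      (pairing x₀ A c 2 / pairing x₀ A c 0) c.pt := by
  refine ContinuousLinearMap.ext fun (v : E3) => ?_
  set w : E3 := A.symm (tangentCoordChange (𝓡 3) c.pt x₀ c.pt v) with hw
  have hv : v = tangentCoordChange (𝓡 3) x₀ c.pt c.pt (A w) := by
    rw [hw, ContinuousLinearEquiv.apply_symm_apply,
      tangentCoordChange_comp (w := c.pt) (x := x₀) (y := c.pt) (by simp [hx]),
      tangentCoordChange_self (by simp)]
  have hw3 : w = ∑ i, w i • (EuclideanSpace.single i 1 : E3) := by
    ext j
    simp [Fin.sum_univ_three]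
    fin_cases j <;> simp
  have hv3 : v = ∑ i, w i • frameVec x₀ A c.pt i := by
    conv_lhs => rw [hv, hw3]
    simp only [map_sum, map_smul]
    rfl
  have hl : c.covector v = ∑ i, w i * pairing x₀ A c i := by
    conv_lhs => rw [hv3]
    simp only [map_sum, map_smul]
    rfl
  rw [hl]
  change _ = pairing x₀ A c 0 * affineCovector _ _ w
  rw [affineCovector_apply, Fin.sum_univ_three]
  field_simp

/-- An affine chart of the configuration space, defined where `p₀ > 0`. -/
def chart (x₀ : M) (A : E3 ≃L[ℝ] E3) : PartialEquiv (ConfigSpace M) E5 where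
  toFun := chartFun x₀ A
  invFun := chartInv x₀ A
  source := {c | c.pt ∈ (chartAt E3 x₀).source ∧ 0 < pairing x₀ A c 0}
  target := {y | y.1 ∈ (chartAt E3 x₀).target}
  map_source' c hc := (chartAt E3 x₀).map_source hc.1
  map_target' y hy := by
    have hx := (chartAt E3 x₀).map_target hy
    refine ⟨hx, ?_⟩
    obtain ⟨r, hr, h⟩ := pairing_mk x₀ _ A A y.2.1 y.2.2 hx
    rw [chartInv, h x₀ 0, (chartCovector_frameVec x₀ A y.2.1 y.2.2 hx).1, mul_one]
    exact hr
  left_inv' c hc := by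
    have h1 : (chartAt E3 x₀).symm (chartFun x₀ A c).1 = c.pt := (chartAt E3 x₀).left_inv hc.1
    rw [chartInv, h1]
    exact saucer_eq hc.2 (covector_eq x₀ A c hc.1 hc.2.ne')
  right_inv' y hy := by
    have hx := (chartAt E3 x₀).map_target hy
    obtain ⟨r, hr, h⟩ := pairing_mk x₀ _ A A y.2.1 y.2.2 hx
    obtain ⟨h0, h1, h2⟩ := chartCovector_frameVec x₀ A y.2.1 y.2.2 hx
    rw [chartFun, chartInv, h x₀ 0, h x₀ 1, h x₀ 2, h0, h1, h2]
    refine Prod.ext ((chartAt E3 x₀).right_inv hy) (Prod.ext ?_ ?_)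
    · change r * y.2.1 / (r * 1) = y.2.1
      field_simp
    · change r * y.2.2 / (r * 1) = y.2.2
      field_simp

theorem exists_frame (c : ConfigSpace M) : ∃ A : E3 ≃L[ℝ] E3, 0 < pairing c.pt A c 0 := by
  obtain ⟨v, hv⟩ : ∃ v : E3, 0 < c.covector v := by
    obtain ⟨v, hv⟩ := DFunLike.ne_iff.1 c.covector_ne_zero
    rcases lt_or_gt_of_ne hv with h | h
    · exact ⟨-v, by rw [map_neg]; exact neg_pos.2 h⟩
    · exact ⟨v, h⟩
  have hv0 : (v : E3) ≠ 0 := fun h => by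
    have : c.covector v = c.covector 0 := congrArg c.covector h
    rw [map_zero] at this
    exact hv.ne' this
  obtain ⟨A, hA⟩ : ∃ A : E3 ≃L[ℝ] E3, A (EuclideanSpace.single 0 1) = v :=
    SeparatingDual.exists_continuousLinearEquiv_apply_eq (by simp) hv0
  refine ⟨A, ?_⟩
  have : frameVec c.pt A c.pt 0 = v := by
    rw [frameVec, hA, tangentCoordChange_self (by simp)]
  rw [pairing, this]
  exact hv

/-- The components of `dx⁰ + a dx¹ + b dx²` in a second coordinate frame. -/
def transVal (x₀ x₁ : M) (A A' : E3 ≃L[ℝ] E3) (i : Fin 3) (y : E5) : ℝ :=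
  affineCovector y.2.1 y.2.2 (A.symm (tangentCoordChange (𝓡 3) x₁ x₀ ((chartAt E3 x₀).symm y.1)
    (A' (EuclideanSpace.single i 1))))

theorem transVal_eq (x₀ x₁ : M) (A A' : E3 ≃L[ℝ] E3) (i : Fin 3) {y : E5}
    (hy : y.1 ∈ (chartAt E3 x₀).target) (hy' : (chartAt E3 x₀).symm y.1 ∈ (chartAt E3 x₁).source) :
    chartCovector x₀ A y.2.1 y.2.2 ((chartAt E3 x₀).symm y.1)
      (frameVec x₁ A' ((chartAt E3 x₀).symm y.1) i) = transVal x₀ x₁ A A' i y := by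
  change affineCovector _ _ (A.symm (tangentCoordChange (𝓡 3) _ x₀ _
      (tangentCoordChange (𝓡 3) x₁ _ _ (A' (EuclideanSpace.single i 1))))) = _
  rw [tangentCoordChange_comp (by simp [hy', (chartAt E3 x₀).map_target hy])]
  rfl

theorem contDiffOn_transVal (x₀ x₁ : M) (A A' : E3 ≃L[ℝ] E3) (i : Fin 3) :
    ContDiffOn ℝ ∞ (transVal x₀ x₁ A A' i)
      {y | y.1 ∈ ((chartAt E3 x₀).symm ≫ₕ chartAt E3 x₁).source} := by
  have hT : ContDiffOn ℝ ∞ (fun y : E5 =>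
      tangentCoordChange (𝓡 3) x₁ x₀ ((chartAt E3 x₀).symm y.1))
      {y | y.1 ∈ ((chartAt E3 x₀).symm ≫ₕ chartAt E3 x₁).source} := by
    have : IsManifold (𝓡 3) (∞ + 1) M := by
      have h : (∞ + 1 : ℕ∞ω) = ∞ := rfl
      rwa [h]
    have h1 := contDiffOn_fderiv_coord_change (I := 𝓡 3) (n := ∞) (achart E3 x₁) (achart E3 x₀)
    have h2 := contDiffOn_ext_coord_change (I := 𝓡 3) (n := ∞) x₁ x₀
    refine (h1.comp (h2.comp (t := (((extChartAt (𝓡 3) x₀).symm ≫ extChartAt (𝓡 3) x₁).source))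
      contDiff_fst.contDiffOn ?_) ?_).congr ?_
    · intro y hy
      simpa using! hy
    · rintro y ⟨hy, hy'⟩
      have := (chartAt E3 x₀).map_target hy
      change (chartAt E3 x₀).symm y.1 ∈ (chartAt E3 x₁).source at hy'
      simp [hy', this]
    · rintro y ⟨hy, hy'⟩
      simp [tangentBundleCore_coordChange]
  have hA := (hT.clm_apply (contDiffOn_const (c := A' (EuclideanSpace.single i 1))))
  have hB := A.symm.contDiff.comp_contDiffOn hA
  have hp (j : Fin 3) := (EuclideanSpace.proj (𝕜 := ℝ) j : E3 →L[ℝ] ℝ).contDiff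
    (n := ∞) |>.comp_contDiffOn hB
  have ha : ContDiff ℝ ∞ fun y : E5 => y.2.1 := contDiff_snd.fst
  have hb : ContDiff ℝ ∞ fun y : E5 => y.2.2 := contDiff_snd.snd
  exact ((hp 0).add (ha.contDiffOn.mul (hp 1))).add (hb.contDiffOn.mul (hp 2))

theorem trans_source (x₀ x₁ : M) (A A' : E3 ≃L[ℝ] E3) :
    ((chart x₀ A).symm.trans (chart x₁ A')).source =
      {y | y.1 ∈ ((chartAt E3 x₀).symm ≫ₕ chartAt E3 x₁).source} ∩
        transVal x₀ x₁ A A' 0 ⁻¹' Ioi 0 := by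
  ext y
  simp only [PartialEquiv.trans_source, mem_inter_iff, mem_ofPred_eq, mem_preimage, mem_Ioi,
    OpenPartialHomeomorph.trans_source]
  change (y.1 ∈ (chartAt E3 x₀).target ∧ (chartAt E3 x₀).symm y.1 ∈ (chartAt E3 x₁).source ∧
    0 < pairing x₁ A' (chartInv x₀ A y) 0) ↔ (y.1 ∈ (chartAt E3 x₀).target ∧
      (chartAt E3 x₀).symm y.1 ∈ (chartAt E3 x₁).source) ∧ _
  rw [and_assoc]
  refine and_congr_right fun hy => and_congr_right fun hy' => ?_
  obtain ⟨r, hr, h⟩ := pairing_mk x₀ _ A A' y.2.1 y.2.2 ((chartAt E3 x₀).map_target hy)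
  rw [chartInv, h x₁ 0, transVal_eq x₀ x₁ A A' 0 hy hy']
  exact mul_pos_iff_of_pos_left hr

theorem trans_eqOn (x₀ x₁ : M) (A A' : E3 ≃L[ℝ] E3) :
    EqOn ((chart x₀ A).symm.trans (chart x₁ A'))
      (fun y => (((chartAt E3 x₀).symm ≫ₕ chartAt E3 x₁) y.1,
        transVal x₀ x₁ A A' 1 y / transVal x₀ x₁ A A' 0 y,
        transVal x₀ x₁ A A' 2 y / transVal x₀ x₁ A A' 0 y))
      ((chart x₀ A).symm.trans (chart x₁ A')).source := by
  intro y hy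
  rw [trans_source] at hy
  obtain ⟨⟨hy, hy'⟩, h0⟩ := hy
  obtain ⟨r, hr, h⟩ := pairing_mk x₀ _ A A' y.2.1 y.2.2 ((chartAt E3 x₀).map_target hy)
  change chartFun x₁ A' (chartInv x₀ A y) = _
  rw [chartFun, chartInv, h x₁ 0, h x₁ 1, h x₁ 2, transVal_eq x₀ x₁ A A' 0 hy hy',
    transVal_eq x₀ x₁ A A' 1 hy hy', transVal_eq x₀ x₁ A A' 2 hy hy',
    mul_div_mul_left _ _ hr.ne', mul_div_mul_left _ _ hr.ne']
  rfl

theorem isOpen_trans_source (x₀ x₁ : M) (A A' : E3 ≃L[ℝ] E3) :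
    IsOpen ((chart x₀ A).symm.trans (chart x₁ A')).source := by
  rw [trans_source]
  exact (contDiffOn_transVal x₀ x₁ A A' 0).continuousOn.isOpen_inter_preimage
    ((((chartAt E3 x₀).symm ≫ₕ chartAt E3 x₁).open_source).preimage continuous_fst) isOpen_Ioi

theorem contDiffOn_trans (x₀ x₁ : M) (A A' : E3 ≃L[ℝ] E3) :
    ContDiffOn ℝ ∞ ((chart x₀ A).symm.trans (chart x₁ A'))
      ((chart x₀ A).symm.trans (chart x₁ A')).source := by
  refine ContDiffOn.congr ?_ (trans_eqOn x₀ x₁ A A')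
  rw [trans_source]
  have hT (i) := (contDiffOn_transVal x₀ x₁ A A' i).mono
    (inter_subset_left (t := transVal x₀ x₁ A A' 0 ⁻¹' Ioi 0))
  have hne : ∀ y ∈ {y : E5 | y.1 ∈ ((chartAt E3 x₀).symm ≫ₕ chartAt E3 x₁).source} ∩
        transVal x₀ x₁ A A' 0 ⁻¹' Ioi 0, transVal x₀ x₁ A A' 0 y ≠ 0 := fun y hy => hy.2.ne'
  refine ContDiffOn.prodMk ?_ (((hT 1).div (hT 0) hne).prodMk ((hT 2).div (hT 0) hne))
  have h := contDiffOn_ext_coord_change (I := 𝓡 3) (n := ∞) x₁ x₀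
  refine ContDiffOn.comp (t := ((chartAt E3 x₀).symm ≫ₕ chartAt E3 x₁).source)
    ?_ contDiff_fst.contDiffOn (fun y hy => hy.1)
  simpa using! h

variable (M) in
/-- The smooth atlas of the configuration space that consists of all the affine charts. -/
def atlasCore : ChartedSpaceCore E5 (ConfigSpace M) where
  atlas := {e | ∃ x₀ A, e = chart x₀ A}
  chartAt c := chart c.pt c.exists_frame.choose
  mem_chart_source c := ⟨mem_chart_source E3 c.pt, c.exists_frame.choose_spec⟩
  chart_mem_atlas c := ⟨_, _, rfl⟩
  open_source := by
    rintro _ _ ⟨x₀, A, rfl⟩ ⟨x₁, A', rfl⟩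
    exact isOpen_trans_source x₀ x₁ A A'
  continuousOn_toFun := by
    rintro _ _ ⟨x₀, A, rfl⟩ ⟨x₁, A', rfl⟩
    exact (contDiffOn_trans x₀ x₁ A A').continuousOn

instance : TopologicalSpace (ConfigSpace M) := (atlasCore M).toTopologicalSpace

instance : ChartedSpace E5 (ConfigSpace M) := (atlasCore M).toChartedSpace

instance : IsManifold 𝓘(ℝ, E5) ∞ (ConfigSpace M) := by
  apply isManifold_of_contDiffOn
  intro e e' he he'
  change e ∈ ⋃ (f : PartialEquiv (ConfigSpace M) E5) (hf : f ∈ (atlasCore M).atlas),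
    {(atlasCore M).openPartialHomeomorph f hf} at he
  change e' ∈ ⋃ (f : PartialEquiv (ConfigSpace M) E5) (hf : f ∈ (atlasCore M).atlas),
    {(atlasCore M).openPartialHomeomorph f hf} at he'
  simp only [mem_iUnion, mem_singleton_iff] at he he'
  obtain ⟨_, ⟨x₀, A, rfl⟩, rfl⟩ := he
  obtain ⟨_, ⟨x₁, A', rfl⟩, rfl⟩ := he'
  simpa using! contDiffOn_trans x₀ x₁ A A'

end ConfigSpace

end Configuration

section Geometry

variable {M : Type*} [TopologicalSpace M] [ChartedSpace E3 M]

/-! ### Vector fields, forms, densities and orientations on `M` -/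

/-- The volume forms (including zero) on `T_xM`, i.e. the fibre of `Λ³` at `x`. -/
abbrev VolForm (x : M) : Type := TangentSpace (𝓡 3) x [⋀^Fin 3]→ₗ[ℝ] ℝ

/-- Wedge product of three covectors: `(p ∧ q ∧ r)(v₀, v₁, v₂)` is the determinant of the
matrix of the values of `p, q, r` on `v₀, v₁, v₂`. -/
def wedge {x : M} (p q r : Cotangent x) : VolForm x :=
  Matrix.detRowAlternating.compLinearMap (LinearMap.pi ![p.toLinearMap, q.toLinearMap,
    r.toLinearMap])

section
variable [IsManifold (𝓡 3) ∞ M]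

/-- The vector field `Y` on `M` is differentiable at `x`. -/
def DiffFieldAt (Y : ∀ x : M, TangentSpace (𝓡 3) x) (x : M) : Prop :=
  MDifferentiableAt (𝓡 3) (𝓡 3).tangent (fun y => (⟨y, Y y⟩ : TangentBundle (𝓡 3) M)) x

/-- The vector field `Y` on `M` is smooth. -/
def SmoothField (Y : ∀ x : M, TangentSpace (𝓡 3) x) : Prop :=
  ContMDiff (𝓡 3) (𝓡 3).tangent ∞ (fun y => (⟨y, Y y⟩ : TangentBundle (𝓡 3) M))

/-- A `1`-form on `M`, viewed as a section of the cotangent bundle. -/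
def formSection (η : ∀ x : M, Cotangent x) (x : M) :
    TotalSpace (E3 →L[ℝ] ℝ) (fun x : M => TangentSpace (𝓡 3) x →L[ℝ] Trivial M ℝ x) :=
  ⟨x, η x⟩

/-- The `1`-form `η` is differentiable at `x`. -/
def DiffFormAt (η : ∀ x : M, Cotangent x) (x : M) : Prop :=
  MDifferentiableAt (𝓡 3) ((𝓡 3).prod 𝓘(ℝ, E3 →L[ℝ] ℝ)) (formSection η) x

/-- The `1`-form `η` is smooth on the set `s`. -/
def SmoothFormOn (η : ∀ x : M, Cotangent x) (s : Set M) : Prop :=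
  ContMDiffOn (𝓡 3) ((𝓡 3).prod 𝓘(ℝ, E3 →L[ℝ] ℝ)) ∞ (formSection η) s

/-- The `3`-form `ε` on `M` is smooth: its values on smooth vector fields are smooth. -/
def SmoothVol (ε : ∀ x : M, VolForm x) : Prop :=
  ∀ Y : Fin 3 → ∀ x : M, TangentSpace (𝓡 3) x, (∀ i, SmoothField (Y i)) →
    ContMDiff (𝓡 3) 𝓘(ℝ, ℝ) ∞ (fun x => ε x (fun i => Y i x))

variable (M) in
/-- An orientation of the manifold `M`: an orientation of each tangent space, such that a smooth
`3`-form is positive on an open set. -/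
structure ManifoldOrientation where
  /-- the orientation of each tangent space -/
  at' : ∀ x : M, Orientation ℝ (TangentSpace (𝓡 3) x) (Fin 3)
  isOpen_pos : ∀ ε : ∀ x : M, VolForm x, SmoothVol ε →
    IsOpen {x | ∃ h : ε x ≠ 0, rayOfNeZero ℝ (ε x) h = at' x}

/-- `ε` is a positive volume form at `x`. -/
def ManifoldOrientation.IsPos (o : ManifoldOrientation M) {x : M} (ε : VolForm x) : Prop :=
  ∃ h : ε ≠ 0, rayOfNeZero ℝ ε h = o.at' x

end

/-- The fibre at `x` of the bundle of projective weight `w` with values in `W`: its elements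
have a value in `W` for every non-zero volume form (scale) `ε`, which is multiplied by `Ω ^ w` when
`ε` is replaced by `Ω⁴ ε`. The value at `ε = 0` carries no information and is set to `0`. -/
def Weighted (w : ℝ) (x : M) (W : Type*) [AddCommGroup W] [Module ℝ W] :
    Submodule ℝ (VolForm x → W) where
  carrier := {f | f 0 = 0 ∧ ∀ t : ℝ, t ≠ 0 → ∀ ε, f (t • ε) = (|t| ^ (w / 4)) • f ε}
  add_mem' := fun {f g} hf hg =>
    ⟨by simp [hf.1, hg.1], fun t ht ε => by simp [hf.2 t ht, hg.2 t ht]⟩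
  zero_mem' := ⟨rfl, fun t _ ε => by simp⟩
  smul_mem' := fun a f hf =>
    ⟨by simp [hf.1], fun t ht ε => by simp [hf.2 t ht, smul_comm a]⟩

/-- The fibre of `Λ⁰(w)`, the line bundle of densities of projective weight `w`. -/
abbrev Density (w : ℝ) (x : M) : Type _ := Weighted w x ℝ

/-- The fibre of `Λ¹(w)`, the bundle of `1`-forms of projective weight `w`. -/
abbrev WeightedCovector (w : ℝ) (x : M) : Type _ := Weighted w x (Cotangent x)

/-! ### Projective structures -/

section
variable [IsManifold (𝓡 3) ∞ M]

/-- A smooth section of `Λ¹(w)`: in every smooth scale it is a smooth `1`-form. -/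
def SmoothWeightedForm {w : ℝ} (φ : ∀ x : M, WeightedCovector w x) : Prop :=
  ∀ ε : ∀ x : M, VolForm x, SmoothVol ε → SmoothFormOn (fun x => (φ x).1 (ε x)) {x | ε x ≠ 0}

variable (M) in
/-- Connections on the tangent bundle of `M`; `∇ Y x X` is `∇_X Y` at `x`. -/
abbrev Connection : Type _ := CovariantDerivative (𝓡 3) E3 (TangentSpace (𝓡 3) : M → Type)

/-- `∇' _X Y = ∇_X Y + Υ(X) Y + Υ(Y) X` for some smooth `1`-form `Υ`. -/
def ProjectivelyEquivalent (cov cov' : Connection M) : Prop :=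
  ∃ Υ : ∀ x : M, Cotangent x, SmoothFormOn Υ univ ∧
    ∀ (x : M) (X : TangentSpace (𝓡 3) x) (Y : ∀ x : M, TangentSpace (𝓡 3) x), DiffFieldAt Y x →
      cov' Y x X = cov Y x X + Υ x X • Y x + Υ x (Y x) • X

/-- Smooth torsion-free connections on the tangent bundle of `M`. -/
def IsSmoothTorsionFree (cov : Connection M) : Prop :=
  CovariantDerivative.ContMDiffCovariantDerivative cov ∞ ∧ cov.torsion = 0

variable (M) in
/-- A projective structure: a projective equivalence class of smooth torsion-free connections. -/
structure ProjectiveStructure where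
  /-- the connections in the class -/
  connections : Set (Connection M)
  nonempty : connections.Nonempty
  isSmoothTorsionFree : ∀ cov ∈ connections, IsSmoothTorsionFree cov
  mem_iff : ∀ cov ∈ connections, ∀ cov' : Connection M, IsSmoothTorsionFree cov' →
    (cov' ∈ connections ↔ ProjectivelyEquivalent cov cov')

/-- The derivative `X f` of the function `f` along the tangent vector `X` at `x`. -/
def dirDeriv (f : M → ℝ) (x : M) (X : TangentSpace (𝓡 3) x) : ℝ :=
  mfderiv (𝓡 3) 𝓘(ℝ, ℝ) f x X

/-- The value `(∇_X η)(Y) = X (η(Y)) - η(∇_X Y)` at `x` of the covariant derivative of a `1`-form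
`η`, for a tangent vector `X` at `x` and a vector field `Y`. -/
def formDeriv (cov : Connection M) (η : ∀ x : M, Cotangent x) (x : M) (X : TangentSpace (𝓡 3) x)
    (Y : ∀ x : M, TangentSpace (𝓡 3) x) : ℝ :=
  dirDeriv (fun y => η y (Y y)) x X - η x (cov Y x X)

/-- The `3`-form `ε` satisfies `∇ε = 0` at the point `x`. -/
def ParallelAt (cov : Connection M) (ε : ∀ x : M, VolForm x) (x : M) : Prop :=
  ∀ (X : TangentSpace (𝓡 3) x) (Y : Fin 3 → ∀ x : M, TangentSpace (𝓡 3) x),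
    (∀ i, DiffFieldAt (Y i) x) →
    dirDeriv (fun y => ε y (fun i => Y i y)) x X =
      ∑ i, ε x (Function.update (fun j => Y j x) i (cov (Y i) x X))

/-- The equation `∇_(a φ_b) = 0` for a section `φ` of `Λ¹(w)`. The covariant derivative of `φ` at
`x` is computed in any scale `ε` with `∇ε = 0` at `x`. -/
def KillingEquation {w : ℝ} (cov : Connection M) (φ : ∀ x : M, WeightedCovector w x) : Prop :=
  ∀ (x : M) (ε : ∀ x : M, VolForm x), SmoothVol ε → ε x ≠ 0 → ParallelAt cov ε x →
    ∀ X Y : ∀ x : M, TangentSpace (𝓡 3) x, DiffFieldAt X x → DiffFieldAt Y x →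
      formDeriv cov (fun y => (φ y).1 (ε y)) x (X x) Y +
        formDeriv cov (fun y => (φ y).1 (ε y)) x (Y x) X = 0

/-! ### The contact distribution -/

/-- The tautological subbundle `P ⊂ π^*TM`: the plane of the saucer. -/
def plane (c : ConfigSpace M) : Submodule ℝ (TangentSpace (𝓡 3) c.pt) :=
  LinearMap.ker c.covector.toLinearMap

/-- The contact distribution `H ⊂ TC`: the inverse image of `P` under `dπ : TC → π^*TM`. -/
def contactH (c : ConfigSpace M) : Submodule ℝ (TangentSpace 𝓘(ℝ, E5) c) :=
  (plane c).comap (mfderiv 𝓘(ℝ, E5) (𝓡 3) ConfigSpace.pt c).toLinearMap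

/-- The vector field `X` on the configuration space is smooth on the set `W`. -/
def SmoothConfigFieldOn (X : ∀ c : ConfigSpace M, TangentSpace 𝓘(ℝ, E5) c)
    (W : Set (ConfigSpace M)) : Prop :=
  ContMDiffOn 𝓘(ℝ, E5) 𝓘(ℝ, E5).tangent ∞
    (fun c => (⟨c, X c⟩ : TangentBundle 𝓘(ℝ, E5) (ConfigSpace M))) W

/-- `p` is a non-zero covector representing the saucer `c`. -/
def ConfigSpace.IsRep (c : ConfigSpace M) (p : Cotangent c.pt) : Prop :=
  p ≠ 0 ∧ saucer c.pt p = c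

/-- The vertical tangent vector at `c = (x, [p])` defined by the covector `ν`: the velocity at
`t = 0` of the curve `(x, [p + t ν])`. -/
def verticalVector (c : ConfigSpace M) (p ν : Cotangent c.pt) : TangentSpace 𝓘(ℝ, E5) c :=
  mfderiv 𝓘(ℝ, ℝ) 𝓘(ℝ, E5) (fun t : ℝ => saucer c.pt (p + t • ν)) 0 (1 : ℝ)

/-- `v ∈ T_cC` is the horizontal lift of `X ∈ T_xM` with respect to the connection: the image of
`X` under the derivative of a local section `y ↦ (y, [η_y])` through `c` with `∇_X η = 0`
at `x`. -/
def IsHorizontalLift (cov : Connection M) (c : ConfigSpace M) (X : TangentSpace (𝓡 3) c.pt)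
    (v : TangentSpace 𝓘(ℝ, E5) c) : Prop :=
  ∃ η : ∀ y : M, Cotangent y, (∀ y, η y ≠ 0) ∧ DiffFormAt η c.pt ∧ c.IsRep (η c.pt) ∧
    (∀ Y : ∀ x : M, TangentSpace (𝓡 3) x, DiffFieldAt Y c.pt → formDeriv cov η c.pt X Y = 0) ∧
    v = (mfderiv (𝓡 3) 𝓘(ℝ, E5) (fun y => saucer y (η y)) c.pt X : E5)

/-! ### `G₂` contact structures -/

/-- The fibre at `c` of the rank two bundle `S = π^*Λ⁰(2/3) ⊕ π^*Λ⁰(-1/3)`. -/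
abbrev Spinor (c : ConfigSpace M) : Type _ := Density (2 / 3) c.pt × Density (-1 / 3) c.pt

/-- The section `s` of `S` is smooth on `W`: its components are smooth functions in every
smooth scale. -/
def SmoothSpinorOn (s : ∀ c : ConfigSpace M, Spinor c) (W : Set (ConfigSpace M)) : Prop :=
  ∀ ε : ∀ x : M, VolForm x, SmoothVol ε →
    ContMDiffOn 𝓘(ℝ, E5) 𝓘(ℝ, ℝ) ∞ (fun c => (s c).1.1 (ε c.pt)) (W ∩ {c | ε c.pt ≠ 0}) ∧
    ContMDiffOn 𝓘(ℝ, E5) 𝓘(ℝ, ℝ) ∞ (fun c => (s c).2.1 (ε c.pt)) (W ∩ {c | ε c.pt ≠ 0})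

/-- The simple vector `s ⊙ s ⊙ s` in the third symmetric power of `S`. -/
def cube {c : ConfigSpace M} (s : Spinor c) : Sym[ℝ]^3 (Spinor c) :=
  SymmetricPower.tprod ℝ (fun _ : Fin 3 => s)

/-- A field of isomorphisms `⊙³S ≅ H` on `U` is a `G₂` contact structure if it is smooth and
compatible with the Levi form `H × H → TC / H`, `(X, Y) ↦ [X, Y] mod H`. Compatibility means that
the Levi form is, up to scale, the invariant symplectic form on `⊙³S`, that is
`(s ⊙ s ⊙ s, t ⊙ t ⊙ t) ↦ ν(s, t)³ ℓ` for an area form `ν` on `S` and a non-zero `ℓ ∈ TC / H`. -/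
structure IsG2ContactStructure (U : Set (ConfigSpace M))
    (Φ : ∀ c : U, Sym[ℝ]^3 (Spinor c.1) ≃ₗ[ℝ] contactH c.1) : Prop where
  smooth : ∀ W ⊆ U, IsOpen W → ∀ s : Fin 3 → ∀ c : ConfigSpace M, Spinor c,
    (∀ i, SmoothSpinorOn (s i) W) → ∀ Z : ∀ c : ConfigSpace M, TangentSpace 𝓘(ℝ, E5) c,
    (∀ c : U, c.1 ∈ W → Z c.1 = Φ c (SymmetricPower.tprod ℝ (fun i => s i c.1))) →
    SmoothConfigFieldOn Z W
  levi : ∀ c : U, ∃ ν : Spinor c.1 [⋀^Fin 2]→ₗ[ℝ] ℝ, ν ≠ 0 ∧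
    ∃ l : TangentSpace 𝓘(ℝ, E5) c.1, l ∉ contactH c.1 ∧
    ∀ W : Set (ConfigSpace M), IsOpen W → c.1 ∈ W →
    ∀ X Y : ∀ c : ConfigSpace M, TangentSpace 𝓘(ℝ, E5) c,
    SmoothConfigFieldOn X W → SmoothConfigFieldOn Y W →
    (∀ d ∈ W, X d ∈ contactH d) → (∀ d ∈ W, Y d ∈ contactH d) →
    ∀ s t : Spinor c.1, X c.1 = Φ c (cube s) → Y c.1 = Φ c (cube t) →
      VectorField.mlieBracket 𝓘(ℝ, E5) X Y c.1 - (ν ![s, t]) ^ 3 • l ∈ contactH c.1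

/-- The set of saucers at which the restrictions of `φ` and `ψ` to `P` are linearly independent
(i.e. `π^!φ ∧ π^!ψ` does not vanish). -/
def regularSet (φ : ∀ x : M, WeightedCovector 2 x) (ψ : ∀ x : M, WeightedCovector 1 x) :
    Set (ConfigSpace M) :=
  {c | ∀ ε : VolForm c.pt, ε ≠ 0 → LinearIndependent ℝ
    ![((φ c.pt).1 ε).toLinearMap.domRestrict (plane c),
      ((ψ c.pt).1 ε).toLinearMap.domRestrict (plane c)]}

end

end Geometry

end FlyingSaucer

end

open FlyingSaucer

/-!
At a saucer `c = (x, [p])` at which `φ` and `ψ` are independent on `P_c`, choose a gauge, that is a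
connection in the class, a representative `p` and a positive scale `ε`. The formula then defines a
linear map from `⊙³S_c`, identified with `ℝ⁴` through the coefficients `(σ³, σ²τ, στ², τ³)`, to
`H_c` (`Gauge.combination`). It is an isomorphism, because `E¹, E²` project to a basis of `P_c` and,
`p`, `φ`, `ψ` being independent, the vertical vectors of `φ` and `ψ` span the kernel of `dπ`
(`Gauge.equiv`). As cubes span `⊙³S_c`, the formula determines `Φ`, and this is the uniqueness.

The gauge does not matter (`Gauge.equiv_eq`). A projective change of the connection changes `∇_X η`
by `-Υ(X) η - η(X) Υ`; for `X ∈ P_c` the last term vanishes at `x`, and the first one does not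
change the velocity of the ray `[η]` (`liftCoords_congr`). Changes of `p` and `ε` rescale the
ingredients by powers whose product is `1` in each term. Since near any saucer the gauge can be chosen to depend
smoothly on the saucer, with the dual basis given by Cramer's rule, `Φ` is smooth
(`smooth_twistedCubic`).

For the Levi form, use affine coordinates `(x, a, b)` on `C` in which `H` is the kernel of
`θ = dx⁰ + a dx¹ + b dx²`. The value of `θ` on the bracket of two sections of `H` is then an
alternating bilinear expression in their values at the point (`contactForm_lieBracket`). On two
horizontal lifts it vanishes because the connection is torsion-free, on two vertical vectors it
vanishes trivially, and on a vertical vector and a lift it is the pairing of the covector with the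
vector (`levi_lift_add_vertical`). With the chosen dual basis the expression for the vectors
`Φ(s ⊙ s ⊙ s)` and `Φ(t ⊙ t ⊙ t)` is `Θ (στ' - τσ')³` (`levi_twistedCubic`).

All computations are based on the coordinates of the velocity of a moving saucer, see
`coordDeriv_mfderiv_saucer`.
-/

noncomputable section

namespace FlyingSaucer

open Set Bundle ConfigSpace

/-! ### Affine charts of the configuration space -/

section

variable {M : Type*} [TopologicalSpace M] [ChartedSpace E3 M]

theorem ConfigSpace.IsRep.exists_pos_smul {c : ConfigSpace M} {p : Cotangent c.pt}
    (h : c.IsRep p) : ∃ r : ℝ, 0 < r ∧ c.covector = r • p := by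
  obtain ⟨h0, h1⟩ := h
  rcases c with ⟨x, ray⟩
  change saucer x p = _ at h1
  change (p : Cotangent x) ≠ 0 at h0
  rw [ConfigSpace.saucer_of_ne_zero h0] at h1
  obtain ⟨r, hr, h⟩ := ConfigSpace.exists_covector_mk h0
  refine ⟨r, hr, ?_⟩
  rw [h1] at h
  exact h

theorem isRep_covector (c : ConfigSpace M) : c.IsRep c.covector :=
  ⟨c.covector_ne_zero, saucer_eq one_pos (one_smul ℝ _).symm⟩

theorem exists_covector_saucer {x : M} {p : Cotangent x} (hp : p ≠ 0) :
    ∃ r : ℝ, 0 < r ∧ (saucer x p).covector = r • p := by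
  rw [saucer_of_ne_zero hp]; exact exists_covector_mk hp

theorem ConfigSpace.IsRep.exists_smul_eq {c : ConfigSpace M} {p p' : Cotangent c.pt}
    (hp : c.IsRep p) (hp' : c.IsRep p') : ∃ r : ℝ, 0 < r ∧ p' = r • p := by
  obtain ⟨r, hr, h⟩ := IsRep.exists_pos_smul hp
  obtain ⟨s, hs, h'⟩ := IsRep.exists_pos_smul hp'
  refine ⟨s⁻¹ * r, by positivity, ?_⟩
  rw [mul_smul, ← h, h', smul_smul, inv_mul_cancel₀ hs.ne', one_smul]

theorem ConfigSpace.IsRep.smul {c : ConfigSpace M} {p : Cotangent c.pt} (hp : c.IsRep p) {r : ℝ}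
    (hr : 0 < r) : c.IsRep (r • p) := by
  obtain ⟨s, hs, h⟩ := IsRep.exists_pos_smul hp
  refine ⟨smul_ne_zero hr.ne' hp.1, saucer_eq (r := s * r⁻¹) (by positivity) ?_⟩
  rw [smul_smul, inv_mul_cancel_right₀ hr.ne', h]

variable [IsManifold (𝓡 3) ∞ M]

/-- The linear change of coordinates used in the preferred affine chart around `c₀`. -/
abbrev chartFrame (c₀ : ConfigSpace M) : E3 ≃L[ℝ] E3 := c₀.exists_frame.choose

/-- The coordinate frame of `M` that underlies the preferred chart of `C` around `c₀`. -/
abbrev chartVec (c₀ : ConfigSpace M) (x : M) (i : Fin 3) : TangentSpace (𝓡 3) x :=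
  frameVec c₀.pt (chartFrame c₀) x i

theorem extChartAt_apply (c₀ c : ConfigSpace M) :
    extChartAt 𝓘(ℝ, E5) c₀ c = chartFun c₀.pt (chartFrame c₀) c := rfl

theorem mem_chart_source_iff (c₀ c : ConfigSpace M) :
    c ∈ (chartAt E5 c₀).source ↔
      c.pt ∈ (chartAt E3 c₀.pt).source ∧ 0 < c.covector (chartVec c₀ c.pt 0) := Iff.rfl

theorem saucer_mem_chart_source_iff (c₀ : ConfigSpace M) {x : M} {p : Cotangent x} (hp : p ≠ 0) :
    saucer x p ∈ (chartAt E5 c₀).source ↔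
      x ∈ (chartAt E3 c₀.pt).source ∧ 0 < p (chartVec c₀ x 0) := by
  obtain ⟨r, hr, h⟩ := exists_covector_saucer hp
  rw [mem_chart_source_iff, h]
  change _ ∧ 0 < r * p (chartVec c₀ x 0) ↔ _
  rw [mul_pos_iff_of_pos_left hr]
  rfl

theorem chartFun_saucer (c₀ : ConfigSpace M) {x : M} {p : Cotangent x} (hp : p ≠ 0) :
    extChartAt 𝓘(ℝ, E5) c₀ (saucer x p) =
      (chartAt E3 c₀.pt x, p (chartVec c₀ x 1) / p (chartVec c₀ x 0),
        p (chartVec c₀ x 2) / p (chartVec c₀ x 0)) := by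
  obtain ⟨r, hr, h⟩ := exists_covector_saucer hp
  rw [extChartAt_apply, chartFun, pairing, pairing, pairing, h]
  change (_, r * p _ / (r * p _), r * p _ / (r * p _)) = _
  rw [mul_div_mul_left _ _ hr.ne', mul_div_mul_left _ _ hr.ne']
  rfl

theorem hasMFDerivAt_prodMk_space {N : Type*} {E : Type*} [NormedAddCommGroup E] [NormedSpace ℝ E]
    [TopologicalSpace N] {H : Type*} [TopologicalSpace H] [ChartedSpace H N]
    {I : ModelWithCorners ℝ E H} {n : N} {E' E'' : Type*} [NormedAddCommGroup E'] [NormedSpace ℝ E']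
    [NormedAddCommGroup E''] [NormedSpace ℝ E''] {f : N → E'} {g : N → E''}
    {f' : E →L[ℝ] E'} {g' : E →L[ℝ] E''}
    (hf : HasMFDerivAt I 𝓘(ℝ, E') f n f') (hg : HasMFDerivAt I 𝓘(ℝ, E'') g n g') :
    HasMFDerivAt I 𝓘(ℝ, E' × E'') (fun m => (f m, g m)) n (f'.prod g' : E →L[ℝ] E' × E'') :=
  ⟨hf.1.prodMk hg.1, hf.2.prodMk hg.2⟩

theorem hasMFDerivAt_real_div {N : Type*} {E : Type*} [NormedAddCommGroup E] [NormedSpace ℝ E]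
    [TopologicalSpace N] {H : Type*} [TopologicalSpace H] [ChartedSpace H N]
    {I : ModelWithCorners ℝ E H} {n : N} {f g : N → ℝ} {f' g' : E →L[ℝ] ℝ}
    (hf : HasMFDerivAt I 𝓘(ℝ, ℝ) f n f') (hg : HasMFDerivAt I 𝓘(ℝ, ℝ) g n g') (h0 : g n ≠ 0) :
    HasMFDerivAt I 𝓘(ℝ, ℝ) (fun m => f m / g m) n
      ((g n ^ 2)⁻¹ • (g n • f' - f n • g') : E →L[ℝ] ℝ) := by
  refine ⟨hf.1.div hg.1 h0, ?_⟩
  have h1 : HasFDerivWithinAt (writtenInExtChartAt I 𝓘(ℝ, ℝ) n f) f' (range I)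
    (extChartAt I n n) := hf.2
  have h2 : HasFDerivWithinAt (writtenInExtChartAt I 𝓘(ℝ, ℝ) n g) g' (range I)
    (extChartAt I n n) := hg.2
  have hg0 : writtenInExtChartAt I 𝓘(ℝ, ℝ) n g (extChartAt I n n) = g n := by
    simp only [mfld_simps]; rfl
  have hf0 : writtenInExtChartAt I 𝓘(ℝ, ℝ) n f (extChartAt I n n) = f n := by
    simp only [mfld_simps]; rfl
  have h3 := h1.mul (((hasDerivAt_inv (by rwa [hg0])).comp_hasFDerivWithinAt _ h2))
  refine (h3.congr_fderiv ?_).congr_of_eventuallyEq (Filter.Eventually.of_forall fun y => ?_) ?_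
  · ext v
    simp only [Function.comp, hg0, hf0]
    simp
    field_simp
    ring
  · simp [writtenInExtChartAt, div_eq_mul_inv]; rfl
  · simp [writtenInExtChartAt, div_eq_mul_inv]; rfl

/-- The derivative at `c` of the preferred chart of `C` around `c₀`. Its values are regarded as
elements of the model space, so that their components make sense. -/
def coordDeriv (c₀ c : ConfigSpace M) : TangentSpace 𝓘(ℝ, E5) c →L[ℝ] E5 :=
  mfderiv 𝓘(ℝ, E5) 𝓘(ℝ, E5) (extChartAt 𝓘(ℝ, E5) c₀) c

/-- The derivative of `(p₁ / p₀, p₂ / p₀)` when `p` moves with velocity `w`, i.e. the velocity of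
the ray `[p]` in affine coordinates. -/
def affDeriv (p w : Fin 3 → ℝ) : ℝ × ℝ :=
  ((w 1 * p 0 - p 1 * w 0) / p 0 ^ 2, (w 2 * p 0 - p 2 * w 0) / p 0 ^ 2)

/-- The chain rule for a map to `C` whose expression in a chart is differentiable. -/
theorem coordDeriv_mfderiv {N : Type*} {E : Type*} [NormedAddCommGroup E] [NormedSpace ℝ E]
    [TopologicalSpace N] {H : Type*} [TopologicalSpace H] [ChartedSpace H N]
    {I : ModelWithCorners ℝ E H} {f : N → ConfigSpace M} {n : N} (c₀ : ConfigSpace M)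
    (hs : ∀ᶠ m in 𝓝 n, f m ∈ (chartAt E5 c₀).source)
    (hd : MDifferentiableAt I 𝓘(ℝ, E5) (fun m => extChartAt 𝓘(ℝ, E5) c₀ (f m)) n)
    (v : TangentSpace I n) :
    coordDeriv c₀ (f n) (mfderiv I 𝓘(ℝ, E5) f n v) =
      mfderiv I 𝓘(ℝ, E5) (fun m => extChartAt 𝓘(ℝ, E5) c₀ (f m)) n v := by
  have h1 : f =ᶠ[𝓝 n] fun m => (extChartAt 𝓘(ℝ, E5) c₀).symm (extChartAt 𝓘(ℝ, E5) c₀ (f m)) := by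
    filter_upwards [hs] with m hm
    rw [(extChartAt 𝓘(ℝ, E5) c₀).left_inv (by simpa using hm)]
  have hf : MDifferentiableAt I 𝓘(ℝ, E5) f n := by
    refine MDifferentiableAt.congr_of_eventuallyEq ?_ h1
    refine MDifferentiableAt.comp n (I' := 𝓘(ℝ, E5))
      (g := (extChartAt 𝓘(ℝ, E5) c₀).symm) ?_ hd
    have := mdifferentiableWithinAt_extChartAt_symm (I := 𝓘(ℝ, E5))
      ((extChartAt 𝓘(ℝ, E5) c₀).map_source (by simpa using hs.self_of_nhds))
    simpa [mdifferentiableWithinAt_univ] using this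
  have := mfderiv_comp n (mdifferentiableAt_extChartAt (I := 𝓘(ℝ, E5)) hs.self_of_nhds) hf
  exact (congrArg (fun L => L v) this).symm

/-- The velocity of a family of saucers `(γ m, [q m])` in an affine chart. Of the covectors `q m`
only the components in the coordinate frame at the moving point `γ m` enter. -/
theorem coordDeriv_mfderiv_saucer {N : Type*} {E : Type*} [NormedAddCommGroup E] [NormedSpace ℝ E]
    [TopologicalSpace N] {H : Type*} [TopologicalSpace H] [ChartedSpace H N]
    {I : ModelWithCorners ℝ E H} (c₀ : ConfigSpace M) {n : N} (γ : N → M)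
    (q : ∀ m, Cotangent (γ m)) (hγ : MDifferentiableAt I (𝓡 3) γ n)
    (hn : γ n ∈ (chartAt E3 c₀.pt).source)
    (hq : ∀ i, MDifferentiableAt I 𝓘(ℝ, ℝ) (fun m => q m (chartVec c₀ (γ m) i)) n)
    (h0 : 0 < q n (chartVec c₀ (γ n) 0)) (v : TangentSpace I n) :
    coordDeriv c₀ (saucer (γ n) (q n))
        (mfderiv I 𝓘(ℝ, E5) (fun m => saucer (γ m) (q m)) n v) =
      ((mfderiv (𝓡 3) (𝓡 3) (chartAt E3 c₀.pt) (γ n) (mfderiv I (𝓡 3) γ n v),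
        affDeriv (fun i => q n (chartVec c₀ (γ n) i))
          (fun i => mfderiv I 𝓘(ℝ, ℝ) (fun m => q m (chartVec c₀ (γ m) i)) n v)) : E5) := by
  have hpos : ∀ᶠ m in 𝓝 n, 0 < q m (chartVec c₀ (γ m) 0) :=
    (hq 0).continuousAt.eventually (lt_mem_nhds h0)
  have hsrc : ∀ᶠ m in 𝓝 n, γ m ∈ (chartAt E3 c₀.pt).source :=
    hγ.continuousAt.eventually ((chartAt E3 c₀.pt).open_source.mem_nhds hn)
  have hne : ∀ m, 0 < q m (chartVec c₀ (γ m) 0) → q m ≠ 0 := by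
    intro m hm h
    rw [h] at hm
    exact lt_irrefl _ hm
  have heq : (fun m => extChartAt 𝓘(ℝ, E5) c₀ (saucer (γ m) (q m))) =ᶠ[𝓝 n] fun m =>
      ((chartAt E3 c₀.pt (γ m), q m (chartVec c₀ (γ m) 1) / q m (chartVec c₀ (γ m) 0),
        q m (chartVec c₀ (γ m) 2) / q m (chartVec c₀ (γ m) 0)) : E5) := by
    filter_upwards [hpos] with m hm
    exact chartFun_saucer c₀ (hne m hm)
  have hdiv := fun i => hasMFDerivAt_real_div (hq i).hasMFDerivAt (hq 0).hasMFDerivAt h0.ne'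
  have h1 := ((mdifferentiable_chart (I := 𝓡 3) c₀.pt).mdifferentiableAt hn).hasMFDerivAt.comp n
    hγ.hasMFDerivAt
  have h2 := (hasMFDerivAt_prodMk_space h1
    (hasMFDerivAt_prodMk_space (hdiv 1) (hdiv 2))).congr_of_eventuallyEq heq
  rw [coordDeriv_mfderiv (I := I) c₀ (f := fun m => saucer (γ m) (q m)) ?_ h2.mdifferentiableAt,
    h2.mfderiv]
  · have key : ∀ a b c d : ℝ, (a ^ 2)⁻¹ * (a * b - c * d) = (b * a - c * d) / a ^ 2 :=
      fun a b c d => by ring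
    refine Prod.ext rfl (Prod.ext ?_ ?_)
    · exact key _ _ _ _
    · exact key _ _ _ _
  · filter_upwards [hpos, hsrc] with m hm hm'
    exact (saucer_mem_chart_source_iff c₀ (hne m hm)).2 ⟨hm', hm⟩

end

/-! ### Vertical vectors and horizontal lifts in coordinates -/

section

variable {M : Type*} [TopologicalSpace M] [ChartedSpace E3 M] [IsManifold (𝓡 3) ∞ M]

/-- The coordinates of a tangent vector at `x` in the frame `frameVec x₀ A x`. -/
def frameCoord (x₀ : M) (A : E3 ≃L[ℝ] E3) (x : M) : TangentSpace (𝓡 3) x →L[ℝ] E3 :=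
  (A.symm : E3 →L[ℝ] E3).comp (tangentCoordChange (𝓡 3) x x₀ x)

theorem tangentCoordChange_frameVec {x₀ : M} (A : E3 ≃L[ℝ] E3) {x : M}
    (hx : x ∈ (chartAt E3 x₀).source) (i : Fin 3) :
    tangentCoordChange (𝓡 3) x x₀ x (frameVec x₀ A x i) = A (EuclideanSpace.single i 1) := by
  rw [frameVec, tangentCoordChange_comp (by simp [hx]), tangentCoordChange_self (by simp [hx])]

theorem frameCoord_frameVec {x₀ : M} (A : E3 ≃L[ℝ] E3) {x : M}
    (hx : x ∈ (chartAt E3 x₀).source) (i : Fin 3) :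
    frameCoord x₀ A x (frameVec x₀ A x i) = EuclideanSpace.single i 1 := by
  change A.symm (tangentCoordChange (𝓡 3) x x₀ x (frameVec x₀ A x i)) = _
  rw [tangentCoordChange_frameVec A hx, ContinuousLinearEquiv.symm_apply_apply]

theorem sum_frameCoord {x₀ : M} (A : E3 ≃L[ℝ] E3) {x : M}
    (hx : x ∈ (chartAt E3 x₀).source) (v : TangentSpace (𝓡 3) x) :
    ∑ i, frameCoord x₀ A x v i • frameVec x₀ A x i = v := by
  set w : E3 := frameCoord x₀ A x v with hw
  have hv : v = tangentCoordChange (𝓡 3) x₀ x x (A w) := by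
    change _ = tangentCoordChange (𝓡 3) x₀ x x (A (A.symm (tangentCoordChange (𝓡 3) x x₀ x v)))
    rw [ContinuousLinearEquiv.apply_symm_apply]
    exact ((tangentCoordChange_comp (by simp [hx])).trans
      (tangentCoordChange_self (I := 𝓡 3) (x := x) (z := x) (by simp))).symm
  have hw3 : w = ∑ i, w i • (EuclideanSpace.single i 1 : E3) := by
    ext j
    simp [Fin.sum_univ_three]
    fin_cases j <;> simp
  rw [hv]
  conv_rhs => rw [hw3]
  simp only [map_sum, map_smul]
  rfl

theorem mfderiv_chartAt_eq {x₀ x : M} (hx : x ∈ (chartAt E3 x₀).source) :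
    mfderiv (𝓡 3) (𝓡 3) (chartAt E3 x₀) x = tangentCoordChange (𝓡 3) x x₀ x :=
  (TangentBundle.continuousLinearMapAt_trivializationAt (I := 𝓡 3) hx).symm.trans
    (TangentBundle.continuousLinearMapAt_trivializationAt_eq_core hx)

theorem contMDiffAt_frameVec {x₀ : M} (A : E3 ≃L[ℝ] E3) {x : M}
    (hx : x ∈ (chartAt E3 x₀).source) (i : Fin 3) :
    ContMDiffAt (𝓡 3) (𝓡 3).tangent ∞
      (fun y => (⟨y, frameVec x₀ A y i⟩ : TangentBundle (𝓡 3) M)) x := by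
  rw [Trivialization.contMDiffAt_section_iff
    (e := trivializationAt E3 (TangentSpace (𝓡 3)) x₀) hx]
  refine (contMDiffAt_const (c := A (EuclideanSpace.single i 1))).congr_of_eventuallyEq ?_
  filter_upwards [(chartAt E3 x₀).open_source.mem_nhds hx] with y hy
  exact tangentCoordChange_frameVec A hy i

theorem diffFieldAt_frameVec {x₀ : M} (A : E3 ≃L[ℝ] E3) {x : M}
    (hx : x ∈ (chartAt E3 x₀).source) (i : Fin 3) :
    DiffFieldAt (fun y => frameVec x₀ A y i) x :=
  (contMDiffAt_frameVec A hx i).mdifferentiableAt (by simp)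

theorem DiffFormAt.apply {η : ∀ x : M, Cotangent x} {Y : ∀ x : M, TangentSpace (𝓡 3) x} {x : M}
    (hη : DiffFormAt η x) (hY : DiffFieldAt Y x) :
    MDifferentiableAt (𝓡 3) 𝓘(ℝ, ℝ) (fun y => η y (Y y)) x := by
  have := MDifferentiableAt.clm_bundle_apply (E₂ := Trivial M ℝ) (F₂ := ℝ) (b := fun y : M => y)
    (ϕ := fun y => η y) (v := fun y => Y y) hη hY
  rw [mdifferentiableAt_totalSpace] at this
  exact this.2

/-- `(∇_X η)(Y)` depends on the field `Y` only through its value at the point. Thus the condition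
`∇_X η = 0` in the definition of a horizontal lift can be checked on a frame. -/
theorem tensorialAt_formDeriv (cov : Connection M) {η : ∀ x : M, Cotangent x} {x : M}
    (hη : DiffFormAt η x) (X : TangentSpace (𝓡 3) x) :
    TensorialAt (𝓡 3) E3 (formDeriv cov η x X) x where
  smul {f Y} hf hY := by
    have h2 : dirDeriv (fun y => η y ((f • Y) y)) x X =
        f x * dirDeriv (fun y => η y (Y y)) x X + η x (Y x) * mvfderiv (𝓡 3) f x X := by
      have h4 : (fun y => η y ((f • Y) y)) = f * fun y => η y (Y y) := by
        ext y; simp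
      rw [h4]
      exact congrArg (fun L => L X) (mvfderiv_mul hf (hη.apply hY))
    rw [formDeriv, h2, cov.isCovariantDerivativeOnUniv.leibniz hY hf, formDeriv]
    simp
    ring
  add {Y Z} hY hZ := by
    have h2 : dirDeriv (fun y => η y ((Y + Z) y)) x X =
        dirDeriv (fun y => η y (Y y)) x X + dirDeriv (fun y => η y (Z y)) x X := by
      have h4 : (fun y => η y ((Y + Z) y)) = (fun y => η y (Y y)) + fun y => η y (Z y) := by
        ext y; simp
      rw [h4]
      exact congrArg (fun L => L X) (mvfderiv_add (hη.apply hY) (hη.apply hZ))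
    rw [formDeriv, h2, cov.isCovariantDerivativeOnUniv.add hY hZ, formDeriv, formDeriv]
    simp
    ring

theorem ConfigSpace.IsRep.pos {c₀ c : ConfigSpace M} (hc : c ∈ (chartAt E5 c₀).source)
    {p : Cotangent c.pt} (hp : c.IsRep p) : 0 < p (chartVec c₀ c.pt 0) := by
  obtain ⟨r, hr, h⟩ := IsRep.exists_pos_smul hp
  have h1 := ((mem_chart_source_iff _ _).1 hc).2
  rw [h] at h1
  exact (mul_pos_iff_of_pos_left hr).1 h1

theorem coordDeriv_verticalVector {c₀ c : ConfigSpace M} (hc : c ∈ (chartAt E5 c₀).source)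
    {p : Cotangent c.pt} (hp : c.IsRep p) (ν : Cotangent c.pt) :
    coordDeriv c₀ c (verticalVector c p ν) =
      ((0, affDeriv (fun i => p (chartVec c₀ c.pt i)) fun i => ν (chartVec c₀ c.pt i)) : E5) := by
  have hp0 := IsRep.pos hc hp
  have hd : ∀ i, HasMFDerivAt 𝓘(ℝ, ℝ) 𝓘(ℝ, ℝ)
      (fun t : ℝ => (p + t • ν) (chartVec c₀ c.pt i)) 0
        (ContinuousLinearMap.toSpanSingleton ℝ (ν (chartVec c₀ c.pt i) : ℝ) : ℝ →L[ℝ] ℝ) := by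
    intro i
    refine HasFDerivAt.hasMFDerivAt ?_
    have := ((hasDerivAt_id (0 : ℝ)).mul_const (ν (chartVec c₀ c.pt i))).const_add
      (p (chartVec c₀ c.pt i))
    rw [one_mul] at this
    exact this.hasFDerivAt
  have key := coordDeriv_mfderiv_saucer (I := 𝓘(ℝ, ℝ)) c₀ (n := (0 : ℝ)) (fun _ => c.pt)
    (fun t => p + t • ν) mdifferentiableAt_const hc.1 (fun i => (hd i).mdifferentiableAt)
    (by simpa using hp0) (1 : ℝ)
  have h0 : saucer c.pt (p + (0 : ℝ) • ν) = c := by rw [zero_smul, add_zero]; exact hp.2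
  rw [h0] at key
  refine key.trans (congrArg₂ Prod.mk ?_
    (congrArg₂ affDeriv (funext fun i => ?_) (funext fun i => ?_)))
  · rw [mfderiv_const]
    exact map_zero (mfderiv (𝓡 3) (𝓡 3) (chartAt E3 c₀.pt) c.pt)
  · rw [zero_smul, add_zero]
  · rw [(hd i).mfderiv]
    exact one_mul (ν (chartVec c₀ c.pt i) : ℝ)

theorem formDeriv_frameVec_eq_zero (cov : Connection M) {η : ∀ x : M, Cotangent x} {x₀ x : M}
    (A : E3 ≃L[ℝ] E3) (hx : x ∈ (chartAt E3 x₀).source) (hη : DiffFormAt η x)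
    (X : TangentSpace (𝓡 3) x)
    (h : ∀ i, formDeriv cov η x X (fun y => frameVec x₀ A y i) = 0)
    (Y : ∀ x : M, TangentSpace (𝓡 3) x) (hY : DiffFieldAt Y x) : formDeriv cov η x X Y = 0 := by
  have ht := tensorialAt_formDeriv cov hη X
  rw [← TensorialAt.mkHom_apply ht hY, ← sum_frameCoord A hx (Y x), map_sum]
  refine Finset.sum_eq_zero fun i _ => ?_
  rw [map_smul]
  have := TensorialAt.mkHom_apply ht (diffFieldAt_frameVec A hx i)
  rw [h] at this
  exact (congrArg _ this).trans (smul_zero _)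

theorem affDeriv_smul_smul {r : ℝ} (hr : r ≠ 0) (p w : Fin 3 → ℝ) :
    affDeriv (r • p) (r • w) = affDeriv p w := by
  have key : ∀ a b c d : ℝ, (r * a * (r * b) - r * c * (r * d)) / (r * b) ^ 2 =
      (a * b - c * d) / b ^ 2 := by
    intro a b c d
    rw [show r * a * (r * b) - r * c * (r * d) = r ^ 2 * (a * b - c * d) by ring, mul_pow,
      mul_div_mul_left _ _ (pow_ne_zero 2 hr)]
  simp only [affDeriv, Pi.smul_apply, smul_eq_mul, key]

/-- The coordinates of the horizontal lift of `X` to `(x, [p])`: along a form `η` with `∇_X η = 0`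
and `η_x = p`, the component `η(F_i)` in the coordinate frame has the derivative `p(∇_X F_i)`. -/
def liftCoords (cov : Connection M) (c₀ : ConfigSpace M) {x : M} (p : Cotangent x)
    (X : TangentSpace (𝓡 3) x) : E5 :=
  (tangentCoordChange (𝓡 3) x c₀.pt x X,
    affDeriv (fun i => p (chartVec c₀ x i)) fun i => p (cov (fun y => chartVec c₀ y i) x X))

theorem coordDeriv_of_isHorizontalLift {cov : Connection M} {c₀ c : ConfigSpace M}
    (hc : c ∈ (chartAt E5 c₀).source) {X : TangentSpace (𝓡 3) c.pt}
    {v : TangentSpace 𝓘(ℝ, E5) c} (hv : IsHorizontalLift cov c X v) {p : Cotangent c.pt}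
    (hp : c.IsRep p) :
    coordDeriv c₀ c v = liftCoords cov c₀ p X := by
  obtain ⟨η, hη0, hη, hrep, hpar, rfl⟩ := hv
  have hd : ∀ i, MDifferentiableAt (𝓡 3) 𝓘(ℝ, ℝ) (fun y => η y (chartVec c₀ y i)) c.pt :=
    fun i => hη.apply (diffFieldAt_frameVec _ hc.1 i)
  have key := coordDeriv_mfderiv_saucer (I := 𝓡 3) c₀ (n := c.pt) (fun y => y) η
    mdifferentiableAt_id hc.1 hd (IsRep.pos hc hrep) X
  rw [hrep.2] at key
  refine key.trans ?_
  obtain ⟨r, hr, hpη⟩ : ∃ r : ℝ, r ≠ 0 ∧ η c.pt = r • p := by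
    obtain ⟨r, hr, h⟩ := IsRep.exists_pos_smul hp
    obtain ⟨s, hs, h'⟩ := IsRep.exists_pos_smul hrep
    refine ⟨s⁻¹ * r, by positivity, ?_⟩
    rw [mul_smul, ← h, h', smul_smul, inv_mul_cancel₀ hs.ne', one_smul]
  rw [liftCoords, ← affDeriv_smul_smul hr]
  refine congrArg₂ Prod.mk ?_ (congrArg₂ affDeriv (funext fun i => ?_) (funext fun i => ?_))
  · rw [mfderiv_chartAt_eq hc.1]
    exact congrArg (tangentCoordChange (𝓡 3) c.pt c₀.pt c.pt)
      (congrArg (fun L => L X) (mfderiv_id (I := 𝓡 3) (x := c.pt)))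
  · rw [hpη]; rfl
  · refine (sub_eq_zero.1 (hpar _ (diffFieldAt_frameVec _ hc.1 i))).trans ?_
    rw [hpη]; rfl

/-- Horizontal lifts exist. A form `η` with `η_x = p` and `∇η = 0` at `x` is one whose components in
the coordinate frame are affine functions of the coordinates, with linear part `v ↦ p(∇_v F_i)`. -/
theorem exists_isHorizontalLift (cov : Connection M) (c : ConfigSpace M)
    (X : TangentSpace (𝓡 3) c.pt) : ∃ v, IsHorizontalLift cov c X v := by
  set A := chartFrame c
  have hx : c.pt ∈ (chartAt E3 c.pt).source := mem_chart_source E3 c.pt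
  have hp0 : c.covector (frameVec c.pt A c.pt 0) ≠ 0 := c.exists_frame.choose_spec.ne'
  -- the components of the derivative of the form are those of `p ∘ ∇ F_i`
  set B : E3 →L[ℝ] E3 →L[ℝ] ℝ := ∑ i : Fin 3,
    ContinuousLinearMap.smulRightL ℝ E3 (E3 →L[ℝ] ℝ)
      ((c.covector.comp (cov (fun y => frameVec c.pt A y i) c.pt) : E3 →L[ℝ] ℝ))
      ((EuclideanSpace.proj (𝕜 := ℝ) i : E3 →L[ℝ] ℝ).comp (A.symm : E3 →L[ℝ] E3)) with hB
  let p : E3 →L[ℝ] ℝ := c.covector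
  set K : M → E3 →L[ℝ] ℝ := fun y => p +
    B (chartAt E3 c.pt y - chartAt E3 c.pt c.pt) with hK
  have hKx : K c.pt = p := by simp [hK]
  have hKd : HasMFDerivAt (𝓡 3) 𝓘(ℝ, E3 →L[ℝ] ℝ) K c.pt B := by
    have h1 : HasMFDerivAt (𝓡 3) 𝓘(ℝ, E3) (chartAt E3 c.pt) c.pt
        (ContinuousLinearMap.id ℝ E3) := by
      have := (mdifferentiableAt_extChartAt (I := 𝓡 3) hx).hasMFDerivAt
      rw [mfderiv_extChartAt_self] at this
      exact this
    have h2 : HasFDerivAt (fun w : E3 => p + B (w - chartAt E3 c.pt c.pt)) B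
        (chartAt E3 c.pt c.pt) :=
      (B.hasFDerivAt.comp _ ((hasFDerivAt_id _).sub_const _)).const_add p
    exact h2.hasMFDerivAt.comp c.pt h1
  set η₀ : ∀ y : M, Cotangent y := fun y => (K y).comp (tangentCoordChange (𝓡 3) y c.pt y) with hη₀
  have hη₀F : ∀ y ∈ (chartAt E3 c.pt).source, ∀ i, η₀ y (frameVec c.pt A y i) =
      K y (A (EuclideanSpace.single i 1)) := by
    intro y hy i
    exact congrArg (K y) (tangentCoordChange_frameVec A hy i)
  have hη₀x : η₀ c.pt = c.covector := by
    refine ContinuousLinearMap.ext fun (v : E3) => ?_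
    change K c.pt (tangentCoordChange (𝓡 3) c.pt c.pt c.pt v) = _
    rw [hKx, tangentCoordChange_self (by simp)]
    rfl
  have hη₀d : DiffFormAt η₀ c.pt := by
    refine (mdifferentiableAt_hom_bundle _).2 ⟨mdifferentiableAt_id, ?_⟩
    refine hKd.mdifferentiableAt.congr_of_eventuallyEq ?_
    filter_upwards [(chartAt E3 c.pt).open_source.mem_nhds hx] with y hy
    rw [ContinuousLinearMap.inCoordinates_eq hy (by trivial)]
    refine ContinuousLinearMap.ext fun (v : E3) => ?_
    exact congrArg (K y) (((trivializationAt E3 (TangentSpace (𝓡 3)) c.pt).continuousLinearEquivAt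
      ℝ y hy).apply_symm_apply v)
  classical
  -- `η₀` may vanish far from the point, where it is replaced by an arbitrary non-zero covector.
  have hne : ∀ᶠ y in 𝓝 c.pt, η₀ y ≠ 0 := by
    have := (hη₀d.apply (diffFieldAt_frameVec A hx 0)).continuousAt.eventually_ne
      (by rwa [hη₀x])
    filter_upwards [this] with y hy h0
    rw [h0] at hy
    exact hy rfl
  set η : ∀ y : M, Cotangent y := fun y =>
    if η₀ y ≠ 0 then η₀ y else (Classical.arbitrary (Module.Ray ℝ (Cotangent y))).someVector
  have hη : ∀ᶠ y in 𝓝 c.pt, η y = η₀ y := by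
    filter_upwards [hne] with y hy
    exact if_pos hy
  have hηx : η c.pt = c.covector := hη.self_of_nhds.trans hη₀x
  have hηd : DiffFormAt η c.pt := by
    refine MDifferentiableAt.congr_of_eventuallyEq hη₀d ?_
    filter_upwards [hη] with y hy
    simp only [formSection, hy]
  refine ⟨_, η, fun y => ?_, hηd, ?_, ?_, rfl⟩
  · by_cases h : η₀ y ≠ 0
    · simpa only [η, if_pos h] using h
    · simpa only [η, if_neg h] using Module.Ray.someVector_ne_zero _
  · rw [hηx]
    exact ⟨c.covector_ne_zero, saucer_eq one_pos (one_smul ℝ _).symm⟩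
  · refine formDeriv_frameVec_eq_zero cov A hx hηd X fun i => ?_
    have h1 : (fun y => η y (frameVec c.pt A y i)) =ᶠ[𝓝 c.pt]
        fun y => K y (A (EuclideanSpace.single i 1)) := by
      filter_upwards [hη, (chartAt E3 c.pt).open_source.mem_nhds hx] with y hy hy'
      rw [hy, hη₀F y hy']
    have h2 : HasMFDerivAt (𝓡 3) 𝓘(ℝ, ℝ) (fun y => K y (A (EuclideanSpace.single i 1))) c.pt
        (B.flip (A (EuclideanSpace.single i 1))) :=
      (ContinuousLinearMap.apply ℝ ℝ (A (EuclideanSpace.single i 1))).hasFDerivAt.hasMFDerivAt.comp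
        c.pt hKd
    rw [formDeriv, dirDeriv, h1.mfderiv_eq, h2.mfderiv, hηx]
    refine sub_eq_zero.2 ?_
    have hBX : ∀ v w : E3, B v w =
        ∑ j, c.covector (cov (fun y => frameVec c.pt A y j) c.pt v) * A.symm w j := by
      intro v w
      rw [hB, _root_.sum_apply, _root_.sum_apply]
      refine Finset.sum_congr rfl fun j _ => ?_
      rfl
    refine (hBX X _).trans ?_
    simp

end

/-! ### The third symmetric power of a plane -/

section SymmetricCube

variable {V W : Type*} [AddCommGroup V] [Module ℝ V] [AddCommGroup W] [Module ℝ W]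

/-- The linear map on the third symmetric power induced by a symmetric trilinear map. -/
def symLift (f : MultilinearMap ℝ (fun _ : Fin 3 => V) W)
    (hf : ∀ (e : Equiv.Perm (Fin 3)) (v : Fin 3 → V), f (fun i => v (e i)) = f v) :
    Sym[ℝ]^3 V →ₗ[ℝ] W where
  toFun := AddCon.lift (addConGen (SymmetricPower.Rel ℝ (Fin 3) V))
    (PiTensorProduct.lift f).toAddMonoidHom (AddCon.addConGen_le.2 (by
      rintro _ _ ⟨e, v⟩
      change PiTensorProduct.lift f (PiTensorProduct.tprod ℝ v) =
        PiTensorProduct.lift f (PiTensorProduct.tprod ℝ fun i => v (e i))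
      rw [PiTensorProduct.lift.tprod, PiTensorProduct.lift.tprod, hf e v]))
  map_add' x y := map_add _ x y
  map_smul' r x := by
    induction x using AddCon.induction_on with
    | _ x => exact map_smul (PiTensorProduct.lift f) r x

theorem symLift_tprod (f : MultilinearMap ℝ (fun _ : Fin 3 => V) W)
    (hf : ∀ (e : Equiv.Perm (Fin 3)) (v : Fin 3 → V), f (fun i => v (e i)) = f v)
    (v : Fin 3 → V) : symLift f hf (SymmetricPower.tprod ℝ v) = f v :=
  PiTensorProduct.lift.tprod v

/-- The product `a ⊙ b ⊙ c`. -/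
def symMul (a b c : V) : Sym[ℝ]^3 V := SymmetricPower.tprod ℝ ![a, b, c]

theorem symMul_eq (v : Fin 3 → V) : SymmetricPower.tprod ℝ v = symMul (v 0) (v 1) (v 2) := by
  rw [symMul]; congr 1; ext i; fin_cases i <;> rfl

theorem symMul_perm (a b c : V) : symMul b a c = symMul a b c ∧ symMul a c b = symMul a b c := by
  constructor
  · have := SymmetricPower.tprod_equiv (R := ℝ) (Equiv.swap (0 : Fin 3) 1) ![a, b, c]
    rwa [symMul_eq] at this
  · have := SymmetricPower.tprod_equiv (R := ℝ) (Equiv.swap (1 : Fin 3) 2) ![a, b, c]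
    rwa [symMul_eq] at this

theorem update_zero_vec3 {X : Type*} (a b c z : X) :
    Function.update ![a, b, c] 0 z = ![z, b, c] := by
  ext i; fin_cases i <;> rfl

theorem symMul_add (a a' b c : V) : symMul (a + a') b c = symMul a b c + symMul a' b c := by
  have := (SymmetricPower.tprod ℝ (ι := Fin 3) (M := V)).map_update_add ![a, b, c] 0 a a'
  simp only [update_zero_vec3] at this
  exact this

theorem symMul_smul (r : ℝ) (a b c : V) : symMul (r • a) b c = r • symMul a b c := by
  have := (SymmetricPower.tprod ℝ (ι := Fin 3) (M := V)).map_update_smul ![a, b, c] 0 r a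
  simp only [update_zero_vec3] at this
  exact this

theorem symMul_add₂ (a b b' c : V) : symMul a (b + b') c = symMul a b c + symMul a b' c := by
  rw [← (symMul_perm a _ c).1, symMul_add, (symMul_perm a _ c).1, (symMul_perm a _ c).1]

theorem symMul_smul₂ (r : ℝ) (a b c : V) : symMul a (r • b) c = r • symMul a b c := by
  rw [← (symMul_perm a _ c).1, symMul_smul, (symMul_perm a _ c).1]

theorem symMul_add₃ (a b c c' : V) : symMul a b (c + c') = symMul a b c + symMul a b c' := by
  rw [← (symMul_perm a b _).2, symMul_add₂, (symMul_perm a b _).2, (symMul_perm a b _).2]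

theorem symMul_smul₃ (r : ℝ) (a b c : V) : symMul a b (r • c) = r • symMul a b c := by
  rw [← (symMul_perm a b _).2, symMul_smul₂, (symMul_perm a b _).2]

/-- The polarization identity for cubes. -/
theorem symMul_eq_cubes (a b c : V) : (6 : ℝ) • symMul a b c =
    symMul (a + b + c) (a + b + c) (a + b + c) - symMul (a + b) (a + b) (a + b)
      - symMul (a + c) (a + c) (a + c) - symMul (b + c) (b + c) (b + c)
      + symMul a a a + symMul b b b + symMul c c c := by
  simp only [symMul_add, symMul_add₂, symMul_add₃]
  have h1 := (symMul_perm a b c).1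
  have h2 := (symMul_perm a b c).2
  have h3 := (symMul_perm a c b).1
  have h4 := (symMul_perm b a c).2
  have h5 := (symMul_perm b c a).1
  rw [h5, h4, h3, h2, h1]
  module

/-- By polarization, the third symmetric power is spanned by cubes. -/
theorem symPower_ext {L L' : Sym[ℝ]^3 V →ₗ[ℝ] W}
    (h : ∀ s, L (SymmetricPower.tprod ℝ fun _ => s) = L' (SymmetricPower.tprod ℝ fun _ => s)) :
    L = L' := by
  have h' : ∀ s, L (symMul s s s) = L' (symMul s s s) := by
    intro s
    have := h s
    rwa [symMul_eq] at this
  refine LinearMap.ext_on (SymmetricPower.span_tprod_eq_top ℝ (Fin 3) V) ?_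
  rintro _ ⟨v, rfl⟩
  rw [symMul_eq]
  have h6 : (6 : ℝ) • L (symMul (v 0) (v 1) (v 2)) = (6 : ℝ) • L' (symMul (v 0) (v 1) (v 2)) := by
    rw [← map_smul, ← map_smul, symMul_eq_cubes]
    simp only [map_add, map_sub, h']
  exact smul_right_injective W (by norm_num : (6 : ℝ) ≠ 0) h6

theorem symPower_equiv_ext {N : Submodule ℝ W} {L L' : Sym[ℝ]^3 V ≃ₗ[ℝ] N}
    (h : ∀ s, (L (SymmetricPower.tprod ℝ fun _ => s) : W) =
      L' (SymmetricPower.tprod ℝ fun _ => s)) : L = L' :=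
  LinearEquiv.toLinearMap_injective (symPower_ext fun s => Subtype.ext (h s))

/-- The trilinear map `(u, v, w) ↦ α(u) β(v) γ(w)`. -/
def monomialMap (α β γ : V →ₗ[ℝ] ℝ) : MultilinearMap ℝ (fun _ : Fin 3 => V) ℝ :=
  (MultilinearMap.mkPiAlgebra ℝ (Fin 3) ℝ).compLinearMap ![α, β, γ]

theorem monomialMap_apply (α β γ : V →ₗ[ℝ] ℝ) (v : Fin 3 → V) :
    monomialMap α β γ v = α (v 0) * β (v 1) * γ (v 2) := by
  simp [monomialMap, Fin.prod_univ_three]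

/-- The symmetric trilinear forms whose values at `(s, s, s)` are `σ³, σ²τ, στ², τ³`, where
`σ = α(s)` and `τ = β(s)`. -/
def cubicCoeff (α β : V →ₗ[ℝ] ℝ) (v : Fin 3 → V) : Fin 4 → ℝ :=
  ![α (v 0) * α (v 1) * α (v 2),
    (α (v 0) * α (v 1) * β (v 2) + α (v 0) * β (v 1) * α (v 2) + β (v 0) * α (v 1) * α (v 2)) / 3,
    (α (v 0) * β (v 1) * β (v 2) + β (v 0) * α (v 1) * β (v 2) + β (v 0) * β (v 1) * α (v 2)) / 3,
    β (v 0) * β (v 1) * β (v 2)]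

/-- `cubicCoeff` as a trilinear map. -/
def cubicMultilinear (α β : V →ₗ[ℝ] ℝ) : MultilinearMap ℝ (fun _ : Fin 3 => V) (Fin 4 → ℝ) :=
  MultilinearMap.pi ![monomialMap α α α,
    (1 / 3 : ℝ) • (monomialMap α α β + monomialMap α β α + monomialMap β α α),
    (1 / 3 : ℝ) • (monomialMap α β β + monomialMap β α β + monomialMap β β α),
    monomialMap β β β]

theorem cubicMultilinear_apply (α β : V →ₗ[ℝ] ℝ) (v : Fin 3 → V) :
    cubicMultilinear α β v = cubicCoeff α β v := by
  ext i
  fin_cases i <;> simp [cubicMultilinear, cubicCoeff, monomialMap_apply] <;> ring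

theorem cubicCoeff_perm (α β : V →ₗ[ℝ] ℝ) (e : Equiv.Perm (Fin 3)) (v : Fin 3 → V) :
    cubicCoeff α β (fun i => v (e i)) = cubicCoeff α β v := by
  have h01 : e 0 ≠ e 1 := fun h => by simpa using e.injective h
  have h02 : e 0 ≠ e 2 := fun h => by simpa using e.injective h
  have h12 : e 1 ≠ e 2 := fun h => by simpa using e.injective h
  have key : ∀ a b c : Fin 3, a ≠ b → a ≠ c → b ≠ c →
      (a = 0 ∧ b = 1 ∧ c = 2) ∨ (a = 0 ∧ b = 2 ∧ c = 1) ∨ (a = 1 ∧ b = 0 ∧ c = 2) ∨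
      (a = 1 ∧ b = 2 ∧ c = 0) ∨ (a = 2 ∧ b = 0 ∧ c = 1) ∨ (a = 2 ∧ b = 1 ∧ c = 0) := by decide
  have vec : ∀ {a b c d a' b' c' d' : ℝ}, a = a' → b = b' → c = c' → d = d' →
      ![a, b, c, d] = ![a', b', c', d'] := by
    rintro _ _ _ _ _ _ _ _ rfl rfl rfl rfl; rfl
  rcases key _ _ _ h01 h02 h12 with ⟨h0, h1, h2⟩ | ⟨h0, h1, h2⟩ | ⟨h0, h1, h2⟩ | ⟨h0, h1, h2⟩ |
    ⟨h0, h1, h2⟩ | ⟨h0, h1, h2⟩ <;> simp only [cubicCoeff, h0, h1, h2] <;>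
    exact vec (by ring) (by ring) (by ring) (by ring)

/-- The linear map on the third symmetric power that takes `s ⊙ s ⊙ s` to `(σ³, σ²τ, στ², τ³)`. -/
def cubicLift (α β : V →ₗ[ℝ] ℝ) : Sym[ℝ]^3 V →ₗ[ℝ] (Fin 4 → ℝ) :=
  symLift (cubicMultilinear α β) fun e v => by
    rw [cubicMultilinear_apply, cubicMultilinear_apply, cubicCoeff_perm]

theorem cubicLift_tprod (α β : V →ₗ[ℝ] ℝ) (v : Fin 3 → V) :
    cubicLift α β (SymmetricPower.tprod ℝ v) = cubicCoeff α β v :=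
  (symLift_tprod _ _ _).trans (cubicMultilinear_apply α β v)

theorem cubicLift_symMul (α β : V →ₗ[ℝ] ℝ) (a b c : V) :
    cubicLift α β (symMul a b c) = cubicCoeff α β ![a, b, c] :=
  cubicLift_tprod α β _

/-- For a plane `V` with linear coordinates `q = (σ, τ)`, the isomorphism `⊙³V ≅ ℝ⁴` that takes
`s ⊙ s ⊙ s` to `(σ³, σ²τ, στ², τ³)`. -/
def cubicEquiv (q : V ≃ₗ[ℝ] ℝ × ℝ) : Sym[ℝ]^3 V ≃ₗ[ℝ] (Fin 4 → ℝ) :=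
  let x := q.symm (1, 0)
  let y := q.symm (0, 1)
  LinearEquiv.ofLinearMap
    (cubicLift ((LinearMap.fst ℝ ℝ ℝ).comp q.toLinearMap)
      ((LinearMap.snd ℝ ℝ ℝ).comp q.toLinearMap))
    (Fintype.linearCombination ℝ ![symMul x x x, (3 : ℝ) • symMul x x y, (3 : ℝ) • symMul x y y,
      symMul y y y])
    (by
      ext i j
      fin_cases i <;> fin_cases j <;>
        simp [cubicLift_symMul, cubicCoeff, x, y, Fintype.linearCombination_apply,
          Pi.single_apply])
    (by
      refine symPower_ext fun s => ?_
      have hs : s = (q s).1 • x + (q s).2 • y := by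
        apply q.injective
        ext <;> simp [x, y]
      rw [LinearMap.comp_apply, cubicLift_tprod, LinearMap.id_apply, symMul_eq]
      conv_rhs => rw [hs]
      simp only [symMul_add, symMul_add₂, symMul_add₃, symMul_smul, symMul_smul₂, symMul_smul₃]
      rw [(symMul_perm x y x).1, (symMul_perm x x y).2, (symMul_perm x y y).1,
        (symMul_perm y x y).2, (symMul_perm x y y).1]
      simp [Fintype.linearCombination_apply, Fin.sum_univ_four, cubicCoeff]
      module)

theorem cubicEquiv_tprod (q : V ≃ₗ[ℝ] ℝ × ℝ) (v : Fin 3 → V) :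
    cubicEquiv q (SymmetricPower.tprod ℝ v) =
      cubicCoeff ((LinearMap.fst ℝ ℝ ℝ).comp q.toLinearMap)
        ((LinearMap.snd ℝ ℝ ℝ).comp q.toLinearMap) v :=
  cubicLift_tprod _ _ v

end SymmetricCube

/-! ### Densities, volume forms and dual bases -/

section Weights
variable {M : Type*} [TopologicalSpace M] [ChartedSpace E3 M]

theorem exists_eq_smul_volForm {x : M} {ε : VolForm x} (hε : ε ≠ 0) (ε' : VolForm x) :
    ∃ t : ℝ, ε' = t • ε := by
  let B : Module.Basis (Fin 3) ℝ (TangentSpace (𝓡 3) x) :=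
    (EuclideanSpace.basisFun (Fin 3) ℝ).toBasis
  have h1 := AlternatingMap.eq_smul_basis_det B ε
  have h2 := AlternatingMap.eq_smul_basis_det B ε'
  have h0 : ε B ≠ 0 := by
    intro h
    rw [h, zero_smul] at h1
    exact hε h1
  refine ⟨ε' B / ε B, h2.trans ?_⟩
  generalize ε B = a at h1 h0 ⊢
  rw [h1, smul_smul, div_mul_cancel₀ _ h0]

theorem Weighted.eq_of_apply_eq {w : ℝ} {x : M} {W : Type*} [AddCommGroup W] [Module ℝ W]
    {f g : Weighted w x W} {ε : VolForm x} (hε : ε ≠ 0) (h : f.1 ε = g.1 ε) : f = g := by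
  refine Subtype.ext (funext fun ε' => ?_)
  obtain ⟨t, rfl⟩ := exists_eq_smul_volForm hε ε'
  by_cases ht : t = 0
  · rw [ht, zero_smul, f.2.1, g.2.1]
  · rw [f.2.2 t ht, g.2.2 t ht, h]

theorem Weighted.apply_pow_smul {w : ℝ} {x : M} {W : Type*} [AddCommGroup W] [Module ℝ W]
    (f : Weighted w x W) {u : ℝ} (hu : 0 < u) (ε : VolForm x) :
    f.1 (u ^ 12 • ε) = u ^ (3 * w) • f.1 ε := by
  have h12 : 0 < u ^ 12 := by positivity
  rw [f.2.2 _ h12.ne', abs_of_pos h12, ← Real.rpow_natCast, ← Real.rpow_mul hu.le]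
  congr 2
  push_cast
  ring

theorem Density.exists_apply_eq (w : ℝ) {x : M} {ε : VolForm x} (hε : ε ≠ 0) (a : ℝ) :
    ∃ f : Density w x, f.1 ε = a := by
  classical
  choose t ht using exists_eq_smul_volForm hε
  have hsm : ∀ s, t (s • ε) = s := fun s =>
    smul_left_injective ℝ hε (ht (s • ε)).symm
  refine ⟨⟨fun ε' => if ε' = 0 then 0 else |t ε'| ^ (w / 4) * a, by simp, fun s hs ε' => ?_⟩, ?_⟩
  · by_cases h : ε' = 0
    · simp [h]
    · have : t (s • ε') = s * t ε' := by
        conv_lhs => rw [ht ε', smul_smul, hsm]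
      simp only [smul_eq_zero, hs, h, or_self, if_false, this, abs_mul, smul_eq_mul]
      rw [Real.mul_rpow (abs_nonneg _) (abs_nonneg _)]
      ring
  · have : t ε = 1 := by simpa using hsm 1
    simp [hε, this]

/-- The coordinates `(σ, τ)` on `S_c` given by the values of a spinor in the scale `ε`. -/
def spinorEquiv [IsManifold (𝓡 3) ∞ M] (c : ConfigSpace M) {ε : VolForm c.pt} (hε : ε ≠ 0) :
    Spinor c ≃ₗ[ℝ] ℝ × ℝ :=
  LinearEquiv.ofBijective
    { toFun := fun s => (s.1.1 ε, s.2.1 ε)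
      map_add' := fun _ _ => rfl
      map_smul' := fun _ _ => rfl }
    ⟨fun s t h => Prod.ext (Weighted.eq_of_apply_eq hε (congrArg Prod.fst h))
        (Weighted.eq_of_apply_eq hε (congrArg Prod.snd h)), fun a => by
      obtain ⟨f, hf⟩ := Density.exists_apply_eq (2 / 3) hε a.1
      obtain ⟨g, hg⟩ := Density.exists_apply_eq (-1 / 3) hε a.2
      exact ⟨(f, g), Prod.ext hf hg⟩⟩

theorem spinorEquiv_apply [IsManifold (𝓡 3) ∞ M] (c : ConfigSpace M) {ε : VolForm c.pt}
    (hε : ε ≠ 0) (s : Spinor c) : spinorEquiv c hε s = (s.1.1 ε, s.2.1 ε) := rfl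

theorem wedge_apply {x : M} (p q r : Cotangent x) (v : Fin 3 → TangentSpace (𝓡 3) x) :
    wedge p q r v =
      p (v 0) * (q (v 1) * r (v 2) - q (v 2) * r (v 1))
      - q (v 0) * (p (v 1) * r (v 2) - p (v 2) * r (v 1))
      + r (v 0) * (p (v 1) * q (v 2) - p (v 2) * q (v 1)) := by
  refine (Matrix.det_fin_three
    (Matrix.of fun i j => (![p.toLinearMap, q.toLinearMap, r.toLinearMap] j) (v i))).trans ?_
  simp
  ring

theorem wedge_smul {x : M} (a b d : ℝ) (p q r : Cotangent x) :
    wedge (a • p) (b • q) (d • r) = (a * b * d) • wedge p q r := by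
  ext v
  simp only [AlternatingMap.smul_apply, wedge_apply]
  simp
  ring

/-- `e₁, e₂` is the basis of `ker p` dual to the restrictions of `q` and `r`. -/
structure IsDualPair {x : M} (p q r : Cotangent x) (e₁ e₂ : TangentSpace (𝓡 3) x) : Prop where
  p₁ : p e₁ = 0
  q₁ : q e₁ = 1
  r₁ : r e₁ = 0
  p₂ : p e₂ = 0
  q₂ : q e₂ = 0
  r₂ : r e₂ = 1

namespace IsDualPair

variable {x : M} {p q r : Cotangent x} {e₁ e₂ : TangentSpace (𝓡 3) x}

/-- A dual pair is completed to a basis of the tangent space that is dual to `p, q, r`. -/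
theorem exists_complement (h : IsDualPair p q r e₁ e₂) (hp : p ≠ 0) :
    ∃ e₀, p e₀ = 1 ∧ q e₀ = 0 ∧ r e₀ = 0 ∧ ∀ v, v = p v • e₀ + q v • e₁ + r v • e₂ := by
  obtain ⟨u, hu⟩ : ∃ u, p u ≠ 0 := by
    by_contra! h0
    exact hp (ContinuousLinearMap.ext h0)
  have e : ∃ e₀, p e₀ = 1 ∧ q e₀ = 0 ∧ r e₀ = 0 := by
    refine ⟨(p u)⁻¹ • u - ((p u)⁻¹ * q u) • e₁ - ((p u)⁻¹ * r u) • e₂, ?_, ?_, ?_⟩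
    · simp [h.p₁, h.p₂, hu]
    · simp [h.q₁, h.q₂]
    · simp [h.r₁, h.r₂]
  obtain ⟨e₀, h0, h1, h2⟩ := e
  refine ⟨e₀, h0, h1, h2, fun v => ?_⟩
  have hl : LinearIndependent ℝ ![e₀, e₁, e₂] := by
    rw [Fintype.linearIndependent_iff]
    intro g hg
    rw [Fin.sum_univ_three] at hg
    have hp := congrArg p hg
    have hq := congrArg q hg
    have hr := congrArg r hg
    simp [h0, h1, h2, h.p₁, h.p₂, h.q₁, h.q₂, h.r₁, h.r₂] at hp hq hr
    intro i; fin_cases i <;> assumption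
  have hcard : Fintype.card (Fin 3) = Module.finrank ℝ (TangentSpace (𝓡 3) x) := by
    rw [Fintype.card_fin]
    exact (finrank_euclideanSpace_fin (𝕜 := ℝ) (n := 3)).symm
  have : FiniteDimensional ℝ (TangentSpace (𝓡 3) x) := inferInstanceAs (FiniteDimensional ℝ E3)
  let B := basisOfLinearIndependentOfCardEqFinrank hl hcard
  have hv := B.sum_repr v
  simp only [Fin.sum_univ_three, B, coe_basisOfLinearIndependentOfCardEqFinrank] at hv
  simp at hv
  have hp := congrArg p hv
  have hq := congrArg q hv
  have hr := congrArg r hv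
  simp [h0, h1, h2, h.p₁, h.p₂, h.q₁, h.q₂, h.r₁, h.r₂] at hp hq hr
  rw [← hp, ← hq, ← hr]
  exact hv.symm

theorem eq_add (h : IsDualPair p q r e₁ e₂) (hp : p ≠ 0) {v : TangentSpace (𝓡 3) x}
    (hv : p v = 0) : v = q v • e₁ + r v • e₂ := by
  obtain ⟨e₀, -, -, -, h0⟩ := h.exists_complement hp
  conv_lhs => rw [h0 v, hv, zero_smul, zero_add]

theorem covector_eq (h : IsDualPair p q r e₁ e₂) (hp : p ≠ 0) (ν : Cotangent x) :
    ∃ a : ℝ, ν = a • p + ν e₁ • q + ν e₂ • r := by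
  obtain ⟨e₀, -, -, -, h0⟩ := h.exists_complement hp
  refine ⟨ν e₀, ContinuousLinearMap.ext fun v => ?_⟩
  conv_lhs => rw [h0 v]
  simp
  ring

theorem wedge_ne_zero (h : IsDualPair p q r e₁ e₂) (hp : p ≠ 0) : wedge p q r ≠ 0 := by
  obtain ⟨e₀, h0, h1, h2, -⟩ := h.exists_complement hp
  intro h3
  have := congrArg (fun L => L ![e₀, e₁, e₂]) h3
  simp only [wedge_apply] at this
  simp [h0, h1, h2, h.p₁, h.p₂, h.q₁, h.q₂, h.r₁, h.r₂] at this

/-- Cramer's rule for the dual basis: a formula that is polynomial in the components of `p, q, r` in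
a frame `v`, up to the factor `(p ∧ q ∧ r)(v)⁻¹`. -/
theorem of_wedge (v : Fin 3 → TangentSpace (𝓡 3) x) (hD : wedge p q r v ≠ 0) :
    IsDualPair p q r
      ((wedge p q r v)⁻¹ • ((r (v 1) * p (v 2) - r (v 2) * p (v 1)) • v 0
        + (r (v 2) * p (v 0) - r (v 0) * p (v 2)) • v 1
        + (r (v 0) * p (v 1) - r (v 1) * p (v 0)) • v 2))
      ((wedge p q r v)⁻¹ • ((p (v 1) * q (v 2) - p (v 2) * q (v 1)) • v 0
        + (p (v 2) * q (v 0) - p (v 0) * q (v 2)) • v 1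
        + (p (v 0) * q (v 1) - p (v 1) * q (v 0)) • v 2)) := by
  constructor <;> simp only [map_smul, map_add, smul_eq_mul]
  · ring
  · rw [inv_mul_eq_one₀ hD, wedge_apply]; ring
  · ring
  · ring
  · ring
  · rw [inv_mul_eq_one₀ hD, wedge_apply]; ring

end IsDualPair

theorem exists_apply_eq_one_of_linearIndependent {V : Type*} [AddCommGroup V] [Module ℝ V]
    {f g : Module.Dual ℝ V} (h : LinearIndependent ℝ ![f, g]) : ∃ v, f v = 1 ∧ g v = 0 := by
  have h1 : ¬ LinearMap.ker g ≤ LinearMap.ker f := by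
    intro hle
    have h2 : f ∈ Submodule.span ℝ (Set.range fun _ : Unit => g) :=
      mem_span_of_iInf_ker_le_ker (by simpa using hle)
    obtain ⟨a, ha⟩ := Submodule.mem_span_singleton.1 (by simpa using h2)
    have := (LinearIndependent.pair_iff.1 h 1 (-a) (by rw [← ha]; simp)).1
    exact one_ne_zero this
  obtain ⟨v, hv, hv'⟩ := SetLike.not_le_iff_exists.1 h1
  have hv' : f v ≠ 0 := hv'
  have hv : g v = 0 := hv
  exact ⟨(f v)⁻¹ • v, by simp [hv'], by simp [hv]⟩

theorem exists_isDualPair_iff {x : M} {p q r : Cotangent x} :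
    (∃ e₁ e₂, IsDualPair p q r e₁ e₂) ↔ LinearIndependent ℝ
      ![q.toLinearMap.domRestrict (LinearMap.ker p.toLinearMap),
        r.toLinearMap.domRestrict (LinearMap.ker p.toLinearMap)] := by
  constructor
  · rintro ⟨e₁, e₂, h⟩
    rw [LinearIndependent.pair_iff]
    intro s t hst
    have h1 := congrArg (fun L => L ⟨e₁, h.p₁⟩) hst
    have h2 := congrArg (fun L => L ⟨e₂, h.p₂⟩) hst
    simp at h1 h2
    rw [h.q₁, h.r₁] at h1
    rw [h.q₂, h.r₂] at h2
    simp at h1 h2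
    exact ⟨h1, h2⟩
  · intro h
    obtain ⟨v, hv, hv'⟩ := exists_apply_eq_one_of_linearIndependent h
    obtain ⟨w, hw, hw'⟩ :=
      exists_apply_eq_one_of_linearIndependent (LinearIndependent.pair_symm_iff.1 h)
    exact ⟨v, w, v.2, hv, hv', w.2, hw', hw⟩

end Weights

/-! ### The contact distribution and projective invariance -/

section Contact
variable {M : Type*} [TopologicalSpace M] [ChartedSpace E3 M] [IsManifold (𝓡 3) ∞ M]

theorem isInvertible_coordDeriv {c₀ c : ConfigSpace M} (hc : c ∈ (chartAt E5 c₀).source) :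
    (coordDeriv c₀ c).IsInvertible :=
  isInvertible_mfderiv_extChartAt (by simpa using hc)

theorem coordDeriv_injective {c₀ c : ConfigSpace M} (hc : c ∈ (chartAt E5 c₀).source) :
    Function.Injective (coordDeriv c₀ c) :=
  (isInvertible_coordDeriv hc).injective

theorem contMDiff_pt : ContMDiff 𝓘(ℝ, E5) (𝓡 3) ∞ (ConfigSpace.pt : ConfigSpace M → M) := by
  intro c
  have h1 : ContMDiffAt 𝓘(ℝ, E5) 𝓘(ℝ, E3) ∞ (fun d => (extChartAt 𝓘(ℝ, E5) c d).1) c :=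
    contDiff_fst.contMDiff.contMDiffAt.comp c contMDiffAt_extChartAt
  have h2 : ContMDiffAt 𝓘(ℝ, E3) (𝓡 3) ∞ (chartAt E3 c.pt).symm (extChartAt 𝓘(ℝ, E5) c c).1 :=
    (contMDiffOn_chart_symm (I := 𝓡 3)).contMDiffAt
      ((chartAt E3 c.pt).open_target.mem_nhds (mem_chart_target E3 c.pt))
  refine (h2.comp c h1).congr_of_eventuallyEq ?_
  filter_upwards [(chartAt E5 c).open_source.mem_nhds (mem_chart_source E5 c)] with d hd
  exact ((chartAt E3 c.pt).left_inv hd.1).symm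

theorem mdifferentiableAt_pt (c : ConfigSpace M) :
    MDifferentiableAt 𝓘(ℝ, E5) (𝓡 3) (ConfigSpace.pt : ConfigSpace M → M) c :=
  contMDiff_pt.mdifferentiableAt (by simp)

/-- The derivative of the projection `π : C → M`. -/
abbrev ptDeriv (c : ConfigSpace M) : TangentSpace 𝓘(ℝ, E5) c →L[ℝ] TangentSpace (𝓡 3) c.pt :=
  mfderiv 𝓘(ℝ, E5) (𝓡 3) ConfigSpace.pt c

/-- In the charts the projection `π` is `(x, a, b) ↦ x`. -/
theorem coordDeriv_fst {c₀ c : ConfigSpace M} (hc : c ∈ (chartAt E5 c₀).source)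
    (v : TangentSpace 𝓘(ℝ, E5) c) :
    (coordDeriv c₀ c v).1 = tangentCoordChange (𝓡 3) c.pt c₀.pt c.pt (ptDeriv c v) := by
  have h1 := mfderiv_comp c (((mdifferentiable_chart (I := 𝓡 3) c₀.pt).mdifferentiableAt hc.1))
    (mdifferentiableAt_pt c)
  have h2 := mfderiv_comp (I := 𝓘(ℝ, E5)) (I' := 𝓘(ℝ, E5)) (I'' := 𝓘(ℝ, E3)) c
    (g := (Prod.fst : E5 → E3)) (f := extChartAt 𝓘(ℝ, E5) c₀)
    (mdifferentiableAt_iff_differentiableAt.2 differentiableAt_fst)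
    (mdifferentiableAt_extChartAt (I := 𝓘(ℝ, E5)) hc)
  have h3 : (Prod.fst : E5 → E3) ∘ extChartAt 𝓘(ℝ, E5) c₀ =
      chartAt E3 c₀.pt ∘ (ConfigSpace.pt : ConfigSpace M → M) := rfl
  rw [mfderiv_eq_fderiv, fderiv_fst] at h2
  rw [h3] at h2
  rw [mfderiv_chartAt_eq hc.1] at h1
  exact congrArg (fun L => L v) (h2.symm.trans h1)

theorem tangentCoordChange_injective {x₀ x : M} (hx : x ∈ (chartAt E3 x₀).source) :
    Function.Injective (tangentCoordChange (𝓡 3) x x₀ x) := by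
  refine Function.LeftInverse.injective (g := tangentCoordChange (𝓡 3) x₀ x x) fun v => ?_
  rw [tangentCoordChange_comp (by simp [hx]), tangentCoordChange_self (by simp)]

theorem mem_contactH_iff {c : ConfigSpace M} {p : Cotangent c.pt} (hp : c.IsRep p)
    {v : TangentSpace 𝓘(ℝ, E5) c} : v ∈ contactH c ↔ p (ptDeriv c v) = 0 := by
  obtain ⟨r, hr, h⟩ := IsRep.exists_pos_smul hp
  change c.covector (ptDeriv c v) = 0 ↔ _
  rw [h]
  change r * p (ptDeriv c v) = 0 ↔ _
  simp [hr.ne']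

theorem ptDeriv_verticalVector {c : ConfigSpace M} {p : Cotangent c.pt} (hp : c.IsRep p)
    (ν : Cotangent c.pt) : ptDeriv c (verticalVector c p ν) = 0 := by
  have hc := mem_chart_source E5 c
  refine tangentCoordChange_injective hc.1 ?_
  rw [← coordDeriv_fst hc, coordDeriv_verticalVector hc hp]
  exact (map_zero (tangentCoordChange (𝓡 3) c.pt c.pt c.pt)).symm

theorem ptDeriv_of_isHorizontalLift {cov : Connection M} {c : ConfigSpace M}
    {X : TangentSpace (𝓡 3) c.pt} {v : TangentSpace 𝓘(ℝ, E5) c}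
    (hv : IsHorizontalLift cov c X v) : ptDeriv c v = X := by
  have hc := mem_chart_source E5 c
  refine tangentCoordChange_injective hc.1 ?_
  rw [← coordDeriv_fst hc, coordDeriv_of_isHorizontalLift hc hv (isRep_covector c)]
  rfl

theorem affDeriv_add (p w w' : Fin 3 → ℝ) :
    affDeriv p (w + w') = affDeriv p w + affDeriv p w' := by
  simp only [affDeriv, Pi.add_apply, Prod.mk_add_mk]
  congr 1 <;> ring

theorem affDeriv_smul (p : Fin 3 → ℝ) (a : ℝ) (w : Fin 3 → ℝ) :
    affDeriv p (a • w) = a • affDeriv p w := by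
  simp only [affDeriv, Pi.smul_apply, smul_eq_mul, Prod.smul_mk]
  congr 1 <;> ring

theorem affDeriv_self (p : Fin 3 → ℝ) : affDeriv p p = 0 := by
  simp [affDeriv, mul_comm]

theorem affDeriv_eq_zero {p w : Fin 3 → ℝ} (hp : p 0 ≠ 0) (h : affDeriv p w = 0) :
    w = (w 0 / p 0) • p := by
  simp only [affDeriv, Prod.mk_eq_zero, div_eq_zero_iff, pow_eq_zero_iff two_ne_zero, hp,
    or_false] at h
  ext i
  simp only [Pi.smul_apply, smul_eq_mul]
  field_simp
  fin_cases i
  · rfl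
  · simp; linarith [h.1]
  · simp; linarith [h.2]

theorem covector_ext_chartVec {c₀ : ConfigSpace M} {x : M} (hx : x ∈ (chartAt E3 c₀.pt).source)
    {p q : Cotangent x} (h : ∀ i, p (chartVec c₀ x i) = q (chartVec c₀ x i)) : p = q := by
  ext v
  rw [← sum_frameCoord (chartFrame c₀) hx v]
  simp only [map_sum, map_smul]
  exact Finset.sum_congr rfl fun i _ => by rw [h]

theorem exists_covector_chartVec {c₀ : ConfigSpace M} {x : M}
    (hx : x ∈ (chartAt E3 c₀.pt).source) (w : Fin 3 → ℝ) :
    ∃ p : Cotangent x, ∀ i, p (chartVec c₀ x i) = w i := by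
  refine ⟨(∑ i, w i • (EuclideanSpace.proj (𝕜 := ℝ) i : E3 →L[ℝ] ℝ)).comp
    (frameCoord c₀.pt (chartFrame c₀) x), fun i => ?_⟩
  rw [ContinuousLinearMap.comp_apply, frameCoord_frameVec _ hx]
  simp

theorem verticalVector_add {c : ConfigSpace M} {p : Cotangent c.pt} (hp : c.IsRep p)
    (ν ν' : Cotangent c.pt) :
    verticalVector c p (ν + ν') = verticalVector c p ν + verticalVector c p ν' := by
  have hc := mem_chart_source E5 c
  apply coordDeriv_injective hc
  rw [map_add, coordDeriv_verticalVector hc hp, coordDeriv_verticalVector hc hp,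
    coordDeriv_verticalVector hc hp]
  exact Prod.ext (zero_add (0 : E3)).symm
    (affDeriv_add (fun i => p (chartVec c c.pt i)) (fun i => ν (chartVec c c.pt i))
      fun i => ν' (chartVec c c.pt i))

theorem verticalVector_smul {c : ConfigSpace M} {p : Cotangent c.pt} (hp : c.IsRep p) (a : ℝ)
    (ν : Cotangent c.pt) : verticalVector c p (a • ν) = a • verticalVector c p ν := by
  have hc := mem_chart_source E5 c
  apply coordDeriv_injective hc
  rw [map_smul, coordDeriv_verticalVector hc hp, coordDeriv_verticalVector hc hp]
  exact Prod.ext (smul_zero a).symm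
    (affDeriv_smul (fun i => p (chartVec c c.pt i)) a fun i => ν (chartVec c c.pt i))

theorem verticalVector_self {c : ConfigSpace M} {p : Cotangent c.pt} (hp : c.IsRep p) :
    verticalVector c p p = 0 := by
  have hc := mem_chart_source E5 c
  apply coordDeriv_injective hc
  rw [map_zero, coordDeriv_verticalVector hc hp, affDeriv_self]
  rfl

theorem verticalVector_smul_left {c : ConfigSpace M} {p : Cotangent c.pt} (hp : c.IsRep p) {r : ℝ}
    (hr : 0 < r) (ν : Cotangent c.pt) :
    verticalVector c (r • p) ν = r⁻¹ • verticalVector c p ν := by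
  have hc := mem_chart_source E5 c
  rw [← verticalVector_smul hp]
  apply coordDeriv_injective hc
  rw [coordDeriv_verticalVector hc (IsRep.smul hp hr), coordDeriv_verticalVector hc hp]
  refine congrArg (Prod.mk (0 : E3)) ?_
  conv_rhs => rw [← affDeriv_smul_smul hr.ne']
  refine congrArg (affDeriv _) (funext fun i => ?_)
  change _ = r * (r⁻¹ * ν (chartVec c c.pt i))
  rw [mul_inv_cancel_left₀ hr.ne']

theorem eq_smul_of_verticalVector_eq_zero {c : ConfigSpace M} {p : Cotangent c.pt}
    (hp : c.IsRep p) {ν : Cotangent c.pt} (h : verticalVector c p ν = 0) :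
    ∃ a : ℝ, ν = a • p := by
  have hc := mem_chart_source E5 c
  have h1 := coordDeriv_verticalVector hc hp ν
  rw [h, map_zero] at h1
  have h2 := affDeriv_eq_zero (p := fun i => p (chartVec c c.pt i))
    (w := fun i => ν (chartVec c c.pt i)) (IsRep.pos hc hp).ne' (congrArg Prod.snd h1).symm
  exact ⟨_, covector_ext_chartVec hc.1 fun i => congrFun h2 i⟩

theorem exists_verticalVector_eq {c : ConfigSpace M} {p : Cotangent c.pt} (hp : c.IsRep p)
    {v : TangentSpace 𝓘(ℝ, E5) c} (hv : ptDeriv c v = 0) : ∃ ν, v = verticalVector c p ν := by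
  have hc := mem_chart_source E5 c
  have hp0 := IsRep.pos hc hp
  set p₀ := p (chartVec c c.pt 0)
  obtain ⟨ν, hν⟩ := exists_covector_chartVec hc.1
    ![0, (coordDeriv c c v).2.1 * p₀, (coordDeriv c c v).2.2 * p₀]
  refine ⟨ν, coordDeriv_injective hc ?_⟩
  rw [coordDeriv_verticalVector hc hp]
  refine Prod.ext ?_ (Prod.ext ?_ ?_)
  · change (coordDeriv c c v).1 = 0
    rw [coordDeriv_fst hc, hv]
    exact map_zero (tangentCoordChange (𝓡 3) c.pt c.pt c.pt)
  · simp only [affDeriv, hν]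
    change (coordDeriv c c v).2.1 = ((coordDeriv c c v).2.1 * p₀ * p₀ - _ * 0) / p₀ ^ 2
    field_simp
    simp
  · simp only [affDeriv, hν]
    change (coordDeriv c c v).2.2 = ((coordDeriv c c v).2.2 * p₀ * p₀ - _ * 0) / p₀ ^ 2
    field_simp
    simp

theorem liftCoords_add (cov : Connection M) (c₀ : ConfigSpace M) {x : M} (p : Cotangent x)
    (X Y : TangentSpace (𝓡 3) x) :
    liftCoords cov c₀ p (X + Y) = liftCoords cov c₀ p X + liftCoords cov c₀ p Y := by
  rw [liftCoords, liftCoords, liftCoords, Prod.mk_add_mk, ← affDeriv_add]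
  refine congrArg₂ Prod.mk (map_add (tangentCoordChange (𝓡 3) x c₀.pt x) X Y)
    (congrArg (affDeriv _) ?_)
  ext i
  simp only [map_add, Pi.add_apply]

theorem liftCoords_smul (cov : Connection M) (c₀ : ConfigSpace M) {x : M} (p : Cotangent x)
    (a : ℝ) (X : TangentSpace (𝓡 3) x) :
    liftCoords cov c₀ p (a • X) = a • liftCoords cov c₀ p X := by
  rw [liftCoords, liftCoords, Prod.smul_mk, ← affDeriv_smul]
  refine congrArg₂ Prod.mk (map_smul (tangentCoordChange (𝓡 3) x c₀.pt x) a X)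
    (congrArg (affDeriv _) ?_)
  ext i
  simp only [map_smul, Pi.smul_apply]

/-- The horizontal lifts of vectors `X` in the plane of the saucer depend only on the projective
class: a projective change of `∇` adds `Υ(X) p(F_i)` to `p(∇_X F_i)`, because the other term
`Υ(F_i) p(X)` vanishes, and this does not affect the velocity of the ray `[p]`. -/
theorem liftCoords_congr {cov cov' : Connection M} (h : ProjectivelyEquivalent cov cov')
    {c₀ : ConfigSpace M} {x : M} (hx : x ∈ (chartAt E3 c₀.pt).source) {p : Cotangent x}
    {X : TangentSpace (𝓡 3) x} (hX : p X = 0) : liftCoords cov' c₀ p X = liftCoords cov c₀ p X := by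
  obtain ⟨Υ, -, h⟩ := h
  refine congrArg (Prod.mk _) ?_
  have : (fun i => p (cov' (fun y => chartVec c₀ y i) x X)) =
      (fun i => p (cov (fun y => chartVec c₀ y i) x X)) + Υ x X • fun i => p (chartVec c₀ x i) := by
    ext i
    rw [h x X _ (diffFieldAt_frameVec _ hx i)]
    simp [hX]
  rw [this, affDeriv_add, affDeriv_smul, affDeriv_self, smul_zero, add_zero]

/-- The lift of a multiple of `X`, with respect to a possibly different connection in the class. -/
theorem IsHorizontalLift.eq_smul {𝔓 : ProjectiveStructure M} {cov cov' : Connection M}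
    (hcov : cov ∈ 𝔓.connections) (hcov' : cov' ∈ 𝔓.connections) {c : ConfigSpace M}
    {p : Cotangent c.pt} (hp : c.IsRep p) {X : TangentSpace (𝓡 3) c.pt} (hX : p X = 0) {a : ℝ}
    {v v' : TangentSpace 𝓘(ℝ, E5) c} (hv : IsHorizontalLift cov c X v)
    (hv' : IsHorizontalLift cov' c (a • X) v') : v' = a • v := by
  have hc := mem_chart_source E5 c
  apply coordDeriv_injective hc
  rw [map_smul, coordDeriv_of_isHorizontalLift hc hv hp,
    coordDeriv_of_isHorizontalLift hc hv' hp, liftCoords_smul,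
    liftCoords_congr ((𝔓.mem_iff _ hcov _ (𝔓.isSmoothTorsionFree _ hcov')).1 hcov') hc.1 hX]

end Contact

/-! ### The isomorphism at a point -/

section Gauge
variable {M : Type*} [TopologicalSpace M] [ChartedSpace E3 M] [IsManifold (𝓡 3) ∞ M]

theorem ManifoldOrientation.exists_isPos (o : ManifoldOrientation M) (x : M) :
    ∃ ε : VolForm x, o.IsPos ε :=
  ⟨(o.at' x).someVector, (o.at' x).someVector_ne_zero, (o.at' x).someVector_ray⟩

/-- Positive scales differ by a positive factor. It is written as `u¹²`, so that the weights `2`,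
`1`, `2/3` and `-1/3` correspond to the integral powers `u⁶`, `u³`, `u²` and `u⁻¹`. -/
theorem ManifoldOrientation.IsPos.exists_smul_eq {o : ManifoldOrientation M} {x : M}
    {ε ε' : VolForm x} (h : o.IsPos ε) (h' : o.IsPos ε') : ∃ u : ℝ, 0 < u ∧ ε' = u ^ 12 • ε := by
  obtain ⟨h0, h1⟩ := h
  obtain ⟨h0', h1'⟩ := h'
  have h2 : SameRay ℝ ε ε' := (ray_eq_iff h0 h0').1 (h1.trans h1'.symm)
  obtain ⟨r, hr, h⟩ := h2.exists_pos_left h0 h0'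
  refine ⟨r ^ (1 / 12 : ℝ), Real.rpow_pos_of_pos hr _, ?_⟩
  rw [← h, ← Real.rpow_natCast, ← Real.rpow_mul hr.le]
  norm_num

variable (o : ManifoldOrientation M) (𝔓 : ProjectiveStructure M)
  (φ : ∀ x : M, WeightedCovector 2 x) (ψ : ∀ x : M, WeightedCovector 1 x)

/-- The choices at a saucer `c` on which the formula for the twisted cubic depends: a connection
in the projective class, a covector representing `c`, a positive scale `ε`, and the resulting
number `Θ`, dual basis `e₁, e₂` and horizontal lifts `E₁, E₂`. -/
structure Gauge (c : ConfigSpace M) where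
  cov : Connection M
  cov_mem : cov ∈ 𝔓.connections
  p : Cotangent c.pt
  isRep : c.IsRep p
  ε : VolForm c.pt
  isPos : o.IsPos ε
  Θ : ℝ
  wedge_eq : wedge p ((φ c.pt).1 ε) ((ψ c.pt).1 ε) = Θ • ε
  e₁ : TangentSpace (𝓡 3) c.pt
  e₂ : TangentSpace (𝓡 3) c.pt
  dual : IsDualPair p ((φ c.pt).1 ε) ((ψ c.pt).1 ε) e₁ e₂
  E₁ : TangentSpace 𝓘(ℝ, E5) c
  E₂ : TangentSpace 𝓘(ℝ, E5) c
  lift₁ : IsHorizontalLift cov c e₁ E₁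
  lift₂ : IsHorizontalLift cov c e₂ E₂

variable {o 𝔓 φ ψ} {c : ConfigSpace M}

/-- Regularity of a saucer may be tested in one scale and with one representative. -/
theorem mem_regularSet_iff {ε : VolForm c.pt} (hε : ε ≠ 0) {p : Cotangent c.pt}
    (hp : c.IsRep p) : c ∈ regularSet φ ψ ↔
      ∃ e₁ e₂, IsDualPair p ((φ c.pt).1 ε) ((ψ c.pt).1 ε) e₁ e₂ := by
  obtain ⟨r, hr, h⟩ := IsRep.exists_smul_eq hp (isRep_covector c)
  have h1 : (∃ e₁ e₂, IsDualPair p ((φ c.pt).1 ε) ((ψ c.pt).1 ε) e₁ e₂) ↔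
      ∃ e₁ e₂, IsDualPair c.covector ((φ c.pt).1 ε) ((ψ c.pt).1 ε) e₁ e₂ := by
    rw [h]
    constructor
    · rintro ⟨e₁, e₂, h1, h2, h3, h4, h5, h6⟩
      exact ⟨e₁, e₂, by simp [h1], h2, h3, by simp [h4], h5, h6⟩
    · rintro ⟨e₁, e₂, h1, h2, h3, h4, h5, h6⟩
      simp [hr.ne'] at h1 h4
      exact ⟨e₁, e₂, h1, h2, h3, h4, h5, h6⟩
  rw [h1]
  constructor
  · intro h
    exact exists_isDualPair_iff.2 (h ε hε)
  · rintro ⟨e₁, e₂, hd⟩ ε' hε'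
    refine exists_isDualPair_iff.1 ?_
    obtain ⟨t, rfl⟩ := exists_eq_smul_volForm hε ε'
    have ht : t ≠ 0 := fun h => hε' (by rw [h, zero_smul])
    have ht' : 0 < |t| := abs_pos.2 ht
    rw [(φ c.pt).2.2 t ht, (ψ c.pt).2.2 t ht]
    refine ⟨(|t| ^ (2 / 4 : ℝ))⁻¹ • e₁, (|t| ^ (1 / 4 : ℝ))⁻¹ • e₂, ?_, ?_, ?_, ?_, ?_, ?_⟩
    · simp [hd.p₁]
    · simp [hd.q₁, (Real.rpow_pos_of_pos ht' _).ne']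
    · simp [hd.r₁]
    · simp [hd.p₂]
    · simp [hd.q₂]
    · simp [hd.r₂, (Real.rpow_pos_of_pos ht' _).ne']

theorem exists_gauge (o : ManifoldOrientation M) (𝔓 : ProjectiveStructure M)
    (hc : c ∈ regularSet φ ψ) {p : Cotangent c.pt} (hp : c.IsRep p) :
    ∃ g : Gauge o 𝔓 φ ψ c, g.p = p := by
  obtain ⟨ε, hε⟩ := o.exists_isPos c.pt
  obtain ⟨cov, hcov⟩ := 𝔓.nonempty
  obtain ⟨e₁, e₂, hd⟩ := (mem_regularSet_iff hε.choose hp).1 hc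
  obtain ⟨Θ, hΘ⟩ := exists_eq_smul_volForm hε.choose (wedge p ((φ c.pt).1 ε) ((ψ c.pt).1 ε))
  obtain ⟨E₁, h₁⟩ := exists_isHorizontalLift cov c e₁
  obtain ⟨E₂, h₂⟩ := exists_isHorizontalLift cov c e₂
  exact ⟨⟨cov, hcov, p, hp, ε, hε, Θ, hΘ, e₁, e₂, hd, E₁, E₂, h₁, h₂⟩, rfl⟩

namespace Gauge

variable (g : Gauge o 𝔓 φ ψ c)

/-- The value of `φ` in the scale of the gauge. -/
abbrev φval : Cotangent c.pt := (φ c.pt).1 g.ε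

/-- The value of `ψ` in the scale of the gauge. -/
abbrev ψval : Cotangent c.pt := (ψ c.pt).1 g.ε

theorem ε_ne_zero : g.ε ≠ 0 := g.isPos.choose

theorem Θ_ne_zero : g.Θ ≠ 0 := by
  intro h
  have := g.wedge_eq
  rw [h, zero_smul] at this
  exact g.dual.wedge_ne_zero g.isRep.1 this

theorem ptDeriv_E₁ : ptDeriv c g.E₁ = g.e₁ := ptDeriv_of_isHorizontalLift g.lift₁

theorem ptDeriv_E₂ : ptDeriv c g.E₂ = g.e₂ := ptDeriv_of_isHorizontalLift g.lift₂

/-- The linear map `ℝ⁴ → H_c` that takes `(σ³, σ²τ, στ², τ³)` to the vector prescribed by the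
formula for the twisted cubic in the given gauge. -/
def combination : (Fin 4 → ℝ) →ₗ[ℝ] TangentSpace 𝓘(ℝ, E5) c where
  toFun a := a 0 • g.E₁ + a 1 • g.E₂ + a 3 • g.Θ • verticalVector c g.p g.φval
    - (3 * a 2) • g.Θ • verticalVector c g.p g.ψval
  map_add' a b := by simp only [Pi.add_apply]; module
  map_smul' a b := by simp only [Pi.smul_apply, RingHom.id_apply, smul_eq_mul]; module

theorem combination_apply (a : Fin 4 → ℝ) : g.combination a =
    a 0 • g.E₁ + a 1 • g.E₂ + a 3 • g.Θ • verticalVector c g.p g.φval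
    - (3 * a 2) • g.Θ • verticalVector c g.p g.ψval := rfl

theorem ptDeriv_combination (a : Fin 4 → ℝ) :
    ptDeriv c (g.combination a) = a 0 • g.e₁ + a 1 • g.e₂ := by
  simp only [combination_apply, map_sub, map_add, map_smul, ptDeriv_E₁, ptDeriv_E₂,
    ptDeriv_verticalVector g.isRep, smul_zero, add_zero, sub_zero]

theorem combination_mem (a : Fin 4 → ℝ) : g.combination a ∈ contactH c := by
  rw [mem_contactH_iff g.isRep, ptDeriv_combination]
  simp [g.dual.p₁, g.dual.p₂]

theorem combination_eq_verticalVector {a : Fin 4 → ℝ} (h0 : a 0 = 0) (h1 : a 1 = 0) :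
    g.combination a =
      verticalVector c g.p ((g.Θ * a 3) • g.φval + (-(3 * g.Θ * a 2)) • g.ψval) := by
  rw [combination_apply, h0, h1, verticalVector_add g.isRep, verticalVector_smul g.isRep,
    verticalVector_smul g.isRep]
  module

theorem combination_injective : Function.Injective g.combination := by
  refine (injective_iff_map_eq_zero _).2 fun a ha => ?_
  have h1 := g.ptDeriv_combination a
  rw [ha, map_zero] at h1
  have h0 : a 0 = 0 := by simpa [g.dual.q₁, g.dual.q₂] using (congrArg g.φval h1).symm
  have h1 : a 1 = 0 := by simpa [g.dual.r₁, g.dual.r₂] using (congrArg g.ψval h1).symm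
  rw [g.combination_eq_verticalVector h0 h1] at ha
  obtain ⟨t, ht⟩ := eq_smul_of_verticalVector_eq_zero g.isRep ha
  have h3 := congrArg (fun L : Cotangent c.pt => L g.e₁) ht
  have h2 := congrArg (fun L : Cotangent c.pt => L g.e₂) ht
  simp [g.dual.q₁, g.dual.q₂, g.dual.r₁, g.dual.r₂, g.dual.p₁, g.dual.p₂, g.Θ_ne_zero] at h2 h3
  ext i
  fin_cases i <;> assumption

theorem exists_combination_eq {v : TangentSpace 𝓘(ℝ, E5) c} (hv : v ∈ contactH c) :
    ∃ a, g.combination a = v := by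
  rw [mem_contactH_iff g.isRep] at hv
  have h1 := g.dual.eq_add g.isRep.1 hv
  have h2 : ptDeriv c (v - g.combination ![g.φval (ptDeriv c v), g.ψval (ptDeriv c v), 0, 0]) =
      0 := by
    rw [map_sub, ptDeriv_combination]
    exact sub_eq_zero.2 h1
  obtain ⟨ν, hν⟩ := exists_verticalVector_eq g.isRep h2
  obtain ⟨t, ht⟩ := g.dual.covector_eq g.isRep.1 ν
  have hΘ := g.Θ_ne_zero
  refine ⟨![g.φval (ptDeriv c v), g.ψval (ptDeriv c v), 0, 0] +
    ![0, 0, -(ν g.e₂ / (3 * g.Θ)), ν g.e₁ / g.Θ], ?_⟩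
  rw [map_add, g.combination_eq_verticalVector (a := ![0, 0, -(ν g.e₂ / (3 * g.Θ)), ν g.e₁ / g.Θ])
    rfl rfl]
  rw [sub_eq_iff_eq_add'] at hν
  refine Eq.trans ?_ hν.symm
  have h3 : verticalVector c g.p ν =
      verticalVector c g.p (ν g.e₁ • g.φval + ν g.e₂ • g.ψval) := by
    conv_lhs => rw [ht]
    rw [add_assoc, verticalVector_add g.isRep (t • g.p), verticalVector_smul g.isRep t,
      verticalVector_self g.isRep, smul_zero, zero_add]
  rw [h3]
  have h4 : g.Θ * (ν g.e₁ / g.Θ) = ν g.e₁ := by field_simp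
  have h5 : -(3 * g.Θ * -(ν g.e₂ / (3 * g.Θ))) = ν g.e₂ := by field_simp
  simp only [Matrix.cons_val, h4, h5]

/-- The isomorphism `⊙³S_c ≅ H_c` defined by the formula for the twisted cubic in a gauge. -/
def equiv : Sym[ℝ]^3 (Spinor c) ≃ₗ[ℝ] contactH c :=
  (cubicEquiv (spinorEquiv c g.ε_ne_zero)).trans
    (LinearEquiv.ofBijective (g.combination.codRestrict (contactH c) g.combination_mem)
      ⟨fun _ _ h => g.combination_injective (congrArg Subtype.val h), fun v => by
        obtain ⟨a, ha⟩ := g.exists_combination_eq v.2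
        exact ⟨a, Subtype.ext ha⟩⟩)

theorem equiv_tprod (s : Fin 3 → Spinor c) :
    (g.equiv (SymmetricPower.tprod ℝ s) : TangentSpace 𝓘(ℝ, E5) c) =
      g.combination (cubicCoeff
        ((LinearMap.fst ℝ ℝ ℝ).comp (spinorEquiv c g.ε_ne_zero).toLinearMap)
        ((LinearMap.snd ℝ ℝ ℝ).comp (spinorEquiv c g.ε_ne_zero).toLinearMap) s) :=
  congrArg g.combination (cubicEquiv_tprod (spinorEquiv c g.ε_ne_zero) s)

theorem equiv_cube (σ : Density (2 / 3) c.pt) (τ : Density (-1 / 3) c.pt) :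
    (g.equiv (cube (σ, τ)) : TangentSpace 𝓘(ℝ, E5) c) =
      σ.1 g.ε ^ 3 • g.E₁ + (σ.1 g.ε ^ 2 * τ.1 g.ε) • g.E₂ +
          τ.1 g.ε ^ 3 • g.Θ • verticalVector c g.p g.φval -
          (3 * σ.1 g.ε * τ.1 g.ε ^ 2) • g.Θ • verticalVector c g.p g.ψval := by
  rw [cube, equiv_tprod, combination_apply]
  simp only [cubicCoeff, LinearMap.comp_apply, LinearEquiv.coe_coe, spinorEquiv_apply,
    LinearMap.fst_apply, LinearMap.snd_apply]
  simp only [Matrix.cons_val_zero, Matrix.cons_val_one, Matrix.cons_val]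
  module

/-- The isomorphism does not depend on the gauge. For `ε' = u¹² ε` and `p' = r p` one has
`φ' = u⁶ φ`, `ψ' = u³ ψ`, `Θ' = r u⁻³ Θ`, `E₁' = u⁻⁶ E₁`, `E₂' = u⁻³ E₂`, `σ' = u² σ`, `τ' = u⁻¹ τ`,
and vertical vectors are multiplied by `r⁻¹`, so that all factors cancel in each term. -/
theorem equiv_eq (g' : Gauge o 𝔓 φ ψ c) : g'.equiv = g.equiv := by
  refine symPower_equiv_ext fun s => ?_
  obtain ⟨σ, τ⟩ := s
  refine (g'.equiv_cube σ τ).trans (Eq.trans ?_ (g.equiv_cube σ τ).symm)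
  obtain ⟨u, hu, hε⟩ := g.isPos.exists_smul_eq g'.isPos
  obtain ⟨r, hr, hp⟩ := IsRep.exists_smul_eq g.isRep g'.isRep
  have hφ : g'.φval = u ^ 6 • g.φval := by
    have := Weighted.apply_pow_smul (φ c.pt) hu g.ε
    rw [← hε] at this
    exact this.trans (by norm_num)
  have hψ : g'.ψval = u ^ 3 • g.ψval := by
    have := Weighted.apply_pow_smul (ψ c.pt) hu g.ε
    rw [← hε] at this
    exact this.trans (by norm_num)
  have hσ : σ.1 g'.ε = u ^ 2 * σ.1 g.ε := by
    rw [hε, Weighted.apply_pow_smul σ hu, smul_eq_mul]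
    norm_num
  have hτ : τ.1 g'.ε = u⁻¹ * τ.1 g.ε := by
    rw [hε, Weighted.apply_pow_smul τ hu, smul_eq_mul]
    norm_num [Real.rpow_neg_one]
  have hΘ : g'.Θ = r * (u ^ 3)⁻¹ * g.Θ := by
    have h1 := g'.wedge_eq
    change wedge g'.p g'.φval g'.ψval = _ at h1
    rw [hp, hφ, hψ, wedge_smul, g.wedge_eq, hε, smul_smul, smul_smul] at h1
    have h2 := smul_left_injective ℝ g.ε_ne_zero h1
    field_simp
    have : u ^ 9 * (g'.Θ * u ^ 3) = u ^ 9 * (r * g.Θ) := by linear_combination -h2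
    exact mul_left_cancel₀ (by positivity) this
  have h1 : g'.e₁ = (u ^ 6)⁻¹ • g.e₁ := by
    have hp1 := g'.dual.p₁
    have hq1 := g'.dual.q₁
    have hr1 := g'.dual.r₁
    change g'.φval _ = _ at hq1
    change g'.ψval _ = _ at hr1
    rw [hp] at hp1
    rw [hφ] at hq1
    rw [hψ] at hr1
    simp [hr.ne', hu.ne'] at hp1 hq1 hr1
    have := g.dual.eq_add g.isRep.1 hp1
    rw [show (φ c.pt).1 g.ε g'.e₁ = (u ^ 6)⁻¹ from eq_inv_of_mul_eq_one_right hq1, hr1] at this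
    simpa using this
  have h2 : g'.e₂ = (u ^ 3)⁻¹ • g.e₂ := by
    have hp1 := g'.dual.p₂
    have hq1 := g'.dual.q₂
    have hr1 := g'.dual.r₂
    change g'.φval _ = _ at hq1
    change g'.ψval _ = _ at hr1
    rw [hp] at hp1
    rw [hφ] at hq1
    rw [hψ] at hr1
    simp [hr.ne', hu.ne'] at hp1 hq1 hr1
    have := g.dual.eq_add g.isRep.1 hp1
    rw [show (ψ c.pt).1 g.ε g'.e₂ = (u ^ 3)⁻¹ from eq_inv_of_mul_eq_one_right hr1, hq1] at this
    simpa using this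
  have hE₁ : g'.E₁ = (u ^ 6)⁻¹ • g.E₁ :=
    IsHorizontalLift.eq_smul g.cov_mem g'.cov_mem g.isRep g.dual.p₁ g.lift₁ (h1 ▸ g'.lift₁)
  have hE₂ : g'.E₂ = (u ^ 3)⁻¹ • g.E₂ :=
    IsHorizontalLift.eq_smul g.cov_mem g'.cov_mem g.isRep g.dual.p₂ g.lift₂ (h2 ▸ g'.lift₂)
  rw [hσ, hτ, hE₁, hE₂, hΘ, hp, hφ, hψ, verticalVector_smul_left g.isRep hr,
    verticalVector_smul_left g.isRep hr, verticalVector_smul g.isRep,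
    verticalVector_smul g.isRep]
  simp only [smul_smul]
  refine congrArg₂ (· - ·) (congrArg₂ (· + ·) (congrArg₂ (· + ·) ?_ ?_) ?_) ?_ <;>
    refine congrArg (· • _) ?_ <;> field_simp

end Gauge

variable (o 𝔓 φ ψ) in
/-- The isomorphism `⊙³S_c ≅ H_c` at a regular saucer, defined by means of an arbitrary gauge. -/
def twistedCubic (c : regularSet φ ψ) : Sym[ℝ]^3 (Spinor c.1) ≃ₗ[ℝ] contactH c.1 :=
  (exists_gauge o 𝔓 c.2 (isRep_covector c.1)).choose.equiv

theorem twistedCubic_eq {c : regularSet φ ψ} (g : Gauge o 𝔓 φ ψ c.1) :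
    twistedCubic o 𝔓 φ ψ c = g.equiv := g.equiv_eq _

end Gauge

/-! ### Smooth frames, scales and Christoffel symbols -/

section Smoothness
variable {M : Type*} [TopologicalSpace M] [ChartedSpace E3 M] [IsManifold (𝓡 3) ∞ M]

theorem contMDiffAt_frameCoord {x₀ : M} (A : E3 ≃L[ℝ] E3) {x : M}
    (hx : x ∈ (chartAt E3 x₀).source) {Y : ∀ x : M, TangentSpace (𝓡 3) x}
    (hY : ContMDiffAt (𝓡 3) (𝓡 3).tangent ∞ (fun y => (⟨y, Y y⟩ : TangentBundle (𝓡 3) M)) x) :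
    ContMDiffAt (𝓡 3) 𝓘(ℝ, E3) ∞ (fun y => frameCoord x₀ A y (Y y)) x := by
  rw [Trivialization.contMDiffAt_section_iff
    (e := trivializationAt E3 (TangentSpace (𝓡 3)) x₀) hx] at hY
  exact A.symm.contDiff.contMDiff.contMDiffAt.comp x hY

theorem contMDiffAt_form_apply {η : ∀ x : M, Cotangent x} {s : Set M} (hη : SmoothFormOn η s)
    {x : M} (hs : s ∈ 𝓝 x) {Y : ∀ x : M, TangentSpace (𝓡 3) x}
    (hY : ContMDiffAt (𝓡 3) (𝓡 3).tangent ∞ (fun y => (⟨y, Y y⟩ : TangentBundle (𝓡 3) M)) x) :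
    ContMDiffAt (𝓡 3) 𝓘(ℝ, ℝ) ∞ (fun y => η y (Y y)) x := by
  have := ContMDiffAt.clm_bundle_apply (E₂ := Trivial M ℝ) (F₂ := ℝ) (b := fun y : M => y)
    (ϕ := fun y => η y) (v := fun y => Y y) (hη.contMDiffAt hs) hY
  rw [contMDiffAt_totalSpace] at this
  exact this.2

/-- The volume form that takes the value `1` on the coordinate frame. -/
def frameVol (x₀ : M) (A : E3 ≃L[ℝ] E3) (x : M) : VolForm x :=
  wedge ((EuclideanSpace.proj (𝕜 := ℝ) (0 : Fin 3) : E3 →L[ℝ] ℝ).comp (frameCoord x₀ A x))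
    ((EuclideanSpace.proj (𝕜 := ℝ) (1 : Fin 3) : E3 →L[ℝ] ℝ).comp (frameCoord x₀ A x))
    ((EuclideanSpace.proj (𝕜 := ℝ) (2 : Fin 3) : E3 →L[ℝ] ℝ).comp (frameCoord x₀ A x))

theorem frameVol_apply (x₀ : M) (A : E3 ≃L[ℝ] E3) (x : M) (v : Fin 3 → TangentSpace (𝓡 3) x) :
    frameVol x₀ A x v =
      frameCoord x₀ A x (v 0) 0 * (frameCoord x₀ A x (v 1) 1 * frameCoord x₀ A x (v 2) 2
        - frameCoord x₀ A x (v 2) 1 * frameCoord x₀ A x (v 1) 2)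
      - frameCoord x₀ A x (v 0) 1 * (frameCoord x₀ A x (v 1) 0 * frameCoord x₀ A x (v 2) 2
        - frameCoord x₀ A x (v 2) 0 * frameCoord x₀ A x (v 1) 2)
      + frameCoord x₀ A x (v 0) 2 * (frameCoord x₀ A x (v 1) 0 * frameCoord x₀ A x (v 2) 1
        - frameCoord x₀ A x (v 2) 0 * frameCoord x₀ A x (v 1) 1) :=
  wedge_apply _ _ _ _

theorem frameVol_frameVec {x₀ : M} (A : E3 ≃L[ℝ] E3) {x : M} (hx : x ∈ (chartAt E3 x₀).source) :
    frameVol x₀ A x (frameVec x₀ A x) = 1 := by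
  rw [frameVol_apply]
  simp [frameCoord_frameVec A hx]

theorem contMDiffAt_frameVol {x₀ : M} (A : E3 ≃L[ℝ] E3) {x : M}
    (hx : x ∈ (chartAt E3 x₀).source) {Y : Fin 3 → ∀ x : M, TangentSpace (𝓡 3) x}
    (hY : ∀ i, SmoothField (Y i)) :
    ContMDiffAt (𝓡 3) 𝓘(ℝ, ℝ) ∞ (fun y => frameVol x₀ A y (fun i => Y i y)) x := by
  have h : ∀ i j : Fin 3, ContMDiffAt (𝓡 3) 𝓘(ℝ, ℝ) ∞
      (fun y => frameCoord x₀ A y (Y i y) j) x := fun i j =>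
    (EuclideanSpace.proj (𝕜 := ℝ) j : E3 →L[ℝ] ℝ).contDiff.contMDiff.contMDiffAt.comp x
      (contMDiffAt_frameCoord A hx (hY i x))
  simp only [frameVol_apply]
  exact (((h 0 0).mul (((h 1 1).mul (h 2 2)).sub ((h 2 1).mul (h 1 2)))).sub
    ((h 0 1).mul (((h 1 0).mul (h 2 2)).sub ((h 2 0).mul (h 1 2))))).add
    ((h 0 2).mul (((h 1 0).mul (h 2 1)).sub ((h 2 0).mul (h 1 1))))

variable [T2Space M]

/-- Smoothness of `3`-forms and of connections is defined by means of global vector fields, so the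
coordinate frame has to be extended from a neighbourhood of the point. -/
theorem exists_smoothField_eq_frameVec (x₀ : M) (A : E3 ≃L[ℝ] E3) (i : Fin 3) :
    ∃ G : ∀ x : M, TangentSpace (𝓡 3) x, SmoothField G ∧ ∀ᶠ x in 𝓝 x₀, G x = frameVec x₀ A x i := by
  obtain ⟨χ⟩ : Nonempty (SmoothBumpFunction (𝓡 3) x₀) := inferInstance
  refine ⟨fun x => χ x • frameVec x₀ A x i, ?_, ?_⟩
  · exact ContMDiffOn.smul_section_of_tsupport χ.contMDiff.contMDiffOn
      (chartAt E3 x₀).open_source χ.tsupport_subset_chartAt_source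
      fun x hx => (contMDiffAt_frameVec A hx i).contMDiffWithinAt
  · filter_upwards [χ.eventuallyEq_one] with x hx
    rw [hx, Pi.one_apply, one_smul]

theorem exists_smoothVol_isPos (o : ManifoldOrientation M) (x₀ : M) :
    ∃ ε : ∀ x : M, VolForm x, SmoothVol ε ∧ o.IsPos (ε x₀) := by
  obtain ⟨χ⟩ : Nonempty (SmoothBumpFunction (𝓡 3) x₀) := inferInstance
  have hx₀ := mem_chart_source E3 x₀
  set A : E3 ≃L[ℝ] E3 := ContinuousLinearEquiv.refl ℝ E3
  have hsm : ∀ s : ℝ, SmoothVol fun x => s • χ x • frameVol x₀ A x := by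
    intro s Y hY
    have := χ.contMDiff_smul (g := fun x => frameVol x₀ A x fun i => Y i x)
      fun x hx => (contMDiffAt_frameVol A hx hY).contMDiffWithinAt
    exact (contMDiff_const (I := 𝓡 3) (I' := 𝓘(ℝ, ℝ)) (c := s)).smul this
  obtain ⟨ε, hε⟩ := o.exists_isPos x₀
  have h0 : frameVol x₀ A x₀ ≠ 0 := by
    intro h
    have := frameVol_frameVec A hx₀
    rw [h] at this
    exact zero_ne_one this
  obtain ⟨t, ht⟩ := exists_eq_smul_volForm h0 ε
  refine ⟨fun x => t • χ x • frameVol x₀ A x, hsm t, ?_⟩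
  have : t • χ x₀ • frameVol x₀ A x₀ = ε := by
    rw [χ.eventuallyEq_one.self_of_nhds, Pi.one_apply, one_smul, ht]
  change o.IsPos (t • χ x₀ • frameVol x₀ A x₀)
  rw [this]
  exact hε

/-- The Christoffel symbols of a smooth connection are smooth. -/
theorem contMDiffAt_connection {cov : Connection M}
    (hcov : CovariantDerivative.ContMDiffCovariantDerivative cov ∞) (x₀ : M) (A : E3 ≃L[ℝ] E3)
    (i j : Fin 3) :
    ContMDiffAt (𝓡 3) 𝓘(ℝ, E3) ∞ (fun x => frameCoord x₀ A x
      (cov (fun y => frameVec x₀ A y i) x (frameVec x₀ A x j))) x₀ := by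
  have hx₀ := mem_chart_source E3 x₀
  obtain ⟨G, hG, hGe⟩ := exists_smoothField_eq_frameVec x₀ A i
  have h1 := ((hcov.contMDiff.contMDiff (σ := G) (hG.contMDiffOn)).contMDiffAt
    (x := x₀) Filter.univ_mem)
  have h2 := ContMDiffAt.clm_bundle_apply (b := fun y : M => y)
    (ϕ := fun y => cov G y) (v := fun y => frameVec x₀ A y j) h1 (contMDiffAt_frameVec A hx₀ j)
  refine (contMDiffAt_frameCoord A hx₀ h2).congr_of_eventuallyEq ?_
  filter_upwards [hGe.eventually_nhds, (chartAt E3 x₀).open_source.mem_nhds hx₀] with x hx hx'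
  have : cov (fun y => frameVec x₀ A y i) x = cov G x :=
    cov.isCovariantDerivativeOnUniv.congr_of_eventuallyEq (diffFieldAt_frameVec A hx' i)
      (hG.mdifferentiableAt (by simp)) Filter.univ_mem (hx.mono fun y hy => hy.symm)
  rw [this]

end Smoothness

/-! ### Smoothness of the isomorphism -/

section LocalGauge
variable {M : Type*} [TopologicalSpace M] [ChartedSpace E3 M] [IsManifold (𝓡 3) ∞ M]

/-- The covector `dx⁰ + a dx¹ + b dx²` representing `c` in the chart around `c₀`. -/
def normCovector (c₀ c : ConfigSpace M) : Cotangent c.pt :=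
  chartCovector c₀.pt (chartFrame c₀) (extChartAt 𝓘(ℝ, E5) c₀ c).2.1
    (extChartAt 𝓘(ℝ, E5) c₀ c).2.2 c.pt

theorem normCovector_apply (c₀ c : ConfigSpace M) (v : TangentSpace (𝓡 3) c.pt) :
    normCovector c₀ c v = frameCoord c₀.pt (chartFrame c₀) c.pt v 0
      + (extChartAt 𝓘(ℝ, E5) c₀ c).2.1 * frameCoord c₀.pt (chartFrame c₀) c.pt v 1
      + (extChartAt 𝓘(ℝ, E5) c₀ c).2.2 * frameCoord c₀.pt (chartFrame c₀) c.pt v 2 := rfl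

theorem normCovector_chartVec {c₀ c : ConfigSpace M} (hc : c ∈ (chartAt E5 c₀).source)
    (i : Fin 3) : normCovector c₀ c (chartVec c₀ c.pt i) =
      ![1, (extChartAt 𝓘(ℝ, E5) c₀ c).2.1, (extChartAt 𝓘(ℝ, E5) c₀ c).2.2] i := by
  rw [normCovector_apply, frameCoord_frameVec _ hc.1]
  fin_cases i <;> simp

theorem isRep_normCovector {c₀ c : ConfigSpace M} (hc : c ∈ (chartAt E5 c₀).source) :
    c.IsRep (normCovector c₀ c) := by
  refine ⟨fun h => ?_, ?_⟩
  · have := normCovector_chartVec hc 0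
    rw [h] at this
    exact zero_ne_one this
  · exact saucer_eq hc.2 (ConfigSpace.covector_eq c₀.pt (chartFrame c₀) c hc.1 hc.2.ne')

theorem tangentTriv_eq_coordDeriv {c₀ c : ConfigSpace M} (hc : c ∈ (chartAt E5 c₀).source)
    (v : TangentSpace 𝓘(ℝ, E5) c) :
    (trivializationAt E5 (TangentSpace 𝓘(ℝ, E5)) c₀ ⟨c, v⟩).2 = coordDeriv c₀ c v :=
  congrArg (fun L => L v) ((TangentBundle.continuousLinearMapAt_trivializationAt_eq_core
    (I := 𝓘(ℝ, E5)) hc).symm.trans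
      (TangentBundle.continuousLinearMapAt_trivializationAt (I := 𝓘(ℝ, E5)) hc))

theorem contMDiffAt_configField_iff {Z : ∀ c : ConfigSpace M, TangentSpace 𝓘(ℝ, E5) c}
    (c₀ : ConfigSpace M) :
    ContMDiffAt 𝓘(ℝ, E5) 𝓘(ℝ, E5).tangent ∞
      (fun c => (⟨c, Z c⟩ : TangentBundle 𝓘(ℝ, E5) (ConfigSpace M))) c₀ ↔
    ContMDiffAt 𝓘(ℝ, E5) 𝓘(ℝ, E5) ∞ (fun c => coordDeriv c₀ c (Z c)) c₀ := by
  rw [Trivialization.contMDiffAt_section_iff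
    (e := trivializationAt E5 (TangentSpace 𝓘(ℝ, E5)) c₀) (mem_chart_source E5 c₀)]
  refine Filter.EventuallyEq.contMDiffAt_iff ?_
  filter_upwards [(chartAt E5 c₀).open_source.mem_nhds (mem_chart_source E5 c₀)] with c hc
  exact tangentTriv_eq_coordDeriv hc (Z c)

theorem coordDeriv_combination {o : ManifoldOrientation M} {𝔓 : ProjectiveStructure M}
    {φ : ∀ x : M, WeightedCovector 2 x} {ψ : ∀ x : M, WeightedCovector 1 x}
    {c₀ c : ConfigSpace M} (g : Gauge o 𝔓 φ ψ c) (hc : c ∈ (chartAt E5 c₀).source)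
    (a : Fin 4 → ℝ) :
    coordDeriv c₀ c (g.combination a) =
      a 0 • liftCoords g.cov c₀ g.p g.e₁ + a 1 • liftCoords g.cov c₀ g.p g.e₂
      + a 3 • g.Θ • ((0, affDeriv (fun i => g.p (chartVec c₀ c.pt i))
          fun i => g.φval (chartVec c₀ c.pt i)) : E5)
      - (3 * a 2) • g.Θ • ((0, affDeriv (fun i => g.p (chartVec c₀ c.pt i))
          fun i => g.ψval (chartVec c₀ c.pt i)) : E5) := by
  rw [g.combination_apply]
  simp only [map_sub, map_add, map_smul, coordDeriv_verticalVector hc g.isRep,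
    coordDeriv_of_isHorizontalLift hc g.lift₁ g.isRep,
    coordDeriv_of_isHorizontalLift hc g.lift₂ g.isRep]

theorem apply_frameVec_ne_zero {x₀ x : M} (A : E3 ≃L[ℝ] E3) (hx : x ∈ (chartAt E3 x₀).source)
    {ε : VolForm x} (hε : ε ≠ 0) : ε (frameVec x₀ A x) ≠ 0 := by
  have h0 : frameVol x₀ A x ≠ 0 := by
    intro h
    have := frameVol_frameVec A hx
    rw [h] at this
    exact zero_ne_one this
  obtain ⟨t, rfl⟩ := exists_eq_smul_volForm h0 ε
  rw [AlternatingMap.smul_apply, frameVol_frameVec A hx, smul_eq_mul, mul_one]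
  rintro rfl
  simp at hε

theorem contMDiffAt_normCoord (c₀ : ConfigSpace M) (i : Fin 3) :
    ContMDiffAt 𝓘(ℝ, E5) 𝓘(ℝ, ℝ) ∞ (fun c : ConfigSpace M =>
      (![1, (extChartAt 𝓘(ℝ, E5) c₀ c).2.1, (extChartAt 𝓘(ℝ, E5) c₀ c).2.2] : Fin 3 → ℝ) i)
      c₀ := by
  have h : ContMDiffAt 𝓘(ℝ, E5) 𝓘(ℝ, E5) ∞ (extChartAt 𝓘(ℝ, E5) c₀) c₀ := contMDiffAt_extChartAt
  fin_cases i
  · exact contMDiffAt_const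
  · exact (contDiff_fst.comp contDiff_snd :
      ContDiff ℝ ∞ fun y : E5 => y.2.1).contMDiff.contMDiffAt.comp c₀ h
  · exact (contDiff_snd.comp contDiff_snd :
      ContDiff ℝ ∞ fun y : E5 => y.2.2).contMDiff.contMDiffAt.comp c₀ h

theorem contMDiffAt_normCovector (c₀ : ConfigSpace M) (i : Fin 3) :
    ContMDiffAt 𝓘(ℝ, E5) 𝓘(ℝ, ℝ) ∞ (fun c : ConfigSpace M =>
      normCovector c₀ c (chartVec c₀ c.pt i)) c₀ := by
  refine (contMDiffAt_normCoord c₀ i).congr_of_eventuallyEq ?_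
  filter_upwards [(chartAt E5 c₀).open_source.mem_nhds (mem_chart_source E5 c₀)] with c hc
  exact normCovector_chartVec hc i

theorem contMDiffAt_affDeriv {c₀ : ConfigSpace M} {w : ConfigSpace M → Fin 3 → ℝ}
    (hw : ∀ i, ContMDiffAt 𝓘(ℝ, E5) 𝓘(ℝ, ℝ) ∞ (fun c => w c i) c₀) :
    ContMDiffAt 𝓘(ℝ, E5) 𝓘(ℝ, ℝ × ℝ) ∞ (fun c => affDeriv
      (fun i => normCovector c₀ c (chartVec c₀ c.pt i)) (w c)) c₀ := by
  have h := contMDiffAt_normCoord c₀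
  refine (ContMDiffAt.prodMk_space (((hw 1).mul (h 0)).sub ((h 1).mul (hw 0)))
    (((hw 2).mul (h 0)).sub ((h 2).mul (hw 0)))).congr_of_eventuallyEq ?_
  filter_upwards [(chartAt E5 c₀).open_source.mem_nhds (mem_chart_source E5 c₀)] with c hc
  simp [affDeriv, normCovector_chartVec hc]

theorem contMDiffAt_liftCoords [T2Space M] {cov : Connection M}
    (hcov : CovariantDerivative.ContMDiffCovariantDerivative cov ∞) (c₀ : ConfigSpace M)
    (j : Fin 3) :
    ContMDiffAt 𝓘(ℝ, E5) 𝓘(ℝ, E5) ∞ (fun c : ConfigSpace M =>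
      liftCoords cov c₀ (normCovector c₀ c) (chartVec c₀ c.pt j)) c₀ := by
  have hΓ : ∀ i k : Fin 3, ContMDiffAt 𝓘(ℝ, E5) 𝓘(ℝ, ℝ) ∞ (fun c : ConfigSpace M =>
      frameCoord c₀.pt (chartFrame c₀) c.pt
        (cov (fun y => chartVec c₀ y i) c.pt (chartVec c₀ c.pt j)) k) c₀ := fun i k =>
    (EuclideanSpace.proj (𝕜 := ℝ) k : E3 →L[ℝ] ℝ).contDiff.contMDiff.contMDiffAt.comp c₀
      ((contMDiffAt_connection hcov c₀.pt (chartFrame c₀) i j).comp c₀ (contMDiff_pt c₀))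
  have h := contMDiffAt_normCoord c₀
  have h1 := contMDiffAt_affDeriv (c₀ := c₀) (w := fun c i => normCovector c₀ c
    (cov (fun y => chartVec c₀ y i) c.pt (chartVec c₀ c.pt j))) fun i => by
      simp only [normCovector_apply]
      exact ((hΓ i 0).add ((h 1).mul (hΓ i 1))).add ((h 2).mul (hΓ i 2))
  refine (ContMDiffAt.prodMk_space (contMDiffAt_const (c := chartFrame c₀
    (EuclideanSpace.single j 1))) h1).congr_of_eventuallyEq ?_
  filter_upwards [(chartAt E5 c₀).open_source.mem_nhds (mem_chart_source E5 c₀)] with c hc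
  rw [liftCoords, tangentCoordChange_frameVec _ hc.1]

theorem contMDiffAt_weightedForm {w : ℝ} {φ : ∀ x : M, WeightedCovector w x}
    (hφ : SmoothWeightedForm φ) {ε : ∀ x : M, VolForm x} (hε : SmoothVol ε) {c₀ : ConfigSpace M}
    (h0 : ∀ᶠ x in 𝓝 c₀.pt, ε x ≠ 0) (i : Fin 3) :
    ContMDiffAt 𝓘(ℝ, E5) 𝓘(ℝ, ℝ) ∞ (fun c : ConfigSpace M =>
      (φ c.pt).1 (ε c.pt) (chartVec c₀ c.pt i)) c₀ :=
  (contMDiffAt_form_apply (hφ ε hε) h0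
    (contMDiffAt_frameVec (chartFrame c₀) (mem_chart_source E3 c₀.pt) i)).comp c₀ (contMDiff_pt c₀)

theorem contMDiffAt_wedge {c₀ : ConfigSpace M} {p q r : ∀ c : ConfigSpace M, Cotangent c.pt}
    (hp : ∀ i, ContMDiffAt 𝓘(ℝ, E5) 𝓘(ℝ, ℝ) ∞ (fun c => p c (chartVec c₀ c.pt i)) c₀)
    (hq : ∀ i, ContMDiffAt 𝓘(ℝ, E5) 𝓘(ℝ, ℝ) ∞ (fun c => q c (chartVec c₀ c.pt i)) c₀)
    (hr : ∀ i, ContMDiffAt 𝓘(ℝ, E5) 𝓘(ℝ, ℝ) ∞ (fun c => r c (chartVec c₀ c.pt i)) c₀) :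
    ContMDiffAt 𝓘(ℝ, E5) 𝓘(ℝ, ℝ) ∞
      (fun c => wedge (p c) (q c) (r c) (chartVec c₀ c.pt)) c₀ := by
  simp only [wedge_apply]
  exact (((hp 0).mul (((hq 1).mul (hr 2)).sub ((hq 2).mul (hr 1)))).sub
    ((hq 0).mul (((hp 1).mul (hr 2)).sub ((hp 2).mul (hr 1))))).add
    ((hr 0).mul (((hp 1).mul (hq 2)).sub ((hp 2).mul (hq 1))))

theorem contMDiffAt_vol [T2Space M] {ε : ∀ x : M, VolForm x} (hε : SmoothVol ε)
    (c₀ : ConfigSpace M) :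
    ContMDiffAt 𝓘(ℝ, E5) 𝓘(ℝ, ℝ) ∞
      (fun c : ConfigSpace M => ε c.pt (chartVec c₀ c.pt)) c₀ := by
  choose G hG hGe using exists_smoothField_eq_frameVec c₀.pt (chartFrame c₀)
  refine (((hε G hG) c₀.pt).comp c₀ (contMDiff_pt c₀)).congr_of_eventuallyEq ?_
  have h : ∀ᶠ x in 𝓝 c₀.pt, ∀ i, G i x = chartVec c₀ x i := Filter.eventually_all.2 hGe
  filter_upwards [contMDiff_pt.continuous.continuousAt.eventually h] with c hc
  exact congrArg (ε c.pt) (funext fun i => (hc i).symm)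

theorem mem_regularSet_iff_wedge_ne_zero {φ : ∀ x : M, WeightedCovector 2 x}
    {ψ : ∀ x : M, WeightedCovector 1 x} {c₀ c : ConfigSpace M} (hc : c ∈ (chartAt E5 c₀).source)
    {ε : VolForm c.pt} (hε : ε ≠ 0) :
    c ∈ regularSet φ ψ ↔
      wedge (normCovector c₀ c) ((φ c.pt).1 ε) ((ψ c.pt).1 ε) (chartVec c₀ c.pt) ≠ 0 := by
  rw [mem_regularSet_iff hε (isRep_normCovector hc)]
  constructor
  · rintro ⟨e₁, e₂, h⟩
    exact apply_frameVec_ne_zero _ hc.1 (h.wedge_ne_zero (isRep_normCovector hc).1)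
  · intro h
    exact ⟨_, _, IsDualPair.of_wedge _ h⟩

theorem isOpen_regularSet [T2Space M] (o : ManifoldOrientation M)
    {φ : ∀ x : M, WeightedCovector 2 x} (hφ : SmoothWeightedForm φ)
    {ψ : ∀ x : M, WeightedCovector 1 x} (hψ : SmoothWeightedForm ψ) :
    IsOpen (regularSet φ ψ) := by
  refine isOpen_iff_mem_nhds.2 fun c₀ h₀ => ?_
  obtain ⟨ε, hε, hpos⟩ := exists_smoothVol_isPos o c₀.pt
  have h0 : ∀ᶠ x in 𝓝 c₀.pt, ε x ≠ 0 :=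
    Filter.Eventually.mono ((o.isOpen_pos ε hε).mem_nhds hpos) fun x hx => hx.choose
  have hD := contMDiffAt_wedge (contMDiffAt_normCovector c₀)
    (contMDiffAt_weightedForm hφ hε h0) (contMDiffAt_weightedForm hψ hε h0)
  have hc₀ := mem_chart_source E5 c₀
  filter_upwards [(chartAt E5 c₀).open_source.mem_nhds hc₀,
    contMDiff_pt.continuous.continuousAt.eventually h0,
    hD.continuousAt.eventually_ne ((mem_regularSet_iff_wedge_ne_zero hc₀ hpos.choose).1 h₀)]
    with c hc hc0 hcD
  exact (mem_regularSet_iff_wedge_ne_zero hc hc0).2 hcD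

/-- Linearity of the lift on the expressions that occur in Cramer's rule. -/
theorem liftCoords_dual (cov : Connection M) (c₀ : ConfigSpace M) {x : M} (p : Cotangent x)
    (d k₀ k₁ k₂ : ℝ) (v : Fin 3 → TangentSpace (𝓡 3) x) :
    liftCoords cov c₀ p (d • (k₀ • v 0 + k₁ • v 1 + k₂ • v 2)) =
      d • (k₀ • liftCoords cov c₀ p (v 0) + k₁ • liftCoords cov c₀ p (v 1)
        + k₂ • liftCoords cov c₀ p (v 2)) := by
  simp only [liftCoords_add, liftCoords_smul]

/-- Near each saucer the construction is carried out in gauges that vary smoothly: a fixed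
connection, the normalized covector, a local smooth scale and the dual basis given by Cramer's
rule. -/
theorem smooth_twistedCubic [T2Space M] {o : ManifoldOrientation M} {𝔓 : ProjectiveStructure M}
    {φ : ∀ x : M, WeightedCovector 2 x} (hφ : SmoothWeightedForm φ)
    {ψ : ∀ x : M, WeightedCovector 1 x} (hψ : SmoothWeightedForm ψ)
    {W : Set (ConfigSpace M)} (hWU : W ⊆ regularSet φ ψ) (hW : IsOpen W)
    {s : Fin 3 → ∀ c : ConfigSpace M, Spinor c} (hs : ∀ i, SmoothSpinorOn (s i) W)
    {Z : ∀ c : ConfigSpace M, TangentSpace 𝓘(ℝ, E5) c}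
    (hZ : ∀ c : regularSet φ ψ, c.1 ∈ W →
      Z c.1 = twistedCubic o 𝔓 φ ψ c (SymmetricPower.tprod ℝ (fun i => s i c.1))) :
    SmoothConfigFieldOn Z W := by
  intro c₀ hc₀W
  refine ContMDiffAt.contMDiffWithinAt ((contMDiffAt_configField_iff c₀).2 ?_)
  obtain ⟨cov, hcov⟩ := 𝔓.nonempty
  obtain ⟨ε, hε, hpos⟩ := exists_smoothVol_isPos o c₀.pt
  have hpos' : ∀ᶠ x in 𝓝 c₀.pt, o.IsPos (ε x) := (o.isOpen_pos ε hε).mem_nhds hpos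
  have h0 : ∀ᶠ x in 𝓝 c₀.pt, ε x ≠ 0 := hpos'.mono fun x hx => hx.choose
  have hc₀ := mem_chart_source E5 c₀
  have hp := contMDiffAt_normCovector c₀
  have hq := contMDiffAt_weightedForm hφ hε h0
  have hr := contMDiffAt_weightedForm hψ hε h0
  have hD := contMDiffAt_wedge hp hq hr
  have hD0 := (mem_regularSet_iff_wedge_ne_zero hc₀ hpos.choose).1 (hWU hc₀W)
  have hDi := hD.inv₀ hD0
  have hΘ := hD.mul ((contMDiffAt_vol hε c₀).inv₀
    (apply_frameVec_ne_zero _ hc₀.1 hpos.choose))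
  have hL := contMDiffAt_liftCoords (𝔓.isSmoothTorsionFree cov hcov).1 c₀
  have hL₁ := hDi.smul ((((((hr 1).mul (hp 2)).sub ((hr 2).mul (hp 1))).smul (hL 0)).add
    ((((hr 2).mul (hp 0)).sub ((hr 0).mul (hp 2))).smul (hL 1))).add
    ((((hr 0).mul (hp 1)).sub ((hr 1).mul (hp 0))).smul (hL 2)))
  have hL₂ := hDi.smul ((((((hp 1).mul (hq 2)).sub ((hp 2).mul (hq 1))).smul (hL 0)).add
    ((((hp 2).mul (hq 0)).sub ((hp 0).mul (hq 2))).smul (hL 1))).add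
    ((((hp 0).mul (hq 1)).sub ((hp 1).mul (hq 0))).smul (hL 2)))
  have hVφ := ContMDiffAt.prodMk_space (contMDiffAt_const (c := (0 : E3)))
    (contMDiffAt_affDeriv hq)
  have hVψ := ContMDiffAt.prodMk_space (contMDiffAt_const (c := (0 : E3)))
    (contMDiffAt_affDeriv hr)
  have hWn : W ∩ {c | ε c.pt ≠ 0} ∈ 𝓝 c₀ := Filter.inter_mem (hW.mem_nhds hc₀W)
    (contMDiff_pt.continuous.continuousAt.eventually h0)
  have hσ : ∀ i, ContMDiffAt 𝓘(ℝ, E5) 𝓘(ℝ, ℝ) ∞ (fun c => (s i c).1.1 (ε c.pt)) c₀ :=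
    fun i => ((hs i) ε hε).1.contMDiffAt hWn
  have hτ : ∀ i, ContMDiffAt 𝓘(ℝ, E5) 𝓘(ℝ, ℝ) ∞ (fun c => (s i c).2.1 (ε c.pt)) c₀ :=
    fun i => ((hs i) ε hε).2.contMDiffAt hWn
  have ha₀ := ((hσ 0).mul (hσ 1)).mul (hσ 2)
  have ha₁ := (((((hσ 0).mul (hσ 1)).mul (hτ 2)).add (((hσ 0).mul (hτ 1)).mul (hσ 2))).add
    (((hτ 0).mul (hσ 1)).mul (hσ 2))).mul
    (contMDiffAt_const (I := 𝓘(ℝ, E5)) (I' := 𝓘(ℝ, ℝ)) (x := c₀) (c := (3 : ℝ)⁻¹))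
  have ha₂ := (((((hσ 0).mul (hτ 1)).mul (hτ 2)).add (((hτ 0).mul (hσ 1)).mul (hτ 2))).add
    (((hτ 0).mul (hτ 1)).mul (hσ 2)))
  have ha₃ := ((hτ 0).mul (hτ 1)).mul (hτ 2)
  refine ((((ha₀.smul hL₁).add (ha₁.smul hL₂)).add (ha₃.smul (hΘ.smul hVφ))).sub
    (ha₂.smul (hΘ.smul hVψ))).congr_of_eventuallyEq ?_
  filter_upwards [(chartAt E5 c₀).open_source.mem_nhds hc₀,
    contMDiff_pt.continuous.continuousAt.eventually hpos', hW.mem_nhds hc₀W] with c hc hcpos hcW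
  have hcD := (mem_regularSet_iff_wedge_ne_zero hc hcpos.choose).1 (hWU hcW)
  have hcε := apply_frameVec_ne_zero (chartFrame c₀) hc.1 hcpos.choose
  -- The vectors to be lifted are determined below by Cramer's rule.
  obtain ⟨E₁, hE₁⟩ := exists_isHorizontalLift cov c _
  obtain ⟨E₂, hE₂⟩ := exists_isHorizontalLift cov c _
  let g : Gauge o 𝔓 φ ψ c :=
    { cov := cov
      cov_mem := hcov
      p := normCovector c₀ c
      isRep := isRep_normCovector hc
      ε := ε c.pt
      isPos := hcpos
      Θ := wedge (normCovector c₀ c) ((φ c.pt).1 (ε c.pt)) ((ψ c.pt).1 (ε c.pt))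
        (chartVec c₀ c.pt) * (ε c.pt (chartVec c₀ c.pt))⁻¹
      wedge_eq := by
        obtain ⟨t, ht⟩ := exists_eq_smul_volForm hcpos.choose
          (wedge (normCovector c₀ c) ((φ c.pt).1 (ε c.pt)) ((ψ c.pt).1 (ε c.pt)))
        rw [ht, AlternatingMap.smul_apply, smul_eq_mul, mul_inv_cancel_right₀ hcε]
      e₁ := _
      e₂ := _
      dual := IsDualPair.of_wedge _ hcD
      E₁ := E₁
      E₂ := E₂
      lift₁ := hE₁
      lift₂ := hE₂ }
  rw [hZ ⟨c, hWU hcW⟩ hcW, twistedCubic_eq (c := ⟨c, hWU hcW⟩) g, g.equiv_tprod,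
    coordDeriv_combination g hc]
  change _ • liftCoords cov c₀ (normCovector c₀ c) (_ • (_ • _ + _ • _ + _ • _)) +
    _ • liftCoords cov c₀ (normCovector c₀ c) (_ • (_ • _ + _ • _ + _ • _)) + _ - _ = _
  rw [liftCoords_dual, liftCoords_dual]
  simp only [cubicCoeff, LinearMap.comp_apply, LinearEquiv.coe_coe, spinorEquiv_apply,
    LinearMap.fst_apply, LinearMap.snd_apply, Matrix.cons_val_zero, Matrix.cons_val_one,
    Matrix.cons_val]
  rw [mul_div_cancel₀ _ (three_ne_zero' ℝ)]
  rfl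

end LocalGauge

/-! ### The Levi form -/

section BracketInChart

variable {E N : Type*} [NormedAddCommGroup E] [NormedSpace ℝ E] [TopologicalSpace N]
  [ChartedSpace E N] [IsManifold 𝓘(ℝ, E) 1 N]

theorem inverse_mfderivWithin_extChartAt_symm {x : N} {y : E}
    (hy : y ∈ (extChartAt 𝓘(ℝ, E) x).target) :
    (mfderivWithin 𝓘(ℝ, E) 𝓘(ℝ, E) (extChartAt 𝓘(ℝ, E) x).symm (range 𝓘(ℝ, E)) y).inverse =
      mfderiv 𝓘(ℝ, E) 𝓘(ℝ, E) (extChartAt 𝓘(ℝ, E) x) ((extChartAt 𝓘(ℝ, E) x).symm y) :=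
  ContinuousLinearMap.inverse_eq (mfderivWithin_extChartAt_symm_comp_mfderiv_extChartAt hy)
    (mfderiv_extChartAt_comp_mfderivWithin_extChartAt_symm hy)

/-- The Lie bracket of vector fields, computed in the preferred chart around the point. -/
theorem mfderiv_extChartAt_mlieBracket (V W : ∀ x : N, TangentSpace 𝓘(ℝ, E) x) (x : N) :
    mfderiv 𝓘(ℝ, E) 𝓘(ℝ, E) (extChartAt 𝓘(ℝ, E) x) x
        (VectorField.mlieBracket 𝓘(ℝ, E) V W x) =
      VectorField.lieBracket ℝ
        (fun y : E => (mfderiv 𝓘(ℝ, E) 𝓘(ℝ, E) (extChartAt 𝓘(ℝ, E) x)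
          ((extChartAt 𝓘(ℝ, E) x).symm y) (V ((extChartAt 𝓘(ℝ, E) x).symm y)) : E))
        (fun y : E => (mfderiv 𝓘(ℝ, E) 𝓘(ℝ, E) (extChartAt 𝓘(ℝ, E) x)
          ((extChartAt 𝓘(ℝ, E) x).symm y) (W ((extChartAt 𝓘(ℝ, E) x).symm y)) : E))
        (extChartAt 𝓘(ℝ, E) x x) := by
  rw [← VectorField.mlieBracketWithin_univ, VectorField.mlieBracketWithin_apply]
  have h1 : (mfderiv 𝓘(ℝ, E) 𝓘(ℝ, E) (extChartAt 𝓘(ℝ, E) x) x).IsInvertible :=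
    isInvertible_mfderiv_extChartAt (mem_extChartAt_source x)
  refine (h1.self_apply_inverse _).trans ?_
  have h2 : (extChartAt 𝓘(ℝ, E) x).symm ⁻¹' univ ∩ range 𝓘(ℝ, E) = univ := by simp
  rw [h2]
  refine (congrFun (VectorField.lieBracketWithin_univ (𝕜 := ℝ) (E := E)) _).trans ?_
  have h3 : ∀ U : ∀ x : N, TangentSpace 𝓘(ℝ, E) x,
      (VectorField.mpullbackWithin 𝓘(ℝ, E) 𝓘(ℝ, E) (extChartAt 𝓘(ℝ, E) x).symm U
        (range 𝓘(ℝ, E)) : E → E) =ᶠ[𝓝 (extChartAt 𝓘(ℝ, E) x x)]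
      fun y : E => (mfderiv 𝓘(ℝ, E) 𝓘(ℝ, E) (extChartAt 𝓘(ℝ, E) x)
          ((extChartAt 𝓘(ℝ, E) x).symm y) (U ((extChartAt 𝓘(ℝ, E) x).symm y)) : E) := by
    intro U
    filter_upwards [extChartAt_target_mem_nhds (I := 𝓘(ℝ, E)) x] with y hy
    exact congrArg (fun L => L (U ((extChartAt 𝓘(ℝ, E) x).symm y)))
      (inverse_mfderivWithin_extChartAt_symm hy)
  exact (h3 V).lieBracket_vectorField_eq (h3 W)

end BracketInChart

section ContactForm

/-- The value at `y = (x, a, b)` on the vector `v` of the contact form `θ = dx⁰ + a dx¹ + b dx²`, in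
the coordinates of an affine chart with the linear change of coordinates `A`. -/
def contactForm (A : E3 ≃L[ℝ] E3) (y v : E5) : ℝ := affineCovector y.2.1 y.2.2 (A.symm v.1)

/-- The value `(D_uθ)(v)` of the derivative of the contact form in the direction `u`, that is
`(da ⊗ dx¹ + db ⊗ dx²)(u, v)`. -/
def contactFormDeriv (A : E3 ≃L[ℝ] E3) (u v : E5) : ℝ :=
  u.2.1 * A.symm v.1 1 + u.2.2 * A.symm v.1 2

theorem contactForm_fderiv {A : E3 ≃L[ℝ] E3} {W : E5 → E5} {y : E5} (hW : DifferentiableAt ℝ W y)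
    (h : ∀ᶠ z in 𝓝 y, contactForm A z (W z) = 0) (u : E5) :
    contactForm A y (fderiv ℝ W y u) = -contactFormDeriv A u (W y) := by
  let K : Fin 3 → E5 →L[ℝ] ℝ := fun i => (EuclideanSpace.proj (𝕜 := ℝ) i).comp
    ((A.symm : E3 →L[ℝ] E3).comp (ContinuousLinearMap.fst ℝ E3 (ℝ × ℝ)))
  let a : E5 →L[ℝ] ℝ := (ContinuousLinearMap.fst ℝ ℝ ℝ).comp (ContinuousLinearMap.snd ℝ E3 (ℝ × ℝ))
  let b : E5 →L[ℝ] ℝ := (ContinuousLinearMap.snd ℝ ℝ ℝ).comp (ContinuousLinearMap.snd ℝ E3 (ℝ × ℝ))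
  have hK : ∀ i, HasFDerivAt (fun z => K i (W z)) ((K i).comp (fderiv ℝ W y)) y :=
    fun i => (K i).hasFDerivAt.comp y hW.hasFDerivAt
  have h1 : HasFDerivAt (fun z => K 0 (W z) + a z * K 1 (W z) + b z * K 2 (W z)) _ y :=
    ((hK 0).add (a.hasFDerivAt.mul (hK 1))).add (b.hasFDerivAt.mul (hK 2))
  have h2 : HasFDerivAt (fun z => K 0 (W z) + a z * K 1 (W z) + b z * K 2 (W z))
      (0 : E5 →L[ℝ] ℝ) y :=
    (hasFDerivAt_const (0 : ℝ) y).congr_of_eventuallyEq (by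
      filter_upwards [h] with z hz using hz)
  have h3 : K 0 (fderiv ℝ W y u) + (a y * K 1 (fderiv ℝ W y u) + K 1 (W y) * a u)
      + (b y * K 2 (fderiv ℝ W y u) + K 2 (W y) * b u) = 0 :=
    congrArg (fun L => L u) (h1.unique h2)
  change K 0 (fderiv ℝ W y u) + a y * K 1 (fderiv ℝ W y u) + b y * K 2 (fderiv ℝ W y u) =
    -(a u * K 1 (W y) + b u * K 2 (W y))
  linear_combination h3

/-- For fields `V`, `W` in the kernel of `θ` one has `θ([V, W]) = (D_Wθ)(V) - (D_Vθ)(W)`, which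
depends only on the values of `V` and `W` at the point. -/
theorem contactForm_lieBracket {A : E3 ≃L[ℝ] E3} {V W : E5 → E5} {y : E5}
    (hV : DifferentiableAt ℝ V y) (hW : DifferentiableAt ℝ W y)
    (hV0 : ∀ᶠ z in 𝓝 y, contactForm A z (V z) = 0)
    (hW0 : ∀ᶠ z in 𝓝 y, contactForm A z (W z) = 0) :
    contactForm A y (VectorField.lieBracket ℝ V W y) =
      contactFormDeriv A (W y) (V y) - contactFormDeriv A (V y) (W y) := by
  have h : contactForm A y (VectorField.lieBracket ℝ V W y) =
      contactForm A y (fderiv ℝ W y (V y)) - contactForm A y (fderiv ℝ V y (W y)) := by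
    simp only [contactForm, VectorField.lieBracket, Prod.fst_sub, map_sub]
  rw [h, contactForm_fderiv hW hW0, contactForm_fderiv hV hV0]
  ring

end ContactForm

section LeviForm
variable {M : Type*} [TopologicalSpace M] [ChartedSpace E3 M] [IsManifold (𝓡 3) ∞ M]

theorem mlieBracket_frameVec (x₀ : M) (A : E3 ≃L[ℝ] E3) (i j : Fin 3) :
    VectorField.mlieBracket (𝓡 3) (fun x => frameVec x₀ A x i) (fun x => frameVec x₀ A x j) x₀ =
      0 := by
  have hx₀ := mem_chart_source E3 x₀
  have : IsManifold 𝓘(ℝ, E3) 1 M := IsManifold.of_le (n := ∞) (by simp)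
  have h1 := mfderiv_extChartAt_mlieBracket (fun x => frameVec x₀ A x i)
    (fun x => frameVec x₀ A x j) x₀
  have h2 : ∀ k, (fun y : E3 => (mfderiv 𝓘(ℝ, E3) 𝓘(ℝ, E3) (extChartAt 𝓘(ℝ, E3) x₀)
      ((extChartAt 𝓘(ℝ, E3) x₀).symm y) (frameVec x₀ A ((extChartAt 𝓘(ℝ, E3) x₀).symm y) k) : E3))
      =ᶠ[𝓝 (extChartAt 𝓘(ℝ, E3) x₀ x₀)] fun _ => A (EuclideanSpace.single k 1) := by
    intro k
    filter_upwards [extChartAt_target_mem_nhds (I := 𝓘(ℝ, E3)) x₀] with y hy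
    have hy' := (extChartAt 𝓘(ℝ, E3) x₀).map_target hy
    rw [extChartAt_source] at hy'
    exact (congrArg (fun L => L (frameVec x₀ A ((extChartAt 𝓘(ℝ, E3) x₀).symm y) k))
      (mfderiv_chartAt_eq hy')).trans (tangentCoordChange_frameVec A hy' k)
  rw [(h2 i).lieBracket_vectorField_eq (h2 j)] at h1
  have h3 : (mfderiv 𝓘(ℝ, E3) 𝓘(ℝ, E3) (extChartAt 𝓘(ℝ, E3) x₀) x₀).IsInvertible :=
    isInvertible_mfderiv_extChartAt (mem_extChartAt_source x₀)
  refine h3.injective (h1.trans ?_)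
  rw [map_zero]
  simp [VectorField.lieBracket]
  rfl

/-- The Christoffel symbols of a torsion-free connection are symmetric. -/
theorem sum_frameCoord_connection {cov : Connection M} (hcov : cov.torsion = 0) (x₀ : M)
    (A : E3 ≃L[ℝ] E3) (X Y : TangentSpace (𝓡 3) x₀) :
    ∑ k, frameCoord x₀ A x₀ X k • cov (fun y => frameVec x₀ A y k) x₀ Y =
      ∑ k, frameCoord x₀ A x₀ Y k • cov (fun y => frameVec x₀ A y k) x₀ X := by
  have hx₀ := mem_chart_source E3 x₀
  have hs : ∀ i j, cov (fun y => frameVec x₀ A y i) x₀ (frameVec x₀ A x₀ j) =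
      cov (fun y => frameVec x₀ A y j) x₀ (frameVec x₀ A x₀ i) := by
    intro i j
    have := (CovariantDerivative.torsion_eq_zero_iff cov).1 hcov (diffFieldAt_frameVec A hx₀ j)
      (diffFieldAt_frameVec A hx₀ i)
    rw [mlieBracket_frameVec] at this
    exact sub_eq_zero.1 this
  have h : ∀ (X : TangentSpace (𝓡 3) x₀) (k), cov (fun y => frameVec x₀ A y k) x₀ X =
      ∑ j, frameCoord x₀ A x₀ X j • cov (fun y => frameVec x₀ A y k) x₀ (frameVec x₀ A x₀ j) := by
    intro X k
    conv_lhs => rw [← sum_frameCoord A hx₀ X]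
    rw [map_sum]
    exact Finset.sum_congr rfl fun j _ => map_smul _ _ _
  simp only [h X, h Y, Finset.smul_sum]
  rw [Finset.sum_comm]
  refine Finset.sum_congr rfl fun i _ => Finset.sum_congr rfl fun j _ => ?_
  rw [hs j i, smul_comm]

theorem contactForm_coordDeriv {c₀ c : ConfigSpace M} (hc : c ∈ (chartAt E5 c₀).source)
    (v : TangentSpace 𝓘(ℝ, E5) c) :
    contactForm (chartFrame c₀) (extChartAt 𝓘(ℝ, E5) c₀ c) (coordDeriv c₀ c v) =
      normCovector c₀ c (ptDeriv c v) := by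
  rw [contactForm, coordDeriv_fst hc]
  rfl

/-- Because `p(X) = 0`, the pairing of a velocity of `[p]` with a horizontal component `X` is the
natural pairing of a covector with `X`. -/
theorem contactFormDeriv_affDeriv {c : ConfigSpace M} {X : TangentSpace (𝓡 3) c.pt}
    (hX : normCovector c c X = 0) (z : E3) (w : Fin 3 → ℝ) (q : ℝ × ℝ) :
    contactFormDeriv (chartFrame c)
      (z, affDeriv (fun i => normCovector c c (chartVec c c.pt i)) w)
      (tangentCoordChange (𝓡 3) c.pt c.pt c.pt X, q) =
      ∑ k, frameCoord c.pt (chartFrame c) c.pt X k * w k := by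
  rw [normCovector_apply] at hX
  simp only [contactFormDeriv, affDeriv, normCovector_chartVec (mem_chart_source E5 c),
    Fin.sum_univ_three]
  simp only [Matrix.cons_val_zero, Matrix.cons_val_one, Matrix.cons_val, one_pow, div_one, mul_one]
  change (w 1 - _ * w 0) * frameCoord c.pt (chartFrame c) c.pt X 1 +
    (w 2 - _ * w 0) * frameCoord c.pt (chartFrame c) c.pt X 2 = _
  linear_combination (-w 0) * hX

theorem coordDeriv_lift_add_vertical {cov : Connection M} {c : ConfigSpace M}
    {X : TangentSpace (𝓡 3) c.pt} {E : TangentSpace 𝓘(ℝ, E5) c} (hE : IsHorizontalLift cov c X E)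
    {p : Cotangent c.pt} (hp : c.IsRep p) (ν : Cotangent c.pt) :
    coordDeriv c c (E + verticalVector c p ν) =
      ((tangentCoordChange (𝓡 3) c.pt c.pt c.pt X, affDeriv (fun i => p (chartVec c c.pt i))
        fun i => p (cov (fun y => chartVec c y i) c.pt X) + ν (chartVec c c.pt i)) : E5) := by
  have hc := mem_chart_source E5 c
  rw [map_add, coordDeriv_of_isHorizontalLift hc hE hp, coordDeriv_verticalVector hc hp,
    liftCoords]
  refine congrArg₂ Prod.mk (add_zero _) ?_
  exact (affDeriv_add _ _ _).symm

/-- The Levi form on sums of a horizontal lift and a vertical vector. Two horizontal lifts do not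
contribute since the connection is torsion-free, nor do two vertical vectors, and what remains is
the pairing of the covectors with the vectors. -/
theorem levi_lift_add_vertical {cov : Connection M} (hcov : cov.torsion = 0) {c : ConfigSpace M}
    {W : Set (ConfigSpace M)} (hW : IsOpen W) (hcW : c ∈ W)
    {X Y : ∀ c : ConfigSpace M, TangentSpace 𝓘(ℝ, E5) c}
    (hX : SmoothConfigFieldOn X W) (hY : SmoothConfigFieldOn Y W)
    (hXH : ∀ d ∈ W, X d ∈ contactH d) (hYH : ∀ d ∈ W, Y d ∈ contactH d)
    {v w : TangentSpace (𝓡 3) c.pt} (hv : normCovector c c v = 0) (hw : normCovector c c w = 0)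
    {E F : TangentSpace 𝓘(ℝ, E5) c} (hE : IsHorizontalLift cov c v E)
    (hF : IsHorizontalLift cov c w F) {μ ν : Cotangent c.pt}
    (hXc : X c = E + verticalVector c (normCovector c c) μ)
    (hYc : Y c = F + verticalVector c (normCovector c c) ν) :
    normCovector c c (ptDeriv c (VectorField.mlieBracket 𝓘(ℝ, E5) X Y c)) = ν v - μ w := by
  have hc := mem_chart_source E5 c
  have hrep := isRep_normCovector hc
  have : IsManifold 𝓘(ℝ, E5) 1 (ConfigSpace M) := IsManifold.of_le (n := ∞) (by simp)
  have hsymm : ContMDiffAt 𝓘(ℝ, E5) 𝓘(ℝ, E5) ∞ (extChartAt 𝓘(ℝ, E5) c).symm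
      (extChartAt 𝓘(ℝ, E5) c c) :=
    (contMDiffOn_extChartAt_symm c).contMDiffAt (extChartAt_target_mem_nhds c)
  have hleft : (extChartAt 𝓘(ℝ, E5) c).symm (extChartAt 𝓘(ℝ, E5) c c) = c :=
    extChartAt_to_inv c
  have hev : ∀ᶠ y in 𝓝 (extChartAt 𝓘(ℝ, E5) c c), y ∈ (extChartAt 𝓘(ℝ, E5) c).target ∧
      (extChartAt 𝓘(ℝ, E5) c).symm y ∈ W :=
    Filter.Eventually.and (extChartAt_target_mem_nhds c)
      (hsymm.continuousAt.eventually (by rw [hleft]; exact hW.mem_nhds hcW))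
  have hd : ∀ Z : ∀ c : ConfigSpace M, TangentSpace 𝓘(ℝ, E5) c, SmoothConfigFieldOn Z W →
      DifferentiableAt ℝ (fun y : E5 => coordDeriv c ((extChartAt 𝓘(ℝ, E5) c).symm y)
        (Z ((extChartAt 𝓘(ℝ, E5) c).symm y))) (extChartAt 𝓘(ℝ, E5) c c) := by
    intro Z hZ
    have h1 := (contMDiffAt_configField_iff c).1 (hZ.contMDiffAt (hW.mem_nhds hcW))
    rw [← hleft] at h1
    have h2 := ContMDiffAt.comp (extChartAt 𝓘(ℝ, E5) c c)
      (g := fun d => coordDeriv c d (Z d)) (by simpa only [hleft] using h1) hsymm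
    exact h2.contDiffAt.differentiableAt (by simp)
  have hcon : ∀ Z : ∀ c : ConfigSpace M, TangentSpace 𝓘(ℝ, E5) c, (∀ d ∈ W, Z d ∈ contactH d) →
      ∀ᶠ y in 𝓝 (extChartAt 𝓘(ℝ, E5) c c), contactForm (chartFrame c) y
        (coordDeriv c ((extChartAt 𝓘(ℝ, E5) c).symm y)
          (Z ((extChartAt 𝓘(ℝ, E5) c).symm y))) = 0 := by
    intro Z hZ
    filter_upwards [hev] with y hy
    have hys : (extChartAt 𝓘(ℝ, E5) c).symm y ∈ (chartAt E5 c).source := by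
      have := (extChartAt 𝓘(ℝ, E5) c).map_target hy.1
      rwa [extChartAt_source] at this
    have h1 := contactForm_coordDeriv hys (Z ((extChartAt 𝓘(ℝ, E5) c).symm y))
    rw [(extChartAt 𝓘(ℝ, E5) c).right_inv hy.1] at h1
    rw [h1, ← mem_contactH_iff (isRep_normCovector hys)]
    exact hZ _ hy.2
  have h1 := contactForm_lieBracket (hd X hX) (hd Y hY) (hcon X hXH) (hcon Y hYH)
  rw [← contactForm_coordDeriv hc]
  have h2 := mfderiv_extChartAt_mlieBracket X Y c
  have h3 : contactForm (chartFrame c) (extChartAt 𝓘(ℝ, E5) c c)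
      (coordDeriv c c (VectorField.mlieBracket 𝓘(ℝ, E5) X Y c)) = _ :=
    (congrArg (contactForm (chartFrame c) (extChartAt 𝓘(ℝ, E5) c c)) h2).trans h1
  refine h3.trans ?_
  rw [hleft, hXc, hYc, coordDeriv_lift_add_vertical hE hrep, coordDeriv_lift_add_vertical hF hrep,
    contactFormDeriv_affDeriv hv, contactFormDeriv_affDeriv hw]
  have h4 := congrArg (normCovector c c)
    (sum_frameCoord_connection hcov c.pt (chartFrame c) v w)
  have h5 := congrArg ν (sum_frameCoord (chartFrame c) hc.1 v)
  have h6 := congrArg μ (sum_frameCoord (chartFrame c) hc.1 w)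
  simp only [map_sum, map_smul, smul_eq_mul] at h4 h5 h6
  simp only [mul_add, Finset.sum_add_distrib]
  rw [h4, h5, h6]
  ring

end LeviForm

/-! ### The twisted cubic and the regular set -/

section TwistedCubic
variable {M : Type*} [TopologicalSpace M] [ChartedSpace E3 M] [IsManifold (𝓡 3) ∞ M]
  {o : ManifoldOrientation M} {𝔓 : ProjectiveStructure M}
  {φ : ∀ x : M, WeightedCovector 2 x} {ψ : ∀ x : M, WeightedCovector 1 x}

theorem IsHorizontalLift.eq_add {cov : Connection M} {c : ConfigSpace M}
    {v w : TangentSpace (𝓡 3) c.pt} {E F G : TangentSpace 𝓘(ℝ, E5) c} {a b : ℝ}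
    (hE : IsHorizontalLift cov c v E) (hF : IsHorizontalLift cov c w F)
    (hG : IsHorizontalLift cov c (a • v + b • w) G) : G = a • E + b • F := by
  have hc := mem_chart_source E5 c
  apply coordDeriv_injective hc
  rw [map_add, map_smul, map_smul, coordDeriv_of_isHorizontalLift hc hE (isRep_covector c),
    coordDeriv_of_isHorizontalLift hc hF (isRep_covector c),
    coordDeriv_of_isHorizontalLift hc hG (isRep_covector c), liftCoords_add, liftCoords_smul,
    liftCoords_smul]

/-- The vectors in the formula, split into a horizontal and a vertical part. -/
theorem Gauge.exists_combination_eq_add {c : ConfigSpace M} (g : Gauge o 𝔓 φ ψ c)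
    (a : Fin 4 → ℝ) : ∃ E, IsHorizontalLift g.cov c (a 0 • g.e₁ + a 1 • g.e₂) E ∧
      g.combination a = E +
        verticalVector c g.p ((g.Θ * a 3) • g.φval + (-(3 * g.Θ * a 2)) • g.ψval) := by
  obtain ⟨E, hE⟩ := exists_isHorizontalLift g.cov c (a 0 • g.e₁ + a 1 • g.e₂)
  refine ⟨E, hE, ?_⟩
  rw [IsHorizontalLift.eq_add g.lift₁ g.lift₂ hE, g.combination_apply, verticalVector_add g.isRep,
    verticalVector_smul g.isRep, verticalVector_smul g.isRep]
  module

/-- The area form `σ τ' - τ σ'` on `S_c`, for the values of the spinors in the scale `ε`. -/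
def spinorArea (c : ConfigSpace M) {ε : VolForm c.pt} (hε : ε ≠ 0) :
    Spinor c [⋀^Fin 2]→ₗ[ℝ] ℝ :=
  Matrix.detRowAlternating.compLinearMap (LinearMap.pi
    ![(LinearMap.fst ℝ ℝ ℝ).comp (spinorEquiv c hε).toLinearMap,
      (LinearMap.snd ℝ ℝ ℝ).comp (spinorEquiv c hε).toLinearMap])

theorem spinorArea_apply (c : ConfigSpace M) {ε : VolForm c.pt} (hε : ε ≠ 0) (s t : Spinor c) :
    spinorArea c hε ![s, t] = s.1.1 ε * t.2.1 ε - s.2.1 ε * t.1.1 ε := by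
  refine (Matrix.det_fin_two (Matrix.of fun i j =>
    (![(LinearMap.fst ℝ ℝ ℝ).comp (spinorEquiv c hε).toLinearMap,
      (LinearMap.snd ℝ ℝ ℝ).comp (spinorEquiv c hε).toLinearMap] j) (![s, t] i))).trans ?_
  simp [spinorEquiv_apply]

/-- For the cubes of `s = (σ, τ)` and `t = (σ', τ')` the Levi form takes the value
`Θ (σ³τ'³ - 3σ²τσ'τ'² + 3στ²σ'²τ' - τ³σ'³) = Θ (στ' - τσ')³`. -/
theorem levi_twistedCubic (c : regularSet φ ψ) :
    ∃ ν : Spinor c.1 [⋀^Fin 2]→ₗ[ℝ] ℝ, ν ≠ 0 ∧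
    ∃ l : TangentSpace 𝓘(ℝ, E5) c.1, l ∉ contactH c.1 ∧
    ∀ W : Set (ConfigSpace M), IsOpen W → c.1 ∈ W →
    ∀ X Y : ∀ c : ConfigSpace M, TangentSpace 𝓘(ℝ, E5) c,
    SmoothConfigFieldOn X W → SmoothConfigFieldOn Y W →
    (∀ d ∈ W, X d ∈ contactH d) → (∀ d ∈ W, Y d ∈ contactH d) →
    ∀ s t : Spinor c.1, X c.1 = twistedCubic o 𝔓 φ ψ c (cube s) →
      Y c.1 = twistedCubic o 𝔓 φ ψ c (cube t) →
      VectorField.mlieBracket 𝓘(ℝ, E5) X Y c.1 - (ν ![s, t]) ^ 3 • l ∈ contactH c.1 := by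
  obtain ⟨g, hg⟩ := exists_gauge o 𝔓 c.2 (isRep_normCovector (mem_chart_source E5 c.1))
  obtain ⟨e₀, he₀, -⟩ := g.dual.exists_complement g.isRep.1
  obtain ⟨l, hl⟩ := exists_isHorizontalLift g.cov c.1 (g.Θ • e₀)
  have hpl : g.p (ptDeriv c.1 l) = g.Θ := by
    rw [ptDeriv_of_isHorizontalLift hl, map_smul, he₀, smul_eq_mul, mul_one]
  refine ⟨spinorArea c.1 g.ε_ne_zero, fun h => ?_, l, ?_, ?_⟩
  · have h1 := spinorArea_apply c.1 g.ε_ne_zero ((spinorEquiv c.1 g.ε_ne_zero).symm (1, 0))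
      ((spinorEquiv c.1 g.ε_ne_zero).symm (0, 1))
    have h2 := (spinorEquiv c.1 g.ε_ne_zero).apply_symm_apply (1, 0)
    have h3 := (spinorEquiv c.1 g.ε_ne_zero).apply_symm_apply (0, 1)
    rw [spinorEquiv_apply, Prod.mk.injEq] at h2 h3
    rw [h2.1, h2.2, h3.1, h3.2, h] at h1
    simp at h1
  · rw [mem_contactH_iff g.isRep, hpl]
    exact g.Θ_ne_zero
  · intro W hW hcW X Y hX hY hXH hYH s t hs ht
    rw [twistedCubic_eq g, cube, g.equiv_tprod] at hs ht
    obtain ⟨E, hE, hE'⟩ := g.exists_combination_eq_add (cubicCoeff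
      ((LinearMap.fst ℝ ℝ ℝ).comp (spinorEquiv c.1 g.ε_ne_zero).toLinearMap)
      ((LinearMap.snd ℝ ℝ ℝ).comp (spinorEquiv c.1 g.ε_ne_zero).toLinearMap) fun _ => s)
    obtain ⟨F, hF, hF'⟩ := g.exists_combination_eq_add (cubicCoeff
      ((LinearMap.fst ℝ ℝ ℝ).comp (spinorEquiv c.1 g.ε_ne_zero).toLinearMap)
      ((LinearMap.snd ℝ ℝ ℝ).comp (spinorEquiv c.1 g.ε_ne_zero).toLinearMap) fun _ => t)
    rw [hE', hg] at hs
    rw [hF', hg] at ht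
    have hker : ∀ a b : ℝ, normCovector c.1 c.1 (a • g.e₁ + b • g.e₂) = 0 := by
      intro a b
      rw [← hg]
      simp [g.dual.p₁, g.dual.p₂]
    have key := levi_lift_add_vertical (𝔓.isSmoothTorsionFree _ g.cov_mem).2 hW hcW hX hY hXH hYH
      (hker _ _) (hker _ _) hE hF hs ht
    rw [mem_contactH_iff g.isRep, map_sub, map_sub, map_smul, map_smul, hpl, hg, key,
      spinorArea_apply]
    simp only [cubicCoeff, LinearMap.comp_apply, LinearEquiv.coe_coe, spinorEquiv_apply,
      LinearMap.fst_apply, LinearMap.snd_apply, Matrix.cons_val_zero, Matrix.cons_val_one,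
      Matrix.cons_val, _root_.add_apply, _root_.smul_apply, map_add,
      map_smul, smul_eq_mul, g.dual.q₁, g.dual.q₂, g.dual.r₁, g.dual.r₂]
    ring

theorem exists_ne_zero_apply_eq_zero (u v : E3) : ∃ p : E3 →L[ℝ] ℝ, p ≠ 0 ∧ p u = 0 ∧ p v = 0 := by
  obtain ⟨f, hf, hle⟩ : ∃ f : Module.Dual ℝ E3, f ≠ 0 ∧
      Submodule.span ℝ (Set.range ![u, v]) ≤ LinearMap.ker f := by
    refine Submodule.exists_le_ker_of_lt_top _ (lt_top_iff_ne_top.2 fun h => ?_)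
    have h3 := finrank_range_le_card (R := ℝ) ![u, v]
    rw [Set.finrank, h, finrank_top, finrank_euclideanSpace_fin, Fintype.card_fin] at h3
    omega
  exact ⟨LinearMap.toContinuousLinearMap f, by simpa using hf,
    hle (Submodule.subset_span ⟨0, rfl⟩), hle (Submodule.subset_span ⟨1, rfl⟩)⟩

theorem image_pt_regularSet (φ : ∀ x : M, WeightedCovector 2 x)
    (ψ : ∀ x : M, WeightedCovector 1 x) : ConfigSpace.pt '' regularSet φ ψ =
      {x | ∀ ε : VolForm x, ε ≠ 0 → LinearIndependent ℝ ![(φ x).1 ε, (ψ x).1 ε]} := by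
  ext x
  constructor
  · rintro ⟨c, hc, rfl⟩ ε hε
    refine LinearIndependent.pair_iff.2 fun s t hst =>
      LinearIndependent.pair_iff.1 (hc ε hε) s t (LinearMap.ext fun v => ?_)
    exact congrArg (fun L : Cotangent c.pt => L v.1) hst
  · intro hx
    obtain ⟨ε, hε⟩ : ∃ ε : VolForm x, ε ≠ 0 :=
      ⟨frameVol x (ContinuousLinearEquiv.refl ℝ E3) x, fun h => by
        have := frameVol_frameVec (ContinuousLinearEquiv.refl ℝ E3) (mem_chart_source E3 x)
        rw [h] at this
        exact zero_ne_one this⟩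
    have h : LinearIndependent ℝ ![((φ x).1 ε).toLinearMap, ((ψ x).1 ε).toLinearMap] := by
      refine LinearIndependent.pair_iff.2 fun s t hst =>
        LinearIndependent.pair_iff.1 (hx ε hε) s t (ContinuousLinearMap.ext fun v => ?_)
      exact congrArg (fun L => L v) hst
    obtain ⟨e₁, h₁, h₁'⟩ := exists_apply_eq_one_of_linearIndependent h
    obtain ⟨e₂, h₂, h₂'⟩ :=
      exists_apply_eq_one_of_linearIndependent (LinearIndependent.pair_symm_iff.1 h)
    obtain ⟨p, hp, hp₁, hp₂⟩ : ∃ p : Cotangent x, p ≠ 0 ∧ p e₁ = 0 ∧ p e₂ = 0 :=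
      exists_ne_zero_apply_eq_zero e₁ e₂
    exact ⟨saucer x p, (mem_regularSet_iff (c := saucer x p) (ε := ε) hε ⟨hp, rfl⟩).2
      ⟨e₁, e₂, hp₁, h₁, h₁', hp₂, h₂', h₂⟩, rfl⟩

end TwistedCubic

end FlyingSaucer

end

theorem theorem4p2 {M : Type*} [TopologicalSpace M] [T2Space M]
    [ChartedSpace (EuclideanSpace ℝ (Fin 3)) M] [IsManifold (𝓡 3) ∞ M]
    (o : ManifoldOrientation M) (𝔓 : ProjectiveStructure M)
    (φ : ∀ x : M, WeightedCovector 2 x) (hφ : SmoothWeightedForm φ)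
    (hKilling : ∀ cov ∈ 𝔓.connections, KillingEquation cov φ)
    (ψ : ∀ x : M, WeightedCovector 1 x) (hψ : SmoothWeightedForm ψ) :
    IsOpen (regularSet φ ψ) ∧
    ConfigSpace.pt '' regularSet φ ψ =
      {x | ∀ ε : VolForm x, ε ≠ 0 → LinearIndependent ℝ ![(φ x).1 ε, (ψ x).1 ε]} ∧
    ∃! Φ : ∀ c : regularSet φ ψ, Sym[ℝ]^3 (Spinor c.1) ≃ₗ[ℝ] contactH c.1,
      IsG2ContactStructure (regularSet φ ψ) Φ ∧
      ∀ c : regularSet φ ψ, ∀ cov ∈ 𝔓.connections,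
      ∀ p : Cotangent c.1.pt, c.1.IsRep p → ∀ ε : VolForm c.1.pt, o.IsPos ε →
      ∀ Θ : ℝ, wedge p ((φ c.1.pt).1 ε) ((ψ c.1.pt).1 ε) = Θ • ε →
      ∀ e₁ e₂ : TangentSpace (𝓡 3) c.1.pt,
      p e₁ = 0 → (φ c.1.pt).1 ε e₁ = 1 → (ψ c.1.pt).1 ε e₁ = 0 →
      p e₂ = 0 → (φ c.1.pt).1 ε e₂ = 0 → (ψ c.1.pt).1 ε e₂ = 1 →
      ∀ E₁ E₂ : TangentSpace 𝓘(ℝ, E5) c.1,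
      IsHorizontalLift cov c.1 e₁ E₁ → IsHorizontalLift cov c.1 e₂ E₂ →
      ∀ (σ : Density (2 / 3) c.1.pt) (τ : Density (-1 / 3) c.1.pt),
        (Φ c (cube (σ, τ)) : TangentSpace 𝓘(ℝ, E5) c.1) =
          σ.1 ε ^ 3 • E₁ + (σ.1 ε ^ 2 * τ.1 ε) • E₂ +
          τ.1 ε ^ 3 • Θ • verticalVector c.1 p ((φ c.1.pt).1 ε) -
          (3 * σ.1 ε * τ.1 ε ^ 2) • Θ • verticalVector c.1 p ((ψ c.1.pt).1 ε) := by
  refine ⟨isOpen_regularSet o hφ hψ, image_pt_regularSet φ ψ, twistedCubic o 𝔓 φ ψ,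
    ⟨⟨fun W hWU hW s hs Z hZ => smooth_twistedCubic hφ hψ hWU hW hs hZ, levi_twistedCubic⟩, ?_⟩,
    ?_⟩
  · intro c cov hcov p hp ε hε Θ hΘ e₁ e₂ hp₁ hq₁ hr₁ hp₂ hq₂ hr₂ E₁ E₂ h₁ h₂ σ τ
    let g : Gauge o 𝔓 φ ψ c.1 := ⟨cov, hcov, p, hp, ε, hε, Θ, hΘ, e₁, e₂,
      ⟨hp₁, hq₁, hr₁, hp₂, hq₂, hr₂⟩, E₁, E₂, h₁, h₂⟩
    rw [twistedCubic_eq g]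
    exact g.equiv_cube σ τ
  · rintro Φ ⟨-, hΦ⟩
    refine funext fun c => symPower_equiv_ext fun s => ?_
    obtain ⟨g, -⟩ := exists_gauge o 𝔓 c.2 (isRep_covector c.1)
    rw [twistedCubic_eq g]
    exact (hΦ c g.cov g.cov_mem g.p g.isRep g.ε g.isPos g.Θ g.wedge_eq g.e₁ g.e₂ g.dual.p₁
      g.dual.q₁ g.dual.r₁ g.dual.p₂ g.dual.q₂ g.dual.r₂ g.E₁ g.E₂ g.lift₁ g.lift₂
      s.1 s.2).trans (g.equiv_cube s.1 s.2).symm
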